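/- **Setting.** Graphs are simple directed unweighted graphs without loops on the vertex set $\{0,\dots,n-1\}$, $n\ge 1$. $d(u,v)\in\mathbb N\cup\{\infty\}$ is the length of a shortest directed path from $u$ to $v$, $\varepsilon(v)=\max_u d(v,u)$ is the eccentricity of $v$, and $R=\min_v\varepsilon(v)\in\mathbb N\cup\{\infty\}$ is the radius. An initial graph is given, and then new edges are inserted one after the other; $m$ is the final number of edges, $R_f$ is the final value of the radius, and $R_0$ is the largest finite value that it takes during the update sequence (the initial value, if that is finite). An incremental truncated SSSP algorithm $\mathcal A(u,k,\delta)$ is a deterministic data structure that maintains estimates $d'(u,v)\in[0,\infty]$ for all $v$ under edge insertions, starting from any initial graph, such that at any time $$(1-\delta)\,d(u,v)\le d'(u,v)\le d(u,v)\ \text{ if } d(u,v)\le k,\qquad d'(u,v)\ge(1-\delta)k\ \text{ if } d(u,v)>k .$$ After its start and after each insertion it outputs the vertices whose estimates have changed with the new estimates (an estimate never output is $\infty$), each output taking at least one time unit. It has total time $T_{inc}$ if each instance uses total time at most $T_{inc}(n,m,k,\delta)$, where $m$ is the final number of edges of its graph; $\mathcal A$ is needed only for $k\in\mathbb N_{\ge1}$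 and $\delta=1/a$ with $a\in\mathbb N_{\ge1}$. We assume that $T_{inc}$ grows polynomially: it is nondecreasing in $k$ and in $1/\delta$, and $T_{inc}(n,m,2k,\delta/2)\le K\,T_{inc}(n,m,k,\delta)$ for a constant $K$ (as for every polynomial in $n,m,k,1/\delta$ with nonnegative coefficients). Algorithms are programs of a word RAM with words of $O(\log(n+1/\epsilon))$ bits which can at any time start instances of $\mathcal A$ (used as a black box) on the current graph. The instances then process all later insertions, and the program reads their outputs, with each estimate rounded up to an integer and all estimates greater than $k$ read as $k+1$. The total time of the program includes the time of all instances of $\mathcal A$. The parameter $\epsilon$ is a real number, given to the program as the integer $\lceil 1/\epsilon\rceil$. **Theorem.** There is a deterministic algorithm for incremental radius in unweighted directed graphs that, for any $\epsilon$ with $0<\epsilon<2$ and any incremental truncated SSSP algorithm $\mathcal A$ with total time $T_{inc}$ as above, maintains an estimate $\hat R$ such that, initially and after every insertion, $$R\le\hat R\le(1+\epsilon)R,$$ where $R$ is the radius of the current graph (so $\hat R=\infty$ if and only if $R=\infty$), and that, if $m\ge1$, runs in total time $$\tilde O\Big(\max_{R'\in\mathbb N,\ R_f\le R'\le R_0}\Big\{\big(T_{inc}(n,m,2R',\epsilon)+m\big)\frac{n}{\epsilon^2R'}\Big\}+mn\Big),$$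 where the maximum is $0$ if the radius is infinite throughout. If the initial graph is strongly connected, the additive term $mn$ is not necessary. Here $\tilde O(f)$ means at most $C(1+\log n)^c f$ with an absolute constant $c$ and a constant $C$ that depends only on $K$. -/

import Mathlib

open scoped NNReal ENNReal

namespace IncRadius

/-! ### Directed graphs, distances, radius

A directed graph on the vertex set `Fin n` is given by the list of its edges. -/

/-- The list describes a simple directed graph: no edge occurs twice, and there are no loops. -/
def IsSimple {n : ℕ} (edges : List (Fin n × Fin n)) : Prop :=
  edges.Nodup ∧ ∀ e ∈ edges, e.1 ≠ e.2

/-- `Walk edges l u v`: there is a directed walk of length `l` from `u` to `v`. -/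
inductive Walk {n : ℕ} (edges : List (Fin n × Fin n)) : ℕ → Fin n → Fin n → Prop
  | nil (u : Fin n) : Walk edges 0 u u
  | snoc {l : ℕ} {u v w : Fin n} : Walk edges l u v → (v, w) ∈ edges → Walk edges (l + 1) u w

/-- The distance from `u` to `v`; it is `⊤` if `v` cannot be reached from `u`. -/
noncomputable def distance {n : ℕ} (edges : List (Fin n × Fin n)) (u v : Fin n) : ℕ∞ :=
  ⨅ (l : ℕ) (_ : Walk edges l u v), (l : ℕ∞)

/-- The (out-)eccentricity of `v`: the maximum of the distances from `v`. -/
noncomputable def eccentricity {n : ℕ} (edges : List (Fin n × Fin n)) (v : Fin n) : ℕ∞ :=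
  ⨆ u : Fin n, distance edges v u

/-- The radius: the minimum of the eccentricities. -/
noncomputable def radius {n : ℕ} (edges : List (Fin n × Fin n)) : ℕ∞ :=
  ⨅ v : Fin n, eccentricity edges v

/-- Every vertex can be reached from every vertex. -/
def StronglyConnected {n : ℕ} (edges : List (Fin n × Fin n)) : Prop :=
  ∀ u v : Fin n, ∃ l : ℕ, Walk edges l u v

/-! ### Black-box incremental truncated single-source shortest paths -/

/-- One instance of the black box, with its whole history: the source, the truncation depth `k`,
the accuracy `δ = 1 / acc`, the graph on which the instance was started, and the edges that have
been inserted since then, in chronological order. -/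
structure Instance (n : ℕ) where
  src : Fin n
  depth : ℕ
  acc : ℕ
  start : List (Fin n × Fin n)
  inserted : List (Fin n × Fin n)

namespace Instance

variable {n : ℕ}

/-- The edges of the current graph of the instance. -/
def edges (I : Instance n) : List (Fin n × Fin n) := I.start ++ I.inserted

/-- The same instance with one more insertion. -/
def extend (I : Instance n) (e : Fin n × Fin n) : Instance n :=
  { I with inserted := I.inserted ++ [e] }

/-- The same instance at the earlier time when only `i` insertions had been made. -/
def before (I : Instance n) (i : ℕ) : Instance n :=
  { I with inserted := I.inserted.take i }

/-- The histories on which the black box has to work. -/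
def Admissible (I : Instance n) : Prop :=
  1 ≤ I.depth ∧ 1 ≤ I.acc ∧ IsSimple I.edges

end Instance

/-- A deterministic incremental data structure: `output I` is the list of the vertices (with their
new distance estimates) that it reports in response to the last event of the history `I` (the last
insertion, or the start if nothing has been inserted yet), and `cost I` is the time that it spends
on that event. -/
structure BlackBox where
  output : {n : ℕ} → Instance n → List (Fin n × ℝ≥0∞)
  cost : {n : ℕ} → Instance n → ℕ

namespace BlackBox

variable (A : BlackBox) {n : ℕ}

/-- Everything that has been reported so far, in chronological order. -/
def reports (I : Instance n) : List (Fin n × ℝ≥0∞) :=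
  (List.range (I.inserted.length + 1)).flatMap fun i => A.output (I.before i)

/-- The current estimate for `v`: the last one reported, and `⊤` if there was none. -/
noncomputable def estimate (I : Instance n) (v : Fin n) : ℝ≥0∞ :=
  (((A.reports I).reverse.find? fun p => p.1 = v).map Prod.snd).getD ⊤

/-- The time that the instance has used so far. -/
def totalCost (I : Instance n) : ℕ :=
  ∑ i ∈ Finset.range (I.inserted.length + 1), A.cost (I.before i)

/-- At any time, if the distance `d` from the source to `v` is at most the truncation depth `k`,
then the estimate of `v` lies between `(1 - δ) d` and `d`, and if `d` exceeds `k`, then the estimate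
is at least `(1 - δ) k` (in particular it may be infinite). -/
def Correct : Prop :=
  ∀ (n : ℕ) (I : Instance n), I.Admissible → ∀ v : Fin n,
    (distance I.edges I.src v ≤ I.depth →
      (1 - (I.acc : ℝ≥0∞)⁻¹) * (distance I.edges I.src v : ℝ≥0∞) ≤ A.estimate I v ∧
      A.estimate I v ≤ (distance I.edges I.src v : ℝ≥0∞)) ∧
    ((I.depth : ℕ∞) < distance I.edges I.src v →
      (1 - (I.acc : ℝ≥0∞)⁻¹) * (I.depth : ℝ≥0∞) ≤ A.estimate I v)

/-- Each instance uses total time at most `T n m k δ`, where `m` is the final number of edges;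
reporting a vertex takes at least one time unit. -/
def HasTotalTime (T : ℕ → ℕ → ℕ → ℝ≥0 → ℝ≥0) : Prop :=
  ∀ (n : ℕ) (I : Instance n), I.Admissible →
    (A.output I).length ≤ A.cost I ∧
    (A.totalCost I : ℝ≥0) ≤ T n I.edges.length I.depth ((I.acc : ℝ≥0)⁻¹)

end BlackBox

/-- The time bound `T n m k δ` is nondecreasing in `k` and in `1 / δ`, and it grows by at most the
factor `K` when `k` and `1 / δ` are doubled. Every polynomial in `n`, `m`, `k`, `1 / δ` with
nonnegative coefficients has this property for some `K`. -/
def PolynomialGrowth (K : ℝ≥0) (T : ℕ → ℕ → ℕ → ℝ≥0 → ℝ≥0) : Prop :=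
  ∀ (n m k : ℕ) (δ : ℝ≥0), 1 ≤ k → 0 < δ →
    (∀ (k' : ℕ) (δ' : ℝ≥0), k ≤ k' → 0 < δ' → δ' ≤ δ → T n m k δ ≤ T n m k' δ') ∧
    T n m (2 * k) (δ / 2) ≤ K * T n m k δ

/-! ### A word RAM with access to the black box -/

/-- Operations on words. Comparisons return `1` or `0`. -/
inductive BinOp
  | add | sub | mul | div | mod | lt | eq

def BinOp.apply : BinOp → ℕ → ℕ → ℕ
  | .add, a, b => a + b
  | .sub, a, b => a - b
  | .mul, a, b => a * b
  | .div, a, b => a / b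
  | .mod, a, b => a % b
  | .lt, a, b => if a < b then 1 else 0
  | .eq, a, b => if a = b then 1 else 0

/-- Expressions: constants, variables, array cells, operations. -/
inductive Expr
  | const (c : ℕ)
  | var (x : ℕ)
  | cell (a : ℕ) (i : Expr)
  | op (o : BinOp) (e₁ e₂ : Expr)

/-- The number of elementary steps of the evaluation. -/
def Expr.size : Expr → ℕ
  | .const _ => 1
  | .var _ => 1
  | .cell _ i => i.size + 1
  | .op _ e₁ e₂ => e₁.size + e₂.size + 1

/-- Commands. `spawn src depth acc` starts a new instance of the black box on the current graph,
and `receive i v x` takes the oldest report that has not been read yet. -/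
inductive Cmd
  | skip
  | assign (x : ℕ) (e : Expr)
  | store (a : ℕ) (i e : Expr)
  | seq (c₁ c₂ : Cmd)
  | ite (e : Expr) (c₁ c₂ : Cmd)
  | loop (e : Expr) (c : Cmd)
  | spawn (src depth acc : Expr)
  | receive (i v x : ℕ)

/-- A configuration: the variables, the arrays (a program uses finitely many of each), the running
instances of the black box in the order of their creation, and the queue of unread reports
`(i, v, x)`, where `i` is the position of the instance, `v` the vertex, `x` its estimate. -/
structure Config (n : ℕ) where
  var : ℕ → ℕ
  arr : ℕ → ℕ → ℕ
  insts : List (Instance n)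
  queue : List (ℕ × ℕ × ℕ)

/-- The value of an expression; all arithmetic is on words of `w` bits. -/
def Expr.eval {n : ℕ} (w : ℕ) (s : Config n) : Expr → ℕ
  | .const c => c % 2 ^ w
  | .var x => s.var x
  | .cell a i => s.arr a (i.eval w s)
  | .op o e₁ e₂ => o.apply (e₁.eval w s) (e₂.eval w s) % 2 ^ w

/-- How a program reads an estimate: rounded up to an integer, with `k + 1` for all estimates that
exceed the truncation depth `k`. -/
noncomputable def readEstimate (k : ℕ) (x : ℝ≥0∞) : ℕ :=
  ⌈(min x (k + 1 : ℝ≥0∞)).toNNReal⌉₊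

namespace Config

variable {n : ℕ}

/-- Assign a `w`-bit word to a variable. -/
def setVar (w : ℕ) (s : Config n) (x v : ℕ) : Config n :=
  { s with var := Function.update s.var x (v % 2 ^ w) }

/-- Assign a `w`-bit word to an array cell. -/
def setArr (w : ℕ) (s : Config n) (a i v : ℕ) : Config n :=
  { s with arr := Function.update s.arr a (Function.update (s.arr a) i (v % 2 ^ w)) }

/-- The reports caused by the last event of the instance at position `i`. -/
noncomputable def messages (A : BlackBox) (i : ℕ) (I : Instance n) : List (ℕ × ℕ × ℕ) :=
  (A.output I).map fun p => (i, (p.1 : ℕ), readEstimate I.depth p.2)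

/-- Start an instance on the current graph; the second component is the time it takes. Nothing
happens if the parameters are not admissible. -/
noncomputable def spawn (A : BlackBox) (cur : List (Fin n × Fin n)) (s : Config n)
    (u k a : ℕ) : Config n × ℕ :=
  if h : u < n ∧ 1 ≤ k ∧ 1 ≤ a then
    let I : Instance n := ⟨⟨u, h.1⟩, k, a, cur, []⟩
    ({ s with
        insts := s.insts ++ [I]
        queue := s.queue ++ messages A s.insts.length I }, A.cost I)
  else (s, 0)

/-- Read the oldest unread report: its instance number plus one (or `0` if there is no report), its
vertex and its estimate are assigned to the variables `i`, `v`, `x`. -/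
def receive (w : ℕ) (s : Config n) (i v x : ℕ) : Config n :=
  match s.queue with
  | [] => s.setVar w i 0
  | (j, u, y) :: rest =>
    ((({ s with queue := rest }).setVar w i (j + 1)).setVar w v u).setVar w x y

/-- Insertion of an edge: it is announced to the program in the variables `3` and `4`, and every
running instance of the black box processes it; the second component is the time they take. -/
noncomputable def insertEdge (A : BlackBox) (w : ℕ) (s : Config n) (e : Fin n × Fin n) :
    Config n × ℕ :=
  let insts' := s.insts.map fun I => I.extend e
  (({ s with
      insts := insts'
      queue := s.queue ++ (insts'.mapIdx fun i I => messages A i I).flatten }.setVar w 3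
        e.1).setVar w 4 e.2,
    (insts'.map fun I => A.cost I).sum)

/-- The initial configuration. Variable `0` holds `n`, variable `1` holds the accuracy parameter `q`,
variable `2` holds the number of edges of the initial graph; the tails and the heads of these edges
are in the arrays `0` and `1`; everything else is `0`. -/
def initial (w q : ℕ) (start : List (Fin n × Fin n)) : Config n where
  var x := (if x = 0 then n else if x = 1 then q else if x = 2 then start.length else 0) % 2 ^ w
  arr a i := (if a = 0 then (start[i]?.map fun e => (e.1 : ℕ)).getD 0
    else if a = 1 then (start[i]?.map fun e => (e.2 : ℕ)).getD 0 else 0) % 2 ^ w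
  insts := []
  queue := []

/-- The value maintained by the program, in variable `5`: `0` stands for infinity, `x + 1` for the
number `x`. -/
def answer (s : Config n) : ℕ∞ :=
  if s.var 5 = 0 then ⊤ else ((s.var 5 - 1 : ℕ) : ℕ∞)

end Config

/-- `Exec A w cur c s s' t`: started in the configuration `s`, while `cur` is the list of the edges
of the current graph, the command `c` terminates in `s'` after time `t`, which includes the time
taken by the black box. -/
inductive Exec {n : ℕ} (A : BlackBox) (w : ℕ) (cur : List (Fin n × Fin n)) :
    Cmd → Config n → Config n → ℕ → Prop
  | skip (s) : Exec A w cur .skip s s 1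
  | assign (s x e) : Exec A w cur (.assign x e) s (s.setVar w x (e.eval w s)) (e.size + 1)
  | store (s a i e) : Exec A w cur (.store a i e) s
      (s.setArr w a (i.eval w s) (e.eval w s)) (i.size + e.size + 1)
  | seq {s s₁ s₂ c₁ c₂ t₁ t₂} : Exec A w cur c₁ s s₁ t₁ → Exec A w cur c₂ s₁ s₂ t₂ →
      Exec A w cur (.seq c₁ c₂) s s₂ (t₁ + t₂)
  | ite_true {s s₁ e c₁ c₂ t} : e.eval w s ≠ 0 → Exec A w cur c₁ s s₁ t →
      Exec A w cur (.ite e c₁ c₂) s s₁ (e.size + 1 + t)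
  | ite_false {s s₁ e c₁ c₂ t} : e.eval w s = 0 → Exec A w cur c₂ s s₁ t →
      Exec A w cur (.ite e c₁ c₂) s s₁ (e.size + 1 + t)
  | loop_true {s s₁ s₂ e c t₁ t₂} : e.eval w s ≠ 0 → Exec A w cur c s s₁ t₁ →
      Exec A w cur (.loop e c) s₁ s₂ t₂ →
      Exec A w cur (.loop e c) s s₂ (e.size + 1 + t₁ + t₂)
  | loop_false {s e c} : e.eval w s = 0 → Exec A w cur (.loop e c) s s (e.size + 1)
  | spawn (s u k a) : Exec A w cur (.spawn u k a) s
      (s.spawn A cur (u.eval w s) (k.eval w s) (a.eval w s)).1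
      (u.size + k.size + a.size + 1 + (s.spawn A cur (u.eval w s) (k.eval w s) (a.eval w s)).2)
  | receive (s i v x) : Exec A w cur (.receive i v x) s (s.receive w i v x) 1

/-- The execution of a command is deterministic. -/
theorem Exec.deterministic {n : ℕ} {A : BlackBox} {w : ℕ} {cur : List (Fin n × Fin n)} {c : Cmd}
    {s s₁ s₂ : Config n} {t₁ t₂ : ℕ} (h₁ : Exec A w cur c s s₁ t₁) (h₂ : Exec A w cur c s s₂ t₂) :
    s₁ = s₂ ∧ t₁ = t₂ := by
  induction h₁ generalizing s₂ t₂ with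
  | skip | assign | store | spawn | receive => cases h₂; exact ⟨rfl, rfl⟩
  | seq _ _ ih₁ ih₂ =>
    cases h₂ with
    | seq a b =>
      obtain ⟨rfl, rfl⟩ := ih₁ a
      obtain ⟨rfl, rfl⟩ := ih₂ b
      exact ⟨rfl, rfl⟩
  | ite_true h _ ih | ite_false h _ ih =>
    cases h₂ with
    | ite_true h' a => first | exact absurd h h' | (obtain ⟨rfl, rfl⟩ := ih a; exact ⟨rfl, rfl⟩)
    | ite_false h' a => first | exact absurd h' h | (obtain ⟨rfl, rfl⟩ := ih a; exact ⟨rfl, rfl⟩)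
  | loop_true h _ _ ih₁ ih₂ =>
    cases h₂ with
    | loop_true _ a b =>
      obtain ⟨rfl, rfl⟩ := ih₁ a
      obtain ⟨rfl, rfl⟩ := ih₂ b
      exact ⟨rfl, rfl⟩
    | loop_false h' => exact absurd h' h
  | loop_false h =>
    cases h₂ with
    | loop_true h' _ _ => exact absurd h h'
    | loop_false _ => exact ⟨rfl, rfl⟩

/-- An incremental algorithm: a command that is run once on the initial graph, a command that is run
after each insertion, and the constant that determines the length of the machine words. -/
structure Algorithm where
  setup : Cmd
  update : Cmd
  wordConst : ℕ

/-- The machine words have `O(log (n + q))` bits. -/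
def Algorithm.wordSize (P : Algorithm) (n q : ℕ) : ℕ :=
  P.wordConst * (Nat.log 2 (n + q) + 1)

/-- `P.RunsTo A q start ins s t`: with the accuracy parameter `q`, on the initial graph `start` and
after the insertion of the edges `ins` one after the other, the algorithm `P` with the black box `A`
is in the configuration `s`, and it has used the total time `t`, including the time of all instances
of the black box. -/
inductive Algorithm.RunsTo {n : ℕ} (P : Algorithm) (A : BlackBox) (q : ℕ)
    (start : List (Fin n × Fin n)) : List (Fin n × Fin n) → Config n → ℕ → Prop
  | setup {s t} :
      Exec A (P.wordSize n q) start P.setup (Config.initial (P.wordSize n q) q start) s t →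
      P.RunsTo A q start [] s t
  | insert {ins s s' t t'} (e : Fin n × Fin n) :
      P.RunsTo A q start ins s t →
      Exec A (P.wordSize n q) (start ++ (ins ++ [e])) P.update
        (s.insertEdge A (P.wordSize n q) e).1 s' t' →
      P.RunsTo A q start (ins ++ [e]) s' (t + (s.insertEdge A (P.wordSize n q) e).2 + t')

/-! ### The running time -/

open Classical in
/-- The integers between the final value of the radius and the largest finite value that the radius
has at any time of the update sequence. (A finite radius is less than `n`; the set is empty if the
radius is infinite all the time.) -/
noncomputable def radiusRange {n : ℕ} (start ins : List (Fin n × Fin n)) : Finset ℕ :=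
  (Finset.range n).filter fun r =>
    radius (start ++ ins) ≤ r ∧
      ∃ i ≤ ins.length, radius (start ++ ins.take i) ≠ ⊤ ∧ (r : ℕ∞) ≤ radius (start ++ ins.take i)

/-- The maximum of `(T n m (2 r) ε + m) n / (ε² r)` over all `r` in `radiusRange start ins`, where
`m` is the final number of edges; it is `0` if the range is empty. -/
noncomputable def maxTerm {n : ℕ} (T : ℕ → ℕ → ℕ → ℝ≥0 → ℝ≥0) (ε : ℝ≥0)
    (start ins : List (Fin n × Fin n)) : ℝ≥0 :=
  (radiusRange start ins).sup fun r =>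
    (T n (start ++ ins).length (2 * r) ε + (start ++ ins).length) * n / (ε ^ 2 * r)

end IncRadius

open IncRadius

namespace IncRadius

variable {n : ℕ}

/-! ### A program logic for the word RAM -/

/-! Put `q = ⌈1/ε⌉`. Suppose that a vertex `r` reaches all vertices, and take a breadth-first tree
from `r`. For each `k`, some residue class of the levels modulo `k` has at most `n/k` vertices
(`mul_card_class_le`), and together with `r` it covers the graph: every vertex has a walk of length
less than `k` from a member (`covers_of_levels`). A member that covers a center of the graph has
eccentricity at most `R + k - 1`, so a few sources reveal the radius up to an additive error below
`k` (`Covers.le_radius`). Insertions do not destroy walks, so one tree, computed when the root is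
found, serves for the whole sequence.

The program works in phases, each with an estimate `Q ≥ R`. With `g = Q/(8q)` it takes a cover for
`k = g + 1` and starts a black-box instance of depth `Q` and accuracy `1/(8q+1)` from each member.
The threshold for the estimates is `τ = Q - 1 - 2g`. If all estimates of one instance are at most
`τ`, then its source has eccentricity at most `Q - 1 - g` (`eccLE_of_estimate_le`), and `Q` may be
lowered by `g + 1`. If no instance has this property, then no member has eccentricity at most `τ`
(`estimate_le_of_eccLE`), and the cover yields `q Q ≤ (q+1) R` (`mul_le_of_covers`), which is the
required approximation.

Each phase lowers `Q` by a factor of about `1 - 1/(8q)`, so there are `O(q log n)` phases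
(`phaseBound_le`). A phase has `O(qn/Q)` instances (`phase_size_mul_le`), whose individual time is
comparable to `T n m (2r) ε` for a radius value `r` with `r ≤ Q ≤ 2r` (`phase_cost_le`). The product
is the maximum in the theorem up to a logarithm (`spent_le`). Reading the reports costs a constant
per report, and hence at most a constant times the time of the instances.

The first estimate has to satisfy `R ≤ Q ≤ 2R`, so that all depths belong to the range of the
maximum. It comes from the same covers with `k` halved in each round and with ordinary searches in
place of the black box (`estimateRadius_spec`). A root is found by incremental searches from all
vertices, which mark each pair of vertices at most once (`scan_spec`); this is the term `mn`. In a
strongly connected initial graph the search from the first vertex already succeeds, and the term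
disappears.

All this is proved for a concrete program with a calculus of total correctness and time (`WP`). The
invariant `Running` joins the state before a root is known (`Idle`) to the state afterwards
(`Phase`, `Solved`). -/

/-- All memory cells hold machine words. -/
structure Bdd (w : ℕ) (s : Config n) : Prop where
  one : 1 < 2 ^ w
  var : ∀ x, s.var x < 2 ^ w
  arr : ∀ a i, s.arr a i < 2 ^ w

theorem Bdd.pos {w : ℕ} {s : Config n} (h : Bdd w s) : w ≠ 0 := by
  rintro rfl
  simpa using h.one

namespace Config

/-- Assignment to a variable without truncation. -/
def put (s : Config n) (x v : ℕ) : Config n :=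
  { s with var := Function.update s.var x v }

/-- Assignment to an array cell without truncation. -/
def putArr (s : Config n) (a i v : ℕ) : Config n :=
  { s with arr := Function.update s.arr a (Function.update (s.arr a) i v) }

@[simp] theorem put_var (s : Config n) (x v y : ℕ) :
    (s.put x v).var y = if y = x then v else s.var y := by
  simp [put, Function.update_apply]

@[simp] theorem put_arr (s : Config n) (x v : ℕ) : (s.put x v).arr = s.arr := rfl
@[simp] theorem put_insts (s : Config n) (x v : ℕ) : (s.put x v).insts = s.insts := rfl
@[simp] theorem put_queue (s : Config n) (x v : ℕ) : (s.put x v).queue = s.queue := rfl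
@[simp] theorem putArr_var (s : Config n) (a i v : ℕ) : (s.putArr a i v).var = s.var := rfl
@[simp] theorem putArr_insts (s : Config n) (a i v : ℕ) : (s.putArr a i v).insts = s.insts := rfl
@[simp] theorem putArr_queue (s : Config n) (a i v : ℕ) : (s.putArr a i v).queue = s.queue := rfl

@[simp] theorem putArr_arr (s : Config n) (a i v b : ℕ) :
    (s.putArr a i v).arr b = if b = a then Function.update (s.arr a) i v else s.arr b := by
  simp [putArr, Function.update_apply]

theorem setVar_eq_put {w : ℕ} (s : Config n) (x : ℕ) {v : ℕ} (h : v < 2 ^ w) :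
    s.setVar w x v = s.put x v := by
  simp [setVar, put, Nat.mod_eq_of_lt h]

theorem setArr_eq_putArr {w : ℕ} (s : Config n) (a i : ℕ) {v : ℕ} (h : v < 2 ^ w) :
    s.setArr w a i v = s.putArr a i v := by
  simp [setArr, putArr, Nat.mod_eq_of_lt h]

end Config

/-- The value of an expression without truncation. -/
def Expr.val (s : Config n) : Expr → ℕ
  | .const c => c
  | .var x => s.var x
  | .cell a i => s.arr a (i.val s)
  | .op o e₁ e₂ => o.apply (e₁.val s) (e₂.val s)

/-- No overflow occurs in the evaluation of the expression. -/
def Expr.Fits (w : ℕ) (s : Config n) : Expr → Prop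
  | .const c => c < 2 ^ w
  | .var _ => True
  | .cell _ i => i.Fits w s
  | .op .add e₁ e₂ => e₁.Fits w s ∧ e₂.Fits w s ∧ e₁.val s + e₂.val s < 2 ^ w
  | .op .mul e₁ e₂ => e₁.Fits w s ∧ e₂.Fits w s ∧ e₁.val s * e₂.val s < 2 ^ w
  | .op _ e₁ e₂ => e₁.Fits w s ∧ e₂.Fits w s

theorem Expr.eval_lt {w : ℕ} {s : Config n} (hs : Bdd w s) (e : Expr) : e.eval w s < 2 ^ w := by
  have h2 : 0 < 2 ^ w := by positivity
  cases e with
  | const c => exact Nat.mod_lt _ h2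
  | var x => exact hs.var x
  | cell a i => exact hs.arr a _
  | op o a b => exact Nat.mod_lt _ h2

/-- Only sums and products can leave the range of a word, and `Fits` excludes this. Differences,
quotients and remainders do not exceed the first operand, and comparisons are `0` or `1`. -/
theorem Expr.eval_eq_val {w : ℕ} {s : Config n} (hs : Bdd w s) {e : Expr} (h : e.Fits w s) :
    e.eval w s = e.val s := by
  induction e with
  | const c => exact Nat.mod_eq_of_lt h
  | var x => rfl
  | cell a i ih => simp only [Expr.eval, Expr.val, ih h]
  | op o a b iha ihb =>
    have ha : a.Fits w s := by cases o <;> exact h.1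
    have hb : b.Fits w s := by
      cases o <;> first | exact h.2.1 | exact h.2
    have ha' := Expr.eval_lt hs a
    have hb' := Expr.eval_lt hs b
    simp only [Expr.eval, Expr.val]
    rw [← iha ha, ← ihb hb]
    apply Nat.mod_eq_of_lt
    have h1 := hs.one
    cases o with
    | add => rw [iha ha, ihb hb]; exact h.2.2
    | mul => rw [iha ha, ihb hb]; exact h.2.2
    | sub => exact lt_of_le_of_lt (Nat.sub_le _ _) ha'
    | div => exact lt_of_le_of_lt (Nat.div_le_self _ _) ha'
    | mod => exact lt_of_le_of_lt (Nat.mod_le _ _) ha'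
    | lt => simp only [BinOp.apply]; split <;> omega
    | eq => simp only [BinOp.apply]; split <;> omega

theorem Expr.val_lt {w : ℕ} {s : Config n} (hs : Bdd w s) {e : Expr} (h : e.Fits w s) :
    e.val s < 2 ^ w :=
  Expr.eval_eq_val hs h ▸ Expr.eval_lt hs e

theorem Bdd.setVar {w : ℕ} {s : Config n} (hs : Bdd w s) (x v : ℕ) : Bdd w (s.setVar w x v) where
  one := hs.one
  var y := by
    simp only [Config.setVar, Function.update_apply]
    split
    · exact Nat.mod_lt _ (by positivity)
    · exact hs.var y
  arr := hs.arr

theorem Bdd.setArr {w : ℕ} {s : Config n} (hs : Bdd w s) (a i v : ℕ) :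
    Bdd w (s.setArr w a i v) where
  one := hs.one
  var := hs.var
  arr b j := by
    simp only [Config.setArr, Function.update_apply]
    split
    · rw [Function.update_apply]
      split
      · exact Nat.mod_lt _ (by positivity)
      · exact hs.arr _ j
    · exact hs.arr b j

theorem Bdd.of_eq {w : ℕ} {s s' : Config n} (hs : Bdd w s) (hv : s'.var = s.var)
    (ha : s'.arr = s.arr) : Bdd w s' :=
  ⟨hs.one, fun x => hv ▸ hs.var x, fun a i => ha ▸ hs.arr a i⟩

theorem Config.spawn_var (A : BlackBox) (cur : List (Fin n × Fin n)) (s : Config n) (u k a : ℕ) :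
    (s.spawn A cur u k a).1.var = s.var := by
  unfold Config.spawn; split <;> rfl

theorem Config.spawn_arr (A : BlackBox) (cur : List (Fin n × Fin n)) (s : Config n) (u k a : ℕ) :
    (s.spawn A cur u k a).1.arr = s.arr := by
  unfold Config.spawn; split <;> rfl

theorem Exec.bdd {A : BlackBox} {w : ℕ} {cur : List (Fin n × Fin n)} {c : Cmd} {s s' : Config n}
    {t : ℕ} (h : Exec A w cur c s s' t) (hs : Bdd w s) : Bdd w s' := by
  induction h with
  | skip => exact hs
  | assign => exact hs.setVar _ _
  | store => exact hs.setArr _ _ _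
  | seq _ _ ih₁ ih₂ => exact ih₂ (ih₁ hs)
  | ite_true _ _ ih => exact ih hs
  | ite_false _ _ ih => exact ih hs
  | loop_true _ _ _ ih₁ ih₂ => exact ih₂ (ih₁ hs)
  | loop_false => exact hs
  | spawn s u k a => exact hs.of_eq (Config.spawn_var ..) (Config.spawn_arr ..)
  | receive s i v x =>
    unfold Config.receive
    split
    · exact hs.setVar _ _
    · refine Bdd.setVar (Bdd.setVar (Bdd.setVar ?_ _ _) _ _) _ _
      exact hs.of_eq rfl rfl

/-! ### The memory that a command cannot change. -/

/-- The command assigns to the variable. -/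
def Cmd.writes : Cmd → ℕ → Bool
  | .assign x _, y => x == y
  | .seq c₁ c₂, y => c₁.writes y || c₂.writes y
  | .ite _ c₁ c₂, y => c₁.writes y || c₂.writes y
  | .loop _ c, y => c.writes y
  | .receive i v x, y => i == y || v == y || x == y
  | _, _ => false

/-- The command stores into the array. -/
def Cmd.stores : Cmd → ℕ → Bool
  | .store a _ _, b => a == b
  | .seq c₁ c₂, b => c₁.stores b || c₂.stores b
  | .ite _ c₁ c₂, b => c₁.stores b || c₂.stores b
  | .loop _ c, b => c.stores b
  | _, _ => false

/-- The command starts instances of the black box. -/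
def Cmd.spawns : Cmd → Bool
  | .seq c₁ c₂ => c₁.spawns || c₂.spawns
  | .ite _ c₁ c₂ => c₁.spawns || c₂.spawns
  | .loop _ c => c.spawns
  | .spawn _ _ _ => true
  | _ => false

/-- The command reads reports of the black box. -/
def Cmd.receives : Cmd → Bool
  | .seq c₁ c₂ => c₁.receives || c₂.receives
  | .ite _ c₁ c₂ => c₁.receives || c₂.receives
  | .loop _ c => c.receives
  | .receive _ _ _ => true
  | _ => false

/-- The part of the memory that the command does not touch is the same in both configurations. -/
structure Frame (c : Cmd) (s s' : Config n) : Prop where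
  var : ∀ x, c.writes x = false → s'.var x = s.var x
  arr : ∀ a, c.stores a = false → s'.arr a = s.arr a
  insts : c.spawns = false → s'.insts = s.insts
  queue : c.spawns = false → c.receives = false → s'.queue = s.queue

theorem Frame.refl (c : Cmd) (s : Config n) : Frame c s s :=
  ⟨fun _ _ => rfl, fun _ _ => rfl, fun _ => rfl, fun _ _ => rfl⟩

theorem Frame.trans {c : Cmd} {s₁ s₂ s₃ : Config n} (h : Frame c s₁ s₂) (h' : Frame c s₂ s₃) :
    Frame c s₁ s₃ :=
  ⟨fun x hx => (h'.var x hx).trans (h.var x hx), fun x hx => (h'.arr x hx).trans (h.arr x hx),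
    fun hx => (h'.insts hx).trans (h.insts hx),
    fun hx hy => (h'.queue hx hy).trans (h.queue hx hy)⟩

/-- The hypotheses of `Frame` are Boolean computations on the program text. Later specifications
therefore mention only what a command changes, and everything else is carried along by `rfl`. -/
theorem Exec.frame {A : BlackBox} {w : ℕ} {cur : List (Fin n × Fin n)} {c : Cmd} {s s' : Config n}
    {t : ℕ} (h : Exec A w cur c s s' t) : Frame c s s' := by
  induction h with
  | skip => exact Frame.refl _ _
  | assign s x e =>
    refine ⟨fun y hy => ?_, fun _ _ => rfl, fun _ => rfl, fun _ _ => rfl⟩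
    have : y ≠ x := by rintro rfl; simp [Cmd.writes] at hy
    simp [Config.setVar, Function.update_of_ne this]
  | store s a i e =>
    refine ⟨fun _ _ => rfl, fun b hb => ?_, fun _ => rfl, fun _ _ => rfl⟩
    have : b ≠ a := by rintro rfl; simp [Cmd.stores] at hb
    simp [Config.setArr, Function.update_of_ne this]
  | seq _ _ ih₁ ih₂ =>
    refine ⟨fun x hx => ?_, fun x hx => ?_, fun hx => ?_, fun hx hy => ?_⟩ <;>
      simp only [Cmd.writes, Cmd.stores, Cmd.spawns, Cmd.receives, Bool.or_eq_false_iff] at *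
    · rw [ih₂.var x hx.2, ih₁.var x hx.1]
    · rw [ih₂.arr x hx.2, ih₁.arr x hx.1]
    · rw [ih₂.insts hx.2, ih₁.insts hx.1]
    · rw [ih₂.queue hx.2 hy.2, ih₁.queue hx.1 hy.1]
  | ite_true _ _ ih =>
    refine ⟨fun x hx => ?_, fun x hx => ?_, fun hx => ?_, fun hx hy => ?_⟩ <;>
      simp only [Cmd.writes, Cmd.stores, Cmd.spawns, Cmd.receives, Bool.or_eq_false_iff] at *
    exacts [ih.var x hx.1, ih.arr x hx.1, ih.insts hx.1, ih.queue hx.1 hy.1]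
  | ite_false _ _ ih =>
    refine ⟨fun x hx => ?_, fun x hx => ?_, fun hx => ?_, fun hx hy => ?_⟩ <;>
      simp only [Cmd.writes, Cmd.stores, Cmd.spawns, Cmd.receives, Bool.or_eq_false_iff] at *
    exacts [ih.var x hx.2, ih.arr x hx.2, ih.insts hx.2, ih.queue hx.2 hy.2]
  | loop_true _ _ _ ih₁ ih₂ =>
    refine ⟨fun x hx => ?_, fun x hx => ?_, fun hx => ?_, fun hx hy => ?_⟩
    · rw [ih₂.var x hx, ih₁.var x hx]
    · rw [ih₂.arr x hx, ih₁.arr x hx]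
    · rw [ih₂.insts hx, ih₁.insts hx]
    · rw [ih₂.queue hx hy, ih₁.queue hx hy]
  | loop_false => exact Frame.refl _ _
  | spawn s u k a =>
    refine ⟨fun y hy => ?_, fun _ _ => ?_, fun h => by simp [Cmd.spawns] at h,
      fun h => by simp [Cmd.spawns] at h⟩
    · rw [Config.spawn_var]
    · rw [Config.spawn_arr]
  | receive s i v x =>
    refine ⟨fun y hy => ?_, fun _ _ => ?_, fun h => ?_, fun _ h => by simp [Cmd.receives] at h⟩
    · simp only [Cmd.writes, Bool.or_eq_false_iff, beq_eq_false_iff_ne] at hy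
      obtain ⟨⟨h1, h2⟩, h3⟩ := hy
      unfold Config.receive
      split <;> simp [Config.setVar, h1.symm, h2.symm, h3.symm]
    · unfold Config.receive; split <;> rfl
    · unfold Config.receive; split <;> rfl

/-! ### Rules for total correctness with time. -/

/-- Total correctness: started in `s`, the command terminates in a configuration and after a time
that satisfy the postcondition. -/
def WP (A : BlackBox) (w : ℕ) (cur : List (Fin n × Fin n)) (c : Cmd) (s : Config n)
    (post : Config n → ℕ → Prop) : Prop :=
  Bdd w s → ∃ s' t, Exec A w cur c s s' t ∧ post s' t

namespace WP

variable {A : BlackBox} {w : ℕ} {cur : List (Fin n × Fin n)} {c c₁ c₂ : Cmd} {s : Config n}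
  {post post' : Config n → ℕ → Prop} {e : Expr}

/-- Specifications are composed by this rule: it supplies the word bounds and the frame of the
command at no cost, so they never occur in postconditions. -/
theorem conseq (h : WP A w cur c s post)
    (hp : ∀ s' t, Bdd w s' → Frame c s s' → post s' t → post' s' t) : WP A w cur c s post' := by
  intro hs
  obtain ⟨s', t, he, ht⟩ := h hs
  exact ⟨s', t, he, hp s' t (he.bdd hs) he.frame ht⟩

/-- `WP` is conditional on memory cells that hold words; this makes the condition available for
overflow checks. -/
theorem bdd (h : Bdd w s → WP A w cur c s post) : WP A w cur c s post := fun hs => h hs hs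

theorem skip (h : post s 1) : WP A w cur .skip s post := fun _ => ⟨_, _, .skip _, h⟩

theorem assign {x : ℕ} (hf : e.Fits w s) (h : post (s.put x (e.val s)) (e.size + 1)) :
    WP A w cur (.assign x e) s post := fun hs => by
  refine ⟨_, _, .assign _ _ _, ?_⟩
  rw [Expr.eval_eq_val hs hf, Config.setVar_eq_put _ _ (Expr.val_lt hs hf)]
  exact h

theorem store {a : ℕ} {i : Expr} (hi : i.Fits w s) (hf : e.Fits w s)
    (h : post (s.putArr a (i.val s) (e.val s)) (i.size + e.size + 1)) :
    WP A w cur (.store a i e) s post := fun hs => by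
  refine ⟨_, _, .store _ _ _ _, ?_⟩
  rw [Expr.eval_eq_val hs hf, Expr.eval_eq_val hs hi,
    Config.setArr_eq_putArr _ _ _ (Expr.val_lt hs hf)]
  exact h

theorem seq (h : WP A w cur c₁ s fun s₁ t₁ => WP A w cur c₂ s₁ fun s₂ t₂ => post s₂ (t₁ + t₂)) :
    WP A w cur (.seq c₁ c₂) s post := fun hs => by
  obtain ⟨s₁, t₁, h₁, h⟩ := h hs
  obtain ⟨s₂, t₂, h₂, h⟩ := h (h₁.bdd hs)
  exact ⟨s₂, _, .seq h₁ h₂, h⟩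

theorem ite (hf : e.Fits w s)
    (h₁ : e.val s ≠ 0 → WP A w cur c₁ s fun s' t => post s' (e.size + 1 + t))
    (h₂ : e.val s = 0 → WP A w cur c₂ s fun s' t => post s' (e.size + 1 + t)) :
    WP A w cur (.ite e c₁ c₂) s post := fun hs => by
  rw [← Expr.eval_eq_val hs hf] at h₁ h₂
  by_cases h : e.eval w s = 0
  · obtain ⟨s', t, h', hp⟩ := h₂ h hs
    exact ⟨s', _, .ite_false h h', hp⟩
  · obtain ⟨s', t, h', hp⟩ := h₁ h hs
    exact ⟨s', _, .ite_true h h', hp⟩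

/-- Loops: `I s t` is the invariant, where `t` is the time used so far, and `μ` is decreasing. -/
theorem loop (I : Config n → ℕ → Prop) (μ : Config n → ℕ) (h0 : I s 0)
    (hf : ∀ s' t, Bdd w s' → Frame c s s' → I s' t → e.Fits w s')
    (hstep : ∀ s' t, Bdd w s' → Frame c s s' → I s' t → e.val s' ≠ 0 →
      WP A w cur c s' fun s'' t' => I s'' (t + (e.size + 1) + t') ∧ μ s'' < μ s')
    (hexit : ∀ s' t, Bdd w s' → Frame c s s' → I s' t → e.val s' = 0 → post s' (t + (e.size + 1))) :
    WP A w cur (.loop e c) s post := by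
  intro hs
  -- Induction on a bound for the measure, for an arbitrary intermediate state and an arbitrary
  -- elapsed time `t`.
  suffices H : ∀ (k : ℕ) (s' : Config n) (t : ℕ), μ s' ≤ k → Bdd w s' → Frame c s s' → I s' t →
      ∃ s'' t', Exec A w cur (.loop e c) s' s'' t' ∧ post s'' (t + t') by
    obtain ⟨s'', t', h, hp⟩ := H _ s 0 le_rfl hs (Frame.refl _ _) h0
    exact ⟨s'', t', h, by simpa using hp⟩
  intro k
  induction k with
  | zero =>
    intro s' t hk hs' hF hI
    have hE := Expr.eval_eq_val hs' (hf s' t hs' hF hI)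
    by_cases h : e.val s' = 0
    · exact ⟨s', _, .loop_false (hE.trans h), hexit s' t hs' hF hI h⟩
    · obtain ⟨s₁, t₁, h₁, _, hμ⟩ := hstep s' t hs' hF hI h hs'
      omega
  | succ k ih =>
    intro s' t hk hs' hF hI
    have hE := Expr.eval_eq_val hs' (hf s' t hs' hF hI)
    by_cases h : e.val s' = 0
    · exact ⟨s', _, .loop_false (hE.trans h), hexit s' t hs' hF hI h⟩
    · obtain ⟨s₁, t₁, h₁, hI₁, hμ⟩ := hstep s' t hs' hF hI h hs'
      obtain ⟨s₂, t₂, h₂, hp⟩ := ih s₁ _ (by omega) (h₁.bdd hs') (hF.trans h₁.frame) hI₁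
      refine ⟨s₂, _, .loop_true (fun h' => h (hE.symm.trans h')) h₁ h₂, ?_⟩
      rw [show t + (e.size + 1 + t₁ + t₂) = t + (e.size + 1) + t₁ + t₂ by omega]
      exact hp

theorem receive_nil {i v x : ℕ} (hq : s.queue = []) (h : post (s.put i 0) 1) :
    WP A w cur (.receive i v x) s post := fun hs => by
  refine ⟨_, _, .receive _ _ _ _, ?_⟩
  simp only [Config.receive, hq]
  rw [Config.setVar_eq_put _ _ (by have := hs.one; omega)]
  exact h

theorem receive_cons {i v x j u y : ℕ} {rest : List (ℕ × ℕ × ℕ)} (hq : s.queue = (j, u, y) :: rest)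
    (hj : j + 1 < 2 ^ w) (hu : u < 2 ^ w) (hy : y < 2 ^ w)
    (h : post (((({ s with queue := rest } : Config n).put i (j + 1)).put v u).put x y) 1) :
    WP A w cur (.receive i v x) s post := fun hs => by
  refine ⟨_, _, .receive _ _ _ _, ?_⟩
  simp only [Config.receive, hq]
  rw [Config.setVar_eq_put _ _ hj, Config.setVar_eq_put _ _ hu, Config.setVar_eq_put _ _ hy]
  exact h

theorem spawn {u k a : Expr} (hu : u.Fits w s) (hk : k.Fits w s) (ha : a.Fits w s)
    (h : post (s.spawn A cur (u.val s) (k.val s) (a.val s)).1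
      (u.size + k.size + a.size + 1 + (s.spawn A cur (u.val s) (k.val s) (a.val s)).2)) :
    WP A w cur (.spawn u k a) s post := fun hs => by
  refine ⟨_, _, .spawn _ _ _ _, ?_⟩
  rw [Expr.eval_eq_val hs hu, Expr.eval_eq_val hs hk, Expr.eval_eq_val hs ha]
  exact h

end WP

infixl:65 " +ₑ " => Expr.op BinOp.add
infixl:65 " -ₑ " => Expr.op BinOp.sub
infixl:70 " *ₑ " => Expr.op BinOp.mul
infixl:70 " /ₑ " => Expr.op BinOp.div
infixl:70 " %ₑ " => Expr.op BinOp.mod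
infix:50 " <ₑ " => Expr.op BinOp.lt
infix:50 " =ₑ " => Expr.op BinOp.eq
infix:40 " ≔ " => Cmd.assign
infixr:35 " ;; " => Cmd.seq

/-- The truth value as a number. -/
noncomputable def truth (p : Prop) : ℕ := open Classical in if p then 1 else 0

@[simp] theorem truth_eq_zero {p : Prop} : truth p = 0 ↔ ¬ p := by
  unfold truth; split <;> simp_all

namespace Expr

variable (s : Config n) (a b : Expr)

@[simp] theorem val_const (c : ℕ) : (const c).val s = c := rfl
@[simp] theorem val_var (x : ℕ) : (var x).val s = s.var x := rfl
@[simp] theorem val_cell (x : ℕ) : (cell x a).val s = s.arr x (a.val s) := rfl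
@[simp] theorem val_add : (a +ₑ b).val s = a.val s + b.val s := rfl
@[simp] theorem val_sub : (a -ₑ b).val s = a.val s - b.val s := rfl
@[simp] theorem val_mul : (a *ₑ b).val s = a.val s * b.val s := rfl
@[simp] theorem val_div : (a /ₑ b).val s = a.val s / b.val s := rfl
@[simp] theorem val_mod : (a %ₑ b).val s = a.val s % b.val s := rfl

@[simp] theorem val_lt' : (a <ₑ b).val s = truth (a.val s < b.val s) := by
  simp only [val, BinOp.apply, truth]
  congr

@[simp] theorem val_eq : (a =ₑ b).val s = truth (a.val s = b.val s) := by
  simp only [val, BinOp.apply, truth]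
  congr

end Expr

attribute [simp] Expr.Fits Expr.size

end IncRadius


namespace IncRadius

variable {n : ℕ} {E E' : List (Fin n × Fin n)}

/-! ### Walks and distances -/

namespace Walk

theorem mono (h : E ⊆ E') {l : ℕ} {u v : Fin n} (hw : Walk E l u v) : Walk E' l u v := by
  induction hw with
  | nil => exact .nil _
  | snoc _ he ih => exact .snoc ih (h he)

theorem trans {l l' : ℕ} {u v x : Fin n} (h : Walk E l u v) (h' : Walk E l' v x) :
    Walk E (l + l') u x := by
  induction h' with
  | nil => exact h
  | snoc _ he ih => exact .snoc (ih h) he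

theorem split {i j : ℕ} {u v : Fin n} (h : Walk E (i + j) u v) :
    ∃ x, Walk E i u x ∧ Walk E j x v := by
  induction j generalizing v with
  | zero => exact ⟨v, h, .nil _⟩
  | succ j ih =>
    cases h with
    | snoc h he =>
      obtain ⟨x, h1, h2⟩ := ih h
      exact ⟨x, h1, .snoc h2 he⟩

theorem mem_of_closed {S : Fin n → Prop} {x : Fin n} (hx : S x)
    (hS : ∀ p z, (p, z) ∈ E → S p → S z) {l : ℕ} {u : Fin n} (h : Walk E l x u) : S u := by
  induction h with
  | nil => exact hx
  | snoc _ he ih => exact hS _ _ he (ih hx)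

end Walk

/-- There is a walk of length `d`, and there is no shorter one. -/
def Shortest (E : List (Fin n × Fin n)) (d : ℕ) (u v : Fin n) : Prop :=
  Walk E d u v ∧ ∀ l, Walk E l u v → d ≤ l

theorem Walk.exists_shortest {l : ℕ} {u v : Fin n} (h : Walk E l u v) :
    ∃ d ≤ l, Shortest E d u v := by
  classical
  have hex : ∃ l, Walk E l u v := ⟨l, h⟩
  exact ⟨Nat.find hex, Nat.find_min' hex h, Nat.find_spec hex, fun l' h' => Nat.find_min' hex h'⟩

/-- A shorter walk to the intermediate vertex could be continued to a shorter walk to `v`. -/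
theorem Shortest.split {i j : ℕ} {u v : Fin n} (h : Shortest E (i + j) u v) :
    ∃ x, Shortest E i u x ∧ Walk E j x v := by
  obtain ⟨x, h1, h2⟩ := h.1.split
  refine ⟨x, ⟨h1, fun l hl => ?_⟩, h2⟩
  have := h.2 _ (hl.trans h2)
  omega

theorem Shortest.unique {d d' : ℕ} {u v : Fin n} (h : Shortest E d u v) (h' : Shortest E d' u v) :
    d = d' :=
  le_antisymm (h.2 _ h'.1) (h'.2 _ h.1)

/-- The vertices at distances `0, …, d` along a shortest walk are distinct, because a vertex has
only one distance. -/
theorem Shortest.lt {d : ℕ} {u v : Fin n} (h : Shortest E d u v) : d < n := by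
  have hex : ∀ i : Fin (d + 1), ∃ x, Shortest E i u x := fun i => by
    obtain ⟨x, hx, -⟩ := (show Shortest E (i + (d - i)) u v by
      rwa [Nat.add_sub_cancel' (Nat.lt_succ_iff.mp i.2)]).split
    exact ⟨x, hx⟩
  choose f hf using hex
  have hinj : Function.Injective f := fun i j hij => by
    have := hf i
    rw [hij] at this
    exact Fin.ext (this.unique (hf j))
  have := Fintype.card_le_of_injective f hinj
  simp only [Fintype.card_fin] at this
  omega

theorem distance_le_of_walk {l : ℕ} {u v : Fin n} (h : Walk E l u v) : distance E u v ≤ l :=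
  iInf₂_le l h

theorem Shortest.distance_eq {d : ℕ} {u v : Fin n} (h : Shortest E d u v) : distance E u v = d :=
  le_antisymm (distance_le_of_walk h.1)
    (le_iInf₂ fun l hl => by exact_mod_cast h.2 l hl)

theorem distance_eq_top {u v : Fin n} (h : ∀ l, ¬ Walk E l u v) : distance E u v = ⊤ := by
  simp only [distance, iInf_eq_top]
  exact fun l hl => absurd hl (h l)

theorem exists_shortest_of_distance_ne_top {u v : Fin n} (h : distance E u v ≠ ⊤) :
    ∃ d, Shortest E d u v := by
  by_contra hn
  refine h (distance_eq_top fun l hl => hn ?_)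
  obtain ⟨d, -, hd⟩ := hl.exists_shortest
  exact ⟨d, hd⟩

theorem distance_le_iff {l : ℕ} {u v : Fin n} :
    distance E u v ≤ l ↔ ∃ l' ≤ l, Walk E l' u v := by
  constructor
  · intro h
    obtain ⟨d, hd⟩ := exists_shortest_of_distance_ne_top (E := E) (u := u) (v := v)
      (ne_top_of_le_ne_top (ENat.natCast_ne_top l) h)
    rw [hd.distance_eq] at h
    exact ⟨d, by exact_mod_cast h, hd.1⟩
  · rintro ⟨l', hl, h⟩
    exact (distance_le_of_walk h).trans (by exact_mod_cast hl)

/-- The vertex `v` reaches every vertex by a walk of length at most `l`. -/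
def EccLE (E : List (Fin n × Fin n)) (v : Fin n) (l : ℕ) : Prop :=
  ∀ u, ∃ l' ≤ l, Walk E l' v u

theorem eccentricity_le_iff {v : Fin n} {l : ℕ} : eccentricity E v ≤ l ↔ EccLE E v l := by
  simp [eccentricity, EccLE, iSup_le_iff, distance_le_iff]

theorem EccLE.radius_le {v : Fin n} {l : ℕ} (h : EccLE E v l) : radius E ≤ l :=
  (iInf_le _ v).trans (eccentricity_le_iff.mpr h)

theorem exists_eccentricity_eq_radius (hn : 0 < n) : ∃ v, eccentricity E v = radius E := by
  have : Nonempty (Fin n) := ⟨⟨0, hn⟩⟩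
  exact exists_eq_ciInf_of_finite

theorem exists_eccLE (hn : 0 < n) {R : ℕ} (h : radius E ≤ R) : ∃ v, EccLE E v R := by
  obtain ⟨v, hv⟩ := exists_eccentricity_eq_radius (E := E) hn
  exact ⟨v, eccentricity_le_iff.mp (hv ▸ h)⟩

theorem radius_antitone (hE : E ⊆ E') : radius E' ≤ radius E := by
  refine le_iInf fun v => (iInf_le _ v).trans (iSup_mono fun u => ?_)
  exact le_iInf₂ fun l hl => distance_le_of_walk (hl.mono hE)

/-- Every vertex can be reached from `v`. -/
def ReachesAll (E : List (Fin n × Fin n)) (v : Fin n) : Prop := ∀ u, ∃ l, Walk E l v u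

theorem ReachesAll.eccLE {v : Fin n} (h : ReachesAll E v) : EccLE E v (n - 1) := fun u => by
  obtain ⟨l, hl⟩ := h u
  obtain ⟨d, -, hd⟩ := hl.exists_shortest
  exact ⟨d, by have := hd.lt; omega, hd.1⟩

theorem ReachesAll.exists_radius {v : Fin n} (h : ReachesAll E v) :
    ∃ R : ℕ, radius E = R ∧ R ≤ n - 1 := by
  obtain ⟨R, hR⟩ := ENat.ne_top_iff_exists.mp
    (ne_top_of_le_ne_top (ENat.natCast_ne_top _) h.eccLE.radius_le)
  refine ⟨R, hR.symm, ?_⟩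
  have := h.eccLE.radius_le
  rw [← hR] at this
  exact_mod_cast this

theorem radius_eq_top (h : ∀ v, ¬ ReachesAll E v) : radius E = ⊤ := by
  simp only [radius, iInf_eq_top]
  intro v
  have := h v
  simp only [ReachesAll, not_forall, not_exists] at this
  obtain ⟨u, hu⟩ := this
  exact top_le_iff.mp ((distance_eq_top hu).ge.trans (le_iSup (distance E v) u))

/-- Radius `0` would mean that one vertex equals all others. This is why the case of a single vertex
is treated apart: the time analysis divides by the radius. -/
theorem one_le_radius (hn : 2 ≤ n) : 1 ≤ radius E := by
  by_contra! h
  obtain ⟨v, hv⟩ := exists_eccLE (E := E) (R := 0) (by omega) (by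
    have := Order.lt_one_iff.mp h
    exact this.le)
  have hn0 : 0 < n := by omega
  have key : ∀ u, v = u := fun u => by
    obtain ⟨l, hl, hw⟩ := hv u
    obtain rfl : l = 0 := by omega
    cases hw; rfl
  have h0 := key ⟨0, by omega⟩
  have h1 := key ⟨1, by omega⟩
  rw [h0] at h1
  simp at h1

/-! ### Out-degrees and linked adjacency lists as functions of the edge list. -/

/-- Edges leaving a vertex, among the first `j` edges of the list. -/
def degTo (E : List (Fin n × Fin n)) (u : Fin n) : ℕ → ℕ
  | 0 => 0
  | j + 1 => if E[j]?.map Prod.fst = some u then degTo E u j + 1 else degTo E u j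

/-- The position plus one of the last edge leaving a vertex among the first `j` edges of the list,
or `0` if there is no such edge. -/
def lastEdge (E : List (Fin n × Fin n)) (u : Fin n) : ℕ → ℕ
  | 0 => 0
  | j + 1 => if E[j]?.map Prod.fst = some u then j + 1 else lastEdge E u j

theorem lastEdge_le (u : Fin n) (j : ℕ) : lastEdge E u j ≤ j := by
  induction j with
  | zero => simp [lastEdge]
  | succ j ih => simp only [lastEdge]; split <;> omega

/-- No edge between the last one found and position `j` leaves `u`. Hence following the links costs
one step per edge that leaves `u`, which is what the time bound of a scan counts. -/
theorem degTo_lastEdge (u : Fin n) (j : ℕ) : degTo E u (lastEdge E u j) = degTo E u j := by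
  induction j with
  | zero => rfl
  | succ j ih =>
    simp only [lastEdge]
    split
    · rfl
    · rename_i h; rw [ih]; simp [degTo, h]

theorem tail_lastEdge (u : Fin n) {j p : ℕ} (h : lastEdge E u j = p + 1) :
    E[p]?.map Prod.fst = some u := by
  induction j with
  | zero => simp [lastEdge] at h
  | succ j ih =>
    simp only [lastEdge] at h
    split at h
    · rename_i h'; obtain rfl : j = p := by omega
      exact h'
    · exact ih h

theorem tail_ne_of_lastEdge_le (u : Fin n) {j i : ℕ} (h : lastEdge E u j ≤ i) (hi : i < j) :
    E[i]?.map Prod.fst ≠ some u := by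
  induction j with
  | zero => omega
  | succ j ih =>
    simp only [lastEdge] at h
    split at h
    · omega
    · rename_i h'
      rcases Nat.lt_succ_iff_lt_or_eq.mp hi with h1 | rfl
      · exact ih h h1
      · exact h'

theorem lastEdge_append (u : Fin n) (E' : List (Fin n × Fin n)) {j : ℕ} (hj : j ≤ E.length) :
    lastEdge (E ++ E') u j = lastEdge E u j := by
  induction j with
  | zero => rfl
  | succ j ih =>
    simp only [lastEdge]
    rw [ih (by omega), List.getElem?_append_left (by omega)]

theorem degTo_append (u : Fin n) (E' : List (Fin n × Fin n)) {j : ℕ} (hj : j ≤ E.length) :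
    degTo (E ++ E') u j = degTo E u j := by
  induction j with
  | zero => rfl
  | succ j ih =>
    simp only [degTo]
    rw [ih (by omega), List.getElem?_append_left (by omega)]

theorem degTo_mono (u : Fin n) {i j : ℕ} (h : i ≤ j) : degTo E u i ≤ degTo E u j := by
  induction h with
  | refl => exact le_rfl
  | step _ ih => simp only [degTo]; split <;> omega

theorem sum_degTo {j : ℕ} (hj : j ≤ E.length) : ∑ u, degTo E u j = j := by
  induction j with
  | zero => simp [degTo]
  | succ j ih =>
    have hj' : j < E.length := by omega
    have : ∀ u, degTo E u (j + 1) = degTo E u j + if E[j].1 = u then 1 else 0 := fun u => by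
      simp only [degTo, List.getElem?_eq_getElem hj', Option.map_some, Option.some.injEq]
      split <;> rfl
    simp only [this, Finset.sum_add_distrib, ih (by omega)]
    simp

/-! ### Breadth-first search -/

/-- The invariant of a breadth-first search from `x`. The depths plus one are `d₀` at the start and
`d` now, with `0` for vertices that have not been found; `P` are the vertices that have been
processed, and `R` are those that wait in the queue. -/
structure BFS (E : List (Fin n × Fin n)) (x : Fin n) (d₀ d : Fin n → ℕ) (P R : List (Fin n)) :
    Prop where
  nodup : (P ++ R).Nodup
  mem : ∀ v, v ∈ P ++ R ↔ d₀ v = 0 ∧ d v ≠ 0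
  old : ∀ v, d₀ v ≠ 0 → d v = d₀ v
  walk : ∀ v ∈ P ++ R, ∃ l, Walk E l x v ∧ d v = l + 1
  sorted : (P ++ R).Pairwise fun u v => d u ≤ d v
  span : ∀ u R', R = u :: R' → ∀ v ∈ P ++ R, d v ≤ d u + 1
  closed : ∀ u ∈ P, ∀ z, (u, z) ∈ E → d z ≠ 0 ∧ (d₀ z = 0 → d z ≤ d u + 1)
  root : d x = 1
  root_new : d₀ x = 0
  depth : ∀ v ∈ P ++ R, d v ≤ (P ++ R).length

namespace BFS

variable {x : Fin n} {d₀ d : Fin n → ℕ} {P R : List (Fin n)} {u z : Fin n}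

theorem init (h : d₀ x = 0) : BFS E x d₀ (Function.update d₀ x 1) [] [x] where
  nodup := by simp
  mem v := by
    by_cases hv : v = x
    · subst hv; simp [h]
    · simp [hv]
  old v hv := by
    have : v ≠ x := by rintro rfl; exact hv h
    simp [this]
  walk v hv := by
    obtain rfl : v = x := by simpa using hv
    exact ⟨0, .nil _, by simp⟩
  sorted := by simp
  span u R' hR v hv := by
    obtain ⟨rfl, rfl⟩ : x = u ∧ [] = R' := by simpa using hR
    obtain rfl : v = x := by simpa using hv
    simp
  closed := by simp
  root := by simp
  root_new := h
  depth v hv := by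
    obtain rfl : v = x := by simpa using hv
    simp

/-- The new vertex gets the largest depth present: by `span` no vertex found so far is deeper than
`d u + 1`, so appending it keeps the order. -/
theorem push (h : BFS E x d₀ d P (u :: R)) (he : (u, z) ∈ E) (hz : d z = 0) :
    BFS E x d₀ (Function.update d z (d u + 1)) P (u :: (R ++ [z])) := by
  have hz' : z ∉ P ++ u :: R := fun hm => ((h.mem z).mp hm).2 hz
  have hne : ∀ v ∈ P ++ u :: R, v ≠ z := fun v hv e => hz' (e ▸ hv)
  have hu : u ∈ P ++ u :: R := by simp
  have hd0 : d₀ z = 0 := by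
    by_contra h0
    exact h0 (by rw [← h.old z h0, hz])
  have hL : P ++ u :: (R ++ [z]) = (P ++ u :: R) ++ [z] := by simp
  constructor
  · rw [hL]
    exact List.nodup_append.mpr ⟨h.nodup, by simp, fun a ha b hb => by
      obtain rfl : b = z := by simpa using hb
      exact hne a ha⟩
  · intro v
    rw [hL, List.mem_append, h.mem v]
    by_cases hv : v = z
    · subst hv; simp [hd0]
    · simp [hv]
  · intro v hv
    have : v ≠ z := by rintro rfl; exact hv hd0
    simp [this, h.old v hv]
  · intro v hv
    rw [hL, List.mem_append] at hv
    rcases hv with hv | hv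
    · simpa [hne v hv] using h.walk v hv
    · obtain rfl : v = z := by simpa using hv
      obtain ⟨l, hw, hl⟩ := h.walk u hu
      exact ⟨l + 1, hw.snoc he, by simp [hl]⟩
  · rw [hL, List.pairwise_append]
    refine ⟨h.sorted.imp_of_mem fun {a b} ha hb hab => ?_, by simp, fun a ha b hb => ?_⟩
    · simpa [hne a ha, hne b hb] using hab
    · obtain rfl : b = z := by simpa using hb
      simpa [hne a ha] using h.span u R rfl a ha
  · intro u' R' hR v hv
    obtain ⟨rfl, rfl⟩ : u = u' ∧ R ++ [z] = R' := by simpa using hR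
    rw [hL, List.mem_append] at hv
    rcases hv with hv | hv
    · simpa [hne v hv, hne u hu] using h.span u R rfl v hv
    · obtain rfl : v = z := by simpa using hv
      simp [hne u hu]
  · intro p hp y hy
    have hp' : p ≠ z := hne p (by simp [hp])
    obtain ⟨h1, h2⟩ := h.closed p hp y hy
    have : y ≠ z := by rintro rfl; exact h1 hz
    simpa [this, hp'] using ⟨h1, h2⟩
  · have : x ≠ z := by rintro rfl; rw [h.root] at hz; omega
    simp [this, h.root]
  · exact h.root_new
  · intro v hv
    rw [hL, List.mem_append] at hv
    rw [hL, List.length_append, List.length_singleton]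
    rcases hv with hv | hv
    · have := h.depth v hv
      simp only [Function.update_of_ne (hne v hv)]
      omega
    · obtain rfl : v = z := by simpa using hv
      simpa using h.depth u hu

theorem handled (h : BFS E x d₀ d P (u :: R)) (hz : d z ≠ 0) :
    d z ≠ 0 ∧ (d₀ z = 0 → d z ≤ d u + 1) :=
  ⟨hz, fun h0 => h.span u R rfl z ((h.mem z).mpr ⟨h0, hz⟩)⟩

/-- The next vertex in the queue is at least as deep as `u`, so the bound `span` is inherited;
`closed` for `u` also comes from `span`. -/
theorem pop (h : BFS E x d₀ d P (u :: R))
    (hu : ∀ z, (u, z) ∈ E → d z ≠ 0) : BFS E x d₀ d (P ++ [u]) R := by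
  have hL : (P ++ [u]) ++ R = P ++ u :: R := by simp
  refine ⟨hL ▸ h.nodup, hL ▸ h.mem, h.old, hL ▸ h.walk, hL ▸ h.sorted, ?_, ?_, h.root, h.root_new,
    hL ▸ h.depth⟩
  · rintro u' R' rfl v hv
    rw [hL] at hv
    have h1 := h.span u _ rfl v hv
    have h2 : d u ≤ d u' := by
      have := (List.pairwise_append.mp h.sorted).2.1
      exact (List.pairwise_cons.mp this).1 u' (by simp)
    omega
  · intro p hp z hz
    rcases List.mem_append.mp hp with hp | hp
    · exact h.closed p hp z hz
    · obtain rfl : p = u := by simpa using hp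
      exact h.handled (hu z hz)

theorem length_le (h : BFS E x d₀ d P R) : (P ++ R).length ≤ n := by
  simpa using h.nodup.length_le_card

/-- A complete search on a fresh row computes the shortest distances. -/
theorem shortest (h : BFS E x (fun _ => 0) d P []) {v : Fin n} (hv : d v ≠ 0) :
    ∃ l, Shortest E l x v ∧ d v = l + 1 := by
  -- The recorded depth is at most any walk length plus one, by closedness along the walk; `walk`
  -- shows that it is attained.
  have key : ∀ l v, Walk E l x v → d v ≠ 0 ∧ d v ≤ l + 1 := by
    intro l v hw
    induction hw with
    | nil => simp [h.root]
    | snoc _ he ih =>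
      obtain ⟨h1, h2⟩ := ih h
      obtain ⟨h3, h4⟩ := h.closed _ (by simpa using (h.mem _).mpr ⟨rfl, h1⟩) _ he
      exact ⟨h3, by have := h4 rfl; omega⟩
  obtain ⟨l, hw, hl⟩ := h.walk v ((h.mem v).mpr ⟨rfl, hv⟩)
  exact ⟨l, ⟨hw, fun l' h' => by have := (key l' v h').2; omega⟩, hl⟩

/-- A complete search on a fresh row finds all vertices that can be reached. -/
theorem reach_iff (h : BFS E x (fun _ => 0) d P []) {v : Fin n} :
    d v ≠ 0 ↔ ∃ l, Walk E l x v := by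
  constructor
  · intro hv
    obtain ⟨l, hl, -⟩ := h.shortest hv
    exact ⟨l, hl.1⟩
  · rintro ⟨l, hl⟩
    refine hl.mem_of_closed (S := fun v => d v ≠ 0) (by simp [h.root]) fun p z he hp => ?_
    exact (h.closed p (by simpa using (h.mem p).mpr ⟨rfl, hp⟩) z he).1

/-- A search that continues an older one after the insertion of the edge `(a, x)`. -/
theorem reach_iff_of_insert {a v : Fin n} (h : BFS (E ++ [(a, x)]) x d₀ d P [])
    (hd : ∀ u, d₀ u ≠ 0 ↔ ∃ l, Walk E l v u) (ha : d₀ a ≠ 0) {u : Fin n} :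
    d u ≠ 0 ↔ ∃ l, Walk (E ++ [(a, x)]) l v u := by
  have hE : E ⊆ E ++ [(a, x)] := by simp
  have hold : ∀ y, d₀ y ≠ 0 → d y ≠ 0 := fun y hy => by rwa [h.old y hy]
  constructor
  · intro hu
    by_cases h0 : d₀ u = 0
    · obtain ⟨l, hl, -⟩ := h.walk u ((h.mem u).mpr ⟨h0, hu⟩)
      obtain ⟨l', hl'⟩ := (hd a).mp ha
      exact ⟨_, ((hl'.mono hE).snoc (by simp)).trans hl⟩
    · obtain ⟨l, hl⟩ := (hd u).mp h0
      exact ⟨l, hl.mono hE⟩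
  · rintro ⟨l, hl⟩
    refine hl.mem_of_closed (S := fun v => d v ≠ 0) (hold v ((hd v).mpr ⟨0, .nil _⟩))
      fun p z he hp => ?_
    -- The marked set is closed under edges: at newly marked vertices by the search, at old ones by
    -- the reachability in the old graph, and along the new edge because its head is the start of
    -- the search.
    by_cases h0 : d₀ p = 0
    · exact (h.closed p (by simpa using (h.mem p).mpr ⟨h0, hp⟩) z he).1
    · rcases List.mem_append.mp he with he | he
      · obtain ⟨l, hl⟩ := (hd p).mp h0
        exact hold z ((hd z).mpr ⟨_, hl.snoc he⟩)
      · obtain ⟨rfl, rfl⟩ : p = a ∧ z = x := by simpa using he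
        simp [h.root]

end BFS

/-- Nothing has to be done for a root if the new edge does not leave the set of the vertices that
it reaches. -/
theorem reach_iff_of_not_leaving {a b v : Fin n} {d : Fin n → ℕ}
    (hd : ∀ u, d u ≠ 0 ↔ ∃ l, Walk E l v u) (hab : d a ≠ 0 → d b ≠ 0) {u : Fin n} :
    d u ≠ 0 ↔ ∃ l, Walk (E ++ [(a, b)]) l v u := by
  constructor
  · intro hu
    obtain ⟨l, hl⟩ := (hd u).mp hu
    exact ⟨l, hl.mono (by simp)⟩
  · rintro ⟨l, hl⟩
    refine hl.mem_of_closed (S := fun v => d v ≠ 0) ((hd v).mpr ⟨0, .nil _⟩) fun p z he hp => ?_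
    rcases List.mem_append.mp he with he | he
    · obtain ⟨l, hl⟩ := (hd p).mp hp
      exact (hd z).mpr ⟨_, hl.snoc he⟩
    · obtain ⟨rfl, rfl⟩ : p = a ∧ z = b := by simpa using he
      exact hab hp

/-! ### Covers -/

/-- Every vertex has a member of `S` within distance less than `k`. -/
def Covers (E : List (Fin n × Fin n)) (S : Fin n → Prop) (k : ℕ) : Prop :=
  ∀ u, ∃ s, S s ∧ ∃ l < k, Walk E l s u

theorem Covers.mono (hE : E ⊆ E') {S : Fin n → Prop} {k : ℕ} (h : Covers E S k) :
    Covers E' S k := fun u => by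
  obtain ⟨s, hs, l, hl, hw⟩ := h u
  exact ⟨s, hs, l, hl, hw.mono hE⟩

/-- The root of a breadth-first tree and one residue class of its levels are a cover. -/
theorem covers_of_levels {r : Fin n} {f : Fin n → ℕ} (hf : ∀ u, Shortest E (f u) r u) {k i : ℕ}
    (hik : i < k) : Covers E (fun s => f s % k = i ∨ s = r) k := by
  intro u
  -- Go back on a shortest walk from the root to the nearest level congruent to `i`; this takes
  -- fewer than `k` steps.
  by_cases h : i ≤ f u % k
  · have hle : f u % k ≤ f u := Nat.mod_le _ _
    obtain ⟨x, h1, h2⟩ := (show Shortest E ((f u - (f u % k - i)) + (f u % k - i)) r u by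
      rw [Nat.sub_add_cancel (by omega)]; exact hf u).split
    refine ⟨x, Or.inl ?_, _, lt_of_le_of_lt (Nat.sub_le _ _) (Nat.mod_lt _ (by omega)), h2⟩
    rw [← h1.unique (hf x)]
    have h3 := Nat.div_add_mod (f u) k
    rw [show f u - (f u % k - i) = i + k * (f u / k) by omega, Nat.add_mul_mod_self_left,
      Nat.mod_eq_of_lt hik]
  · by_cases h0 : f u < k
    -- Above the first level of the class there is no such level; these vertices are the reason for
    -- adding the root.
    · exact ⟨r, Or.inr rfl, _, h0, (hf u).1⟩
    · have hmod : f u % k < k := Nat.mod_lt _ (by omega)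
      have h3 := Nat.div_add_mod (f u) k
      have hq : 1 ≤ f u / k := Nat.div_pos (by omega) (by omega)
      -- The residue of `f u` is smaller than `i`, so the level sought lies in the preceding block
      -- of `k` levels.
      obtain ⟨q, hq'⟩ : ∃ q, f u / k = q + 1 := ⟨f u / k - 1, by omega⟩
      rw [hq', Nat.mul_add] at h3
      obtain ⟨x, h1, h2⟩ := (show Shortest E ((i + k * q) + (f u - (i + k * q))) r u by
        rw [Nat.add_sub_cancel' (by omega)]; exact hf u).split
      refine ⟨x, Or.inl ?_, _, by omega, h2⟩
      rw [← h1.unique (hf x), Nat.add_mul_mod_self_left, Nat.mod_eq_of_lt hik]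

/-- If no member of a cover has small eccentricity, then the radius is not small. -/
theorem Covers.le_radius {S : Fin n → Prop} {k τ R : ℕ} (hn : 0 < n) (h : Covers E S k)
    (hS : ∀ s, S s → ¬ EccLE E s τ) (hR : radius E ≤ R) : τ + 2 ≤ R + k := by
  obtain ⟨c, hc⟩ := exists_eccLE hn hR
  obtain ⟨s, hs, l, hl, hw⟩ := h c
  -- A walk from `s` to the center `c` and then a walk from `c` have total length at most `R + k -
  -- 1`, which would be at most `τ`.
  by_contra hlt
  refine hS s hs fun u => ?_
  obtain ⟨l', hl', hw'⟩ := hc u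
  exact ⟨_, by omega, hw.trans hw'⟩

end IncRadius


namespace IncRadius

variable {n : ℕ} {E E' : List (Fin n × Fin n)}

/-! ### The search program

Use of the memory: variable `0` holds `n`, `1` the accuracy parameter, `2` the number of edges, `3`
and `4` the new edge, `5` the answer. The arrays `0` and `1` hold the tails and heads of the edges,
`2` and `3` the adjacency lists (edge numbers plus one, `0` at the end), `4` the rows of depths plus
one, `5` the queue of the search. -/

/-- The adjacency lists in the memory describe the graph. -/
structure Adj (E : List (Fin n × Fin n)) (s : Config n) : Prop where
  heads : ∀ i e, E[i]? = some e → s.arr 1 i = e.2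
  first : ∀ u : Fin n, s.arr 2 u = lastEdge E u E.length
  next : ∀ i e, E[i]? = some e → s.arr 3 i = lastEdge E e.1 i

theorem Adj.congr {s s' : Config n} (h : Adj E s) (h1 : s'.arr 1 = s.arr 1)
    (h2 : s'.arr 2 = s.arr 2) (h3 : s'.arr 3 = s.arr 3) : Adj E s' :=
  ⟨h1 ▸ h.heads, h2 ▸ h.first, h3 ▸ h.next⟩

/-- Scan the adjacency list of the vertex in variable `10` from the position in variable `11`. -/
def scanEdges : Cmd :=
  .loop (.var 11) (
    12 ≔ .cell 1 (.var 11 -ₑ .const 1) ;;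
    .ite (.cell 4 (.var 6 +ₑ .var 12)) .skip (
      .store 4 (.var 6 +ₑ .var 12) (.cell 4 (.var 6 +ₑ .var 10) +ₑ .const 1) ;;
      .store 5 (.var 9) (.var 12) ;;
      9 ≔ .var 9 +ₑ .const 1) ;;
    11 ≔ .cell 3 (.var 11 -ₑ .const 1))

/-- Breadth-first search in the row that starts at the position in variable `6`, from the vertex in
variable `7`. The number of the vertices that are found is left in variable `9`. -/
def search : Cmd :=
  .store 4 (.var 6 +ₑ .var 7) (.const 1) ;;
  .store 5 (.const 0) (.var 7) ;;
  8 ≔ .const 0 ;;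
  9 ≔ .const 1 ;;
  .loop (.var 8 <ₑ .var 9) (
    10 ≔ .cell 5 (.var 8) ;;
    8 ≔ .var 8 +ₑ .const 1 ;;
    11 ≔ .cell 2 (.var 10) ;;
    scanEdges)

/-- The part of the memory that is used by a search: the row at position `row` agrees with the state
of the search, the array `5` holds the queue, and the other rows are as in `s₀`. -/
structure SearchMem (E : List (Fin n × Fin n)) (row : ℕ) (x : Fin n) (s₀ s : Config n)
    (P R : List (Fin n)) : Prop where
  bfs : BFS E x (fun v => s₀.arr 4 (row + v)) (fun v => s.arr 4 (row + v)) P R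
  queue : ∀ (i : ℕ) (v : Fin n), (P ++ R)[i]? = some v → s.arr 5 i = v
  len : s.var 9 = (P ++ R).length
  other : ∀ i, (∀ v : Fin n, i ≠ row + v) → s.arr 4 i = s₀.arr 4 i

theorem SearchMem.congr {row : ℕ} {x : Fin n} {s₀ s s' : Config n} {P R : List (Fin n)}
    (h : SearchMem E row x s₀ s P R) (h4 : s'.arr 4 = s.arr 4) (h5 : s'.arr 5 = s.arr 5)
    (h9 : s'.var 9 = s.var 9) : SearchMem E row x s₀ s' P R := by
  obtain ⟨a, b, c, d⟩ := h
  exact ⟨by rw [h4]; exact a, by rw [h5]; exact b, h9.trans c, by rw [h4]; exact d⟩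

variable {A : BlackBox} {w : ℕ} {cur : List (Fin n × Fin n)}

/-- The list runs through the edges in decreasing position. The invariant says that the edges from
the current position on have been handled, and the elapsed time is paid by the degree already
consumed. -/
theorem scanEdges_spec {row : ℕ} {x u : Fin n} {s₀ s : Config n} {P R : List (Fin n)}
    (hadj : Adj E s) (hrow : s.var 6 = row) (hu : s.var 10 = u)
    (hp : s.var 11 = lastEdge E u E.length) (hw : row + n + 2 ≤ 2 ^ w)
    (hm : SearchMem E row x s₀ s P (u :: R)) :
    WP A w cur scanEdges s fun s' t =>
      (∃ R', SearchMem E row x s₀ s' P (u :: R') ∧ ∀ z, (u, z) ∈ E → s'.arr 4 (row + z) ≠ 0) ∧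
      t ≤ 2 + 40 * degTo E u E.length := by
  refine WP.loop (fun s' t => ∃ R', SearchMem E row x s₀ s' P (u :: R') ∧
      (∀ p, s'.var 11 = p + 1 → E[p]?.map Prod.fst = some u) ∧
      (∀ i z, s'.var 11 ≤ i → E[i]? = some (u, z) → s'.arr 4 (row + z) ≠ 0) ∧
      t + 40 * degTo E u (s'.var 11) ≤ 40 * degTo E u E.length) (fun s' => s'.var 11) ?_ ?_ ?_ ?_
  · refine ⟨R, hm, fun p h => tail_lastEdge u (h ▸ hp.symm), fun i z hi he => ?_, ?_⟩
    · have hi' : i < E.length := (List.getElem?_eq_some_iff.mp he).1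
      exact absurd (by simp [he]) (tail_ne_of_lastEdge_le u (hp ▸ hi) hi')
    · rw [hp, degTo_lastEdge]; omega
  · simp
  · rintro s' t hb hF ⟨R', hm', htail, hdone, ht⟩ hne
    have e6 := (hF.var 6 rfl).trans hrow
    have e10 := (hF.var 10 rfl).trans hu
    have hadj' := hadj.congr (hF.arr 1 rfl) (hF.arr 2 rfl) (hF.arr 3 rfl)
    obtain ⟨p, hp'⟩ : ∃ p, s'.var 11 = p + 1 := ⟨s'.var 11 - 1, by simp at hne; omega⟩
    have htl := htail p hp'
    obtain ⟨e, he, rfl⟩ := Option.map_eq_some_iff.mp htl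
    have hlt : p < E.length := (List.getElem?_eq_some_iff.mp he).1
    have hmem : (e.1, e.2) ∈ E := List.mem_of_getElem? he
    have hhead := hadj'.heads p e he
    have hnext := hadj'.next p e he
    have hle := lastEdge_le (E := E) e.1 p
    have hdeg : degTo E e.1 (p + 1) = degTo E e.1 (lastEdge E e.1 p) + 1 := by
      rw [degTo_lastEdge]; simp [degTo, he]
    -- Stated for an arbitrary row `f`, so that it serves both when the head was already marked and
    -- when it has just been marked. Between `lastEdge` and `p` there are no edges of this tail.
    have hdone' : ∀ (f : ℕ → ℕ), (∀ z : Fin n, s'.arr 4 (row + z) ≠ 0 → f (row + z) ≠ 0) →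
        f (row + e.2) ≠ 0 → ∀ i z, lastEdge E e.1 p ≤ i → E[i]? = some (e.1, z) →
        f (row + z) ≠ 0 := by
      intro f hf hf2 i z hi hez
      rcases Nat.lt_or_ge i p with h | h
      · exact absurd (by simp [hez]) (tail_ne_of_lastEdge_le e.1 hi h)
      · rcases h.eq_or_lt with rfl | h
        · rw [he] at hez
          have hz : e.2 = z := congrArg Prod.snd (Option.some.inj hez)
          exact hz ▸ hf2
        · exact hf z (hdone i z (by omega) hez)
    have hn := e.2.2
    have hw0 := hb.pos
    apply WP.seq
    refine WP.assign (by simp; omega) ?_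
    apply WP.seq
    refine WP.ite (by simp [e6, hp', hhead]; omega) ?_ ?_
    · intro hv
      refine WP.skip (WP.assign (by simp; omega) ⟨⟨R', ?_, ?_, ?_, ?_⟩, ?_⟩)
      · exact hm'.congr rfl rfl rfl
      · simp only [Config.put_var, Config.put_arr, Expr.val_cell, Expr.val_sub, Expr.val_var,
          Expr.val_const, hp']
        simp [hnext]
        intro p' hp''
        obtain ⟨e', h1, h2⟩ := Option.map_eq_some_iff.mp (tail_lastEdge e.1 hp'')
        exact ⟨e'.2, by rw [← h2]; exact h1⟩
      · simp [e6, hp', hhead] at hv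
        simp only [Config.put_var, Config.put_arr, Expr.val_cell, Expr.val_sub, Expr.val_var,
          Expr.val_const, hp']
        simp only [if_true, Nat.add_sub_cancel]
        simpa [hnext] using hdone' (s'.arr 4) (fun _ h => h) hv
      · simp [hp', hnext]
        rw [hp', hdeg] at ht
        omega
      · simp [hp', hnext]; omega
    · intro hv
      simp [e6, hp', hhead] at hv
      have hbfs := hm'.bfs.push hmem hv
      have hlen := hbfs.length_le
      have hdep := hm'.bfs.depth e.1 (by simp)
      simp only [List.length_append, List.length_cons] at hlen hdep
      have hlen9 := hm'.len
      simp only [List.length_append, List.length_cons] at hlen9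
      apply WP.seq
      refine WP.store (by simp [e6, hp', hhead]; omega) (by simp [e6, e10]; omega) ?_
      apply WP.seq
      refine WP.store (by simp) (by simp) ?_
      refine WP.assign (by simp; omega) ?_
      refine WP.assign (by simp; omega) ⟨⟨R' ++ [e.2], ?_, ?_, ?_, ?_⟩, ?_⟩
      · have harr : ∀ v : Fin n, (if (v : ℕ) = e.2 then s'.arr 4 (row + e.1) + 1
            else s'.arr 4 (row + v)) = Function.update (fun v : Fin n => s'.arr 4 (row + v)) e.2
            (s'.arr 4 (row + e.1) + 1) v := by
          intro v
          simp only [Function.update_apply, Fin.val_inj]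
        constructor
        · simp [e6, e10, hp', hhead, Function.update_apply]
          simp only [harr]
          exact hbfs
        · intro i v hi
          have hL : P ++ e.1 :: (R' ++ [e.2]) = (P ++ e.1 :: R') ++ [e.2] := by simp
          rw [hL] at hi
          simp [hp', hhead, Function.update_apply, hlen9]
          rcases Nat.lt_or_ge i (P ++ e.1 :: R').length with h | h
          · rw [List.getElem?_append_left h] at hi
            simp only [List.length_append, List.length_cons] at h
            rw [if_neg (by omega)]
            exact hm'.queue i v hi
          · rw [List.getElem?_append_right h] at hi
            simp only [List.length_append, List.length_cons] at h hi
            have h0 : i - (P.length + (R'.length + 1)) = 0 := by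
              have := (List.getElem?_eq_some_iff.mp hi).1
              simp at this; omega
            rw [h0] at hi
            simp at hi
            rw [if_pos (by omega), hi]
        · simp [hlen9]; omega
        · intro i hi
          simp [e6, hp', hhead, hi e.2]
          exact hm'.other i hi
      · simp [hp', hnext]
        intro p' hp''
        obtain ⟨e', h1, h2⟩ := Option.map_eq_some_iff.mp (tail_lastEdge e.1 hp'')
        exact ⟨e'.2, by rw [← h2]; exact h1⟩
      · have := hdone' (Function.update (s'.arr 4) (row + e.2) (s'.arr 4 (row + e.1) + 1))
          (fun z hz => by
            rw [Function.update_apply]; split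
            · simp
            · exact hz) (by simp)
        simp [e6, e10, hp', hhead, hnext]
        exact this
      · simp [hp', hnext]
        rw [hp', hdeg] at ht
        omega
      · simp [hp', hnext]; omega
  · rintro s' t hb hF ⟨R', hm', -, hdone, ht⟩ h0
    simp at h0
    refine ⟨⟨R', hm', fun z hz => ?_⟩, by simp; omega⟩
    obtain ⟨i, hi⟩ := List.mem_iff_getElem?.mp hz
    exact hdone i z (by omega) hi

/-- The time is expressed by the vertices that are actually processed. This allows it to be charged
to newly marked vertices when a search continues older ones. -/
theorem search_spec {row : ℕ} {x : Fin n} {s : Config n}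
    (hadj : Adj E s) (hrow : s.var 6 = row) (hx : s.var 7 = x) (h0 : s.arr 4 (row + x) = 0)
    (hw : row + n + 2 ≤ 2 ^ w) :
    WP A w cur search s fun s' t =>
      ∃ P, SearchMem E row x s s' P [] ∧
        t ≤ 40 + (P.map fun v => 40 * (degTo E v E.length + 1)).sum := by
  have hxn := x.2
  refine WP.bdd fun hb => ?_
  have hw0 := hb.pos
  unfold search
  apply WP.seq
  refine WP.store (by simp [hrow, hx]; omega) (by simp; omega) ?_
  apply WP.seq
  refine WP.store (by simp) (by simp) ?_
  apply WP.seq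
  refine WP.assign (by simp) ?_
  apply WP.seq
  refine WP.assign (by simp; omega) ?_
  refine WP.loop (fun s' t => ∃ P R, SearchMem E row x s s' P R ∧ s'.var 8 = P.length ∧
    t ≤ (P.map fun v => 40 * (degTo E v E.length + 1)).sum)
    (fun s' => n - s'.var 8) ?_ ?_ ?_ ?_
  · refine ⟨[], [x], ⟨?_, ?_, ?_, ?_⟩, ?_, ?_⟩
    · simp [hrow, hx, Function.update_apply]
      have := BFS.init (E := E) (x := x) (d₀ := fun v => s.arr 4 (row + v)) h0
      convert this using 2 with v
      simp [Function.update_apply, Fin.ext_iff]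
    · intro i v hi
      have h0 : i = 0 := by
        have := (List.getElem?_eq_some_iff.mp hi).1
        simp at this; omega
      subst h0
      simp at hi
      simp [hx, hi]
    · simp
    · intro i hi
      simp [hrow, hx, hi x]
    · simp
    · simp
  · simp
  · rintro s' t hb hF ⟨P, R, hm, h8, ht⟩ hlt
    have e6 : s'.var 6 = row := by rw [hF.var 6 rfl]; simpa using hrow
    have hadj' : Adj E s' := hadj.congr (by rw [hF.arr 1 rfl]; rfl) (by rw [hF.arr 2 rfl]; rfl)
      (by rw [hF.arr 3 rfl]; rfl)
    have h9 := hm.len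
    have hle := hm.bfs.length_le
    simp at hlt
    obtain ⟨u, R', rfl⟩ : ∃ u R', R = u :: R' := by
      cases R with
      | nil => simp at h9; omega
      | cons u R' => exact ⟨u, R', rfl⟩
    have hu : s'.arr 5 P.length = u := hm.queue _ _ (by simp)
    simp only [List.length_append, List.length_cons] at hle
    apply WP.seq
    refine WP.assign (by simp) ?_
    apply WP.seq
    refine WP.assign (by simp; omega) ?_
    apply WP.seq
    refine WP.assign (by simp) ?_
    refine WP.conseq (scanEdges_spec (row := row) (x := x) (u := u) (s₀ := s) (P := P) (R := R')
      (hadj'.congr rfl rfl rfl) (by simp [e6])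
      (by simp [h8, hu]) (by simp [h8, hu, hadj'.first]) hw (hm.congr rfl rfl rfl)) ?_
    rintro s₁ t₁ - hF₁ ⟨⟨R'', hm₁, hd⟩, ht₁⟩
    have h8' := hF₁.var 8 rfl
    simp [h8] at h8'
    refine ⟨⟨P ++ [u], R'', ⟨hm₁.bfs.pop hd, ?_, ?_, hm₁.other⟩, by simp [h8'], ?_⟩, ?_⟩
    · simpa using hm₁.queue
    · simpa using hm₁.len
    · simp; omega
    · rw [h8', h8]; omega
  · rintro s' t hb hF ⟨P, R, hm, h8, ht⟩ hlt
    have h9 := hm.len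
    simp at hlt
    obtain rfl : R = [] := by
      cases R with
      | nil => rfl
      | cons u R' => simp at h9; omega
    exact ⟨P, hm, by simp; omega⟩

end IncRadius


namespace IncRadius

variable {n : ℕ} {E E' : List (Fin n × Fin n)} {A : BlackBox} {w : ℕ} {cur : List (Fin n × Fin n)}

/-! ### Adjacency lists -/

/-- The adjacency lists of the first `j` edges. -/
structure AdjTo (E : List (Fin n × Fin n)) (j : ℕ) (s : Config n) : Prop where
  first : ∀ u : Fin n, s.arr 2 u = lastEdge E u j
  next : ∀ i e, i < j → E[i]? = some e → s.arr 3 i = lastEdge E e.1 i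

theorem AdjTo.adj {s : Config n} (h : AdjTo E E.length s)
    (h1 : ∀ i e, E[i]? = some e → s.arr 1 i = e.2) : Adj E s :=
  ⟨h1, h.first, fun i e he => h.next i e (List.getElem?_eq_some_iff.mp he).1 he⟩

theorem Adj.adjTo_append {s : Config n} (h : Adj E s) (e : Fin n × Fin n) :
    AdjTo (E ++ [e]) E.length s where
  first u := by rw [lastEdge_append u _ le_rfl, h.first]
  next i e' hi he := by
    rw [lastEdge_append _ _ hi.le]
    exact h.next i e' (by rwa [List.getElem?_append_left hi] at he)

/-- Put the edge with the number in variable `13` into the adjacency lists. -/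
def link : Cmd :=
  .store 3 (.var 13) (.cell 2 (.cell 0 (.var 13))) ;;
  .store 2 (.cell 0 (.var 13)) (.var 13 +ₑ .const 1)

/-- The former head of the list of the tail becomes the successor of the new edge, which is just the
recursion of `lastEdge`. -/
theorem link_spec {s : Config n} {j : ℕ} {e : Fin n × Fin n} (hj : s.var 13 = j)
    (he : E[j]? = some e) (h0 : s.arr 0 j = e.1) (h : AdjTo E j s) (hw : j + 1 < 2 ^ w) :
    WP A w cur link s fun s' t => AdjTo E (j + 1) s' ∧ t ≤ 20 := by
  refine WP.bdd fun hb => ?_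
  have hw0 := hb.pos
  unfold link
  apply WP.seq
  refine WP.store (by simp) (by simp) ?_
  refine WP.store (by simp) (by simp; omega) ⟨⟨fun u => ?_, fun i e' hi he' => ?_⟩, by simp⟩
  · by_cases hu : e.1 = u
    · subst hu
      simp [hj, h0, lastEdge, he]
    · have : (u : ℕ) ≠ e.1 := fun h => hu (Fin.ext h.symm)
      simp [hj, h0, lastEdge, he, hu, Function.update_of_ne this, h.first]
  · by_cases hij : i = j
    · obtain rfl : e = e' := Option.some.inj (he.symm.trans (hij ▸ he'))
      simp [hj, hij, h0, h.first]
    · simp [hj, Function.update_of_ne hij, h.next i e' (by omega) he']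

/-- Build the adjacency lists of the initial graph. -/
def build : Cmd :=
  13 ≔ .const 0 ;; .loop (.var 13 <ₑ .var 2) (link ;; 13 ≔ .var 13 +ₑ .const 1)

theorem build_spec {s : Config n} (h2 : s.var 2 = E.length)
    (h0 : ∀ i e, E[i]? = some e → s.arr 0 i = e.1) (h1 : ∀ i e, E[i]? = some e → s.arr 1 i = e.2)
    (hz : ∀ i, s.arr 2 i = 0) (hw : E.length + 1 < 2 ^ w) :
    WP A w cur build s fun s' t => Adj E s' ∧ t ≤ 40 * E.length + 10 := by
  refine WP.bdd fun hb => ?_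
  have hw0 := hb.pos
  unfold build
  apply WP.seq
  refine WP.assign (by simp) ?_
  refine WP.loop (fun s' t => AdjTo E (s'.var 13) s' ∧ s'.var 13 ≤ E.length ∧ t ≤ 40 * s'.var 13)
    (fun s' => E.length - s'.var 13) ?_ ?_ ?_ ?_
  · exact ⟨⟨fun u => by simp [lastEdge, hz], fun i e hi => by simp at hi⟩, by simp, by simp⟩
  · simp
  · rintro s' t hb' hF ⟨hA, hle, ht⟩ hlt
    have e2 : s'.var 2 = E.length := (hF.var 2 rfl).trans h2
    have a0 : s'.arr 0 = s.arr 0 := hF.arr 0 rfl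
    simp [e2] at hlt
    apply WP.seq
    refine (link_spec rfl (List.getElem?_eq_getElem hlt)
      (by rw [a0]; exact h0 _ _ (List.getElem?_eq_getElem hlt)) hA (by omega)).conseq ?_
    rintro s₁ t₁ hb₁ hF₁ ⟨hA₁, ht₁⟩
    have e13 := hF₁.var 13 rfl
    refine WP.assign (by simp; omega) ?_
    simp [e13]
    exact ⟨⟨⟨hA₁.first, hA₁.next⟩, by omega, by omega⟩, by omega⟩
  · rintro s' t hb' hF ⟨hA, hle, ht⟩ hlt
    have e2 : s'.var 2 = E.length := (hF.var 2 rfl).trans h2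
    have a1 : s'.arr 1 = s.arr 1 := hF.arr 1 rfl
    simp [e2] at hlt
    obtain hj : s'.var 13 = E.length := by omega
    exact ⟨(hj ▸ hA).adj (by rw [a1]; exact h1), by simp; omega⟩

/-! ### Incremental reachability from all roots -/

theorem row_inj {v v' u u' : ℕ} (hu : u < n) (hu' : u' < n) (h : v * n + u = v' * n + u') :
    v = v' ∧ u = u' := by
  have h1 : ∀ a b, b < n → (a * n + b) / n = a := fun a b hb => by
    rw [Nat.mul_comm, Nat.mul_add_div (by omega), Nat.div_eq_of_lt hb, Nat.add_zero]
  have hv : v = v' := by rw [← h1 v u hu, h, h1 v' u' hu']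
  subst hv
  exact ⟨rfl, by omega⟩

theorem row_le {v u : Fin n} : (v : ℕ) * n + u < n * n := by
  have h1 := v.2
  have h2 := u.2
  have : ((v : ℕ) + 1) * n ≤ n * n := Nat.mul_le_mul_right n h1
  rw [Nat.add_mul] at this
  omega

namespace BFS

variable {x : Fin n} {d₀ d : Fin n → ℕ} {P : List (Fin n)}

/-- A finished search has processed exactly the vertices that it has newly marked, so any weight on
unmarked vertices drops by the weight of `P`. This is the amortization of the incremental searches.
-/
theorem sum_unmarked (h : BFS E x d₀ d P []) (f : Fin n → ℕ) :
    (∑ u, if d₀ u = 0 then f u else 0) = (∑ u, if d u = 0 then f u else 0) + (P.map f).sum := by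
  have hP : (P.map f).sum = ∑ u, if u ∈ P then f u else 0 := by
    rw [← List.sum_toFinset f (by simpa using h.nodup), ← Finset.sum_filter]
    congr 1; ext; simp
  rw [hP, ← Finset.sum_add_distrib]
  refine Finset.sum_congr rfl fun u _ => ?_
  have hm := h.mem u
  have ho := h.old u
  simp only [List.append_nil] at hm
  by_cases h0 : d₀ u = 0 <;> by_cases h1 : d u = 0 <;> simp_all

theorem card_marked (h : BFS E x d₀ d P []) :
    (Finset.univ.filter fun u => d u ≠ 0).card =
      (Finset.univ.filter fun u => d₀ u ≠ 0).card + P.length := by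
  have := h.sum_unmarked fun _ => 1
  simp only [← Finset.sum_filter, Finset.sum_const, smul_eq_mul, mul_one, List.map_const',
    List.sum_replicate] at this
  have h1 := Finset.card_filter_add_card_filter_not (s := (Finset.univ : Finset (Fin n)))
    (fun u => d₀ u = 0)
  have h2 := Finset.card_filter_add_card_filter_not (s := (Finset.univ : Finset (Fin n)))
    (fun u => d u = 0)
  simp only [ne_eq]
  omega

end BFS

/-- The row of the vertex `v` and its counter. -/
structure RowOK (E : List (Fin n × Fin n)) (v : Fin n) (s : Config n) : Prop where
  mem : ∀ u : Fin n, s.arr 4 (v * n + u) ≠ 0 ↔ ∃ l, Walk E l v u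
  card : s.arr 6 v = (Finset.univ.filter fun u : Fin n => s.arr 4 (v * n + u) ≠ 0).card

/-- The row of the vertex `v` is empty. -/
structure RowZero (v : Fin n) (s : Config n) : Prop where
  mem : ∀ u : Fin n, s.arr 4 (v * n + u) = 0
  card : s.arr 6 v = 0

theorem RowOK.reachesAll_iff {v : Fin n} {s : Config n} (h : RowOK E v s) :
    s.arr 6 v = n ↔ ReachesAll E v := by
  rw [h.card]
  have : (Finset.univ.filter fun u : Fin n => s.arr 4 (v * n + u) ≠ 0).card = n ↔
      ∀ u : Fin n, s.arr 4 (v * n + u) ≠ 0 := by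
    conv_lhs => rhs; rw [← Fintype.card_fin n]
    rw [Finset.card_eq_iff_eq_univ]
    simp [Finset.ext_iff]
  rw [this]
  exact forall_congr' h.mem

theorem RowOK.congr {v : Fin n} {s s' : Config n} (h : RowOK E v s)
    (h4 : ∀ u : Fin n, s'.arr 4 (v * n + u) = s.arr 4 (v * n + u)) (h6 : s'.arr 6 v = s.arr 6 v) :
    RowOK E v s' :=
  ⟨fun u => by rw [h4]; exact h.mem u, by rw [h6, h.card]; simp only [h4]⟩

theorem RowZero.congr {v : Fin n} {s s' : Config n} (h : RowZero v s)
    (h4 : ∀ u : Fin n, s'.arr 4 (v * n + u) = s.arr 4 (v * n + u)) (h6 : s'.arr 6 v = s.arr 6 v) :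
    RowZero v s' :=
  ⟨fun u => by rw [h4]; exact h.mem u, by rw [h6, h.card]⟩

/-- The time that is reserved for the vertices that have not been marked in a row. -/
def rowPot (F : Fin n → ℕ) (v : Fin n) (s : Config n) : ℕ :=
  ∑ u : Fin n, if s.arr 4 (v * n + u) = 0 then 40 * (F u + 1) else 0

/-- The row before a scan: it is empty, or it is right for the graph without the new edge. -/
def RowPre (E : List (Fin n × Fin n)) (v : Fin n) (s : Config n) : Prop :=
  RowZero v s ∨ ∃ (E' : List (Fin n × Fin n)) (a b : Fin n), E = E' ++ [(a, b)] ∧ s.var 3 = a ∧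
    s.var 4 = b ∧ RowOK E' v s

/-- Search in a row, and update its counter. -/
def grow : Cmd :=
  search ;; .store 6 (.var 14) (.cell 6 (.var 14) +ₑ .var 9)

/-- Bring the row of the vertex in variable `14` up to date. -/
def visit : Cmd :=
  .ite (.cell 4 (.var 6 +ₑ .var 14))
    (.ite (.cell 4 (.var 6 +ₑ .var 3))
      (.ite (.cell 4 (.var 6 +ₑ .var 4)) .skip (7 ≔ .var 4 ;; grow))
      .skip)
    (7 ≔ .var 14 ;; grow)

/-- Bring all rows up to date, or stop at a root that reaches all vertices; it is left in variable
`16`, increased by one. -/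
def scan : Cmd :=
  14 ≔ .const 0 ;; 6 ≔ .const 0 ;; 15 ≔ .var 0 ;;
  .loop (.var 14 <ₑ .var 15) (
    visit ;;
    .ite (.cell 6 (.var 14) =ₑ .var 0) (16 ≔ .var 14 +ₑ .const 1 ;; 15 ≔ .const 0) .skip ;;
    14 ≔ .var 14 +ₑ .const 1 ;;
    6 ≔ .var 6 +ₑ .var 0)

/-- The potential released by the newly marked vertices pays for scanning their lists; only a
constant overhead remains. `F` bounds the current degrees, so the potential can be fixed once for
the final graph. -/
theorem grow_spec {F : Fin n → ℕ} {v x : Fin n} {s : Config n} (hF : ∀ u, degTo E u E.length ≤ F u)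
    (hadj : Adj E s) (h6 : s.var 6 = v * n) (h14 : s.var 14 = v) (h7 : s.var 7 = x)
    (h0 : s.arr 4 (v * n + x) = 0)
    (hc : s.arr 6 v = (Finset.univ.filter fun u : Fin n => s.arr 4 (v * n + u) ≠ 0).card)
    (hw : n * n + 3 * n + 20 ≤ 2 ^ w) :
    WP A w cur grow s fun s' t =>
      (∃ P, BFS E x (fun u => s.arr 4 (v * n + u)) (fun u => s'.arr 4 (v * n + u)) P []) ∧
      s'.arr 6 v = (Finset.univ.filter fun u : Fin n => s'.arr 4 (v * n + u) ≠ 0).card ∧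
      (∀ i, (∀ u : Fin n, i ≠ v * n + u) → s'.arr 4 i = s.arr 4 i) ∧
      (∀ i : ℕ, i ≠ v → s'.arr 6 i = s.arr 6 i) ∧ t + rowPot F v s' ≤ rowPot F v s + 50 := by
  have hv := v.2
  have hrow : (v : ℕ) * n ≤ n * n := Nat.mul_le_mul_right n hv.le
  unfold grow
  apply WP.seq
  refine (search_spec (row := v * n) (x := x) hadj h6 h7 h0 (by omega)).conseq ?_
  rintro s₁ t₁ hb hF₁ ⟨P, hm, ht⟩
  have e14 := (hF₁.var 14 rfl).trans h14
  have a6 := hF₁.arr 6 rfl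
  have hcard := hm.bfs.card_marked
  have hle : (Finset.univ.filter fun u : Fin n => s₁.arr 4 (v * n + u) ≠ 0).card ≤ n := by
    simpa using Finset.card_filter_le (Finset.univ : Finset (Fin n)) _
  have h9 : s₁.var 9 = P.length := by simpa using hm.len
  have hsum := hm.bfs.sum_unmarked fun u => 40 * (F u + 1)
  have hdeg : (P.map fun v => 40 * (degTo E v E.length + 1)).sum ≤
      (P.map fun v => 40 * (F v + 1)).sum :=
    List.sum_le_sum fun u _ => by have := hF u; omega
  have hcnt : s₁.arr 6 v + s₁.var 9 ≤ n := by rw [a6, hc, h9, ← hcard]; exact hle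
  refine WP.store (by simp) (by simp [e14]; omega) ?_
  simp only [Expr.val_var, e14, Expr.val_add, Expr.val_cell, a6, hc, h9]
  refine ⟨⟨P, by simpa using hm.bfs⟩, by simp [hcard], ?_, ?_, ?_⟩
  · simpa using hm.other
  · intro i hi
    simp [Function.update_of_ne hi, a6]
  · simp only [rowPot] at *
    simp
    omega

/-- An empty row needs a full search. Otherwise a search is necessary only if the new edge leaves
the reached set, and then it starts at the head of this edge. The marks made in this way are not
distances from `v`; only their being nonzero matters. -/
theorem visit_spec {F : Fin n → ℕ} {v : Fin n} {s : Config n} (hF : ∀ u, degTo E u E.length ≤ F u)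
    (hadj : Adj E s) (h6 : s.var 6 = v * n) (h14 : s.var 14 = v) (hrow : RowPre E v s)
    (hw : n * n + 3 * n + 20 ≤ 2 ^ w) :
    WP A w cur visit s fun s' t =>
      RowOK E v s' ∧ (∀ i, (∀ u : Fin n, i ≠ v * n + u) → s'.arr 4 i = s.arr 4 i) ∧
      (∀ i : ℕ, i ≠ v → s'.arr 6 i = s.arr 6 i) ∧ t + rowPot F v s' ≤ rowPot F v s + 70 := by
  have hv := v.2
  have hle : (v : ℕ) * n ≤ n * n := Nat.mul_le_mul_right n hv.le
  unfold visit
  rcases hrow with hz | ⟨E', a, b, rfl, ha, hb, hok⟩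
  · refine WP.ite (by simp [h6, h14]; omega) (fun h => absurd (hz.mem v) (by simpa [h6, h14] using h))
      fun _ => ?_
    apply WP.seq
    refine WP.assign (by simp) ?_
    refine WP.conseq (grow_spec (v := v) (x := v) hF (hadj.congr rfl rfl rfl) (by simpa using h6)
      (by simpa using h14) (by simpa using h14) (by simpa using hz.mem v)
      (by simp [hz.card, hz.mem]) hw) ?_
    rintro s₁ t₁ - - ⟨⟨P, hP⟩, h1, h2, h3, h4⟩
    simp only [Config.put_arr, hz.mem] at hP h2 h3
    change _ ≤ rowPot F v s + 50 at h4
    exact ⟨⟨fun u => hP.reach_iff, h1⟩, h2, h3, by simp; omega⟩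
  · have hvv : s.arr 4 (v * n + v) ≠ 0 := (hok.mem v).mpr ⟨0, .nil _⟩
    have han := a.2
    have hbn := b.2
    have skip_ok : (s.arr 4 (v * n + a) ≠ 0 → s.arr 4 (v * n + b) ≠ 0) →
        RowOK (E' ++ [(a, b)]) v s := fun h =>
      ⟨fun u => reach_iff_of_not_leaving (d := fun u : Fin n => s.arr 4 (v * n + u)) hok.mem h,
        hok.card⟩
    refine WP.ite (by simp [h6, h14]; omega) (fun _ => ?_)
      fun h => absurd (by simpa [h6, h14] using h) hvv
    refine WP.ite (by simp [h6, ha]; omega) (fun hva => ?_) fun hva => ?_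
    · simp only [Expr.val_cell, Expr.val_add, Expr.val_var, h6, ha] at hva
      refine WP.ite (by simp [h6, hb]; omega) (fun hvb => ?_) fun hvb => ?_
      · simp only [Expr.val_cell, Expr.val_add, Expr.val_var, h6, hb] at hvb
        exact WP.skip ⟨skip_ok fun _ => hvb, fun _ _ => rfl, fun _ _ => rfl, by simp; omega⟩
      · simp only [Expr.val_cell, Expr.val_add, Expr.val_var, h6, hb] at hvb
        apply WP.seq
        refine WP.assign (by simp) ?_
        refine WP.conseq (grow_spec (v := v) (x := b) hF (hadj.congr rfl rfl rfl)
          (by simpa using h6) (by simpa using h14) (by simpa using hb) (by simpa using hvb)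
          hok.card hw) ?_
        rintro s₁ t₁ - - ⟨⟨P, hP⟩, h1, h2, h3, h4⟩
        simp only [Config.put_arr] at hP h2 h3
        change _ ≤ rowPot F v s + 50 at h4
        exact ⟨⟨fun u => hP.reach_iff_of_insert hok.mem hva, h1⟩, h2, h3, by simp; omega⟩
    · simp only [Expr.val_cell, Expr.val_add, Expr.val_var, h6, ha] at hva
      exact WP.skip ⟨skip_ok fun h => absurd hva h, fun _ _ => rfl, fun _ _ => rfl, by simp; omega⟩

/-- If the scan stops early, the later rows are out of date, which is harmless because rows are not
needed once a root is known. The last clause is for strongly connected initial graphs: only the row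
of the first vertex is searched, so the cost has no factor `n`. -/
theorem scan_spec {F : Fin n → ℕ} {s : Config n} (hn : 0 < n)
    (hF : ∀ u, degTo E u E.length ≤ F u) (hadj : Adj E s) (h0 : s.var 0 = n) (h16 : s.var 16 = 0)
    (hrow : ∀ v, RowPre E v s) (hw : n * n + 3 * n + 20 ≤ 2 ^ w) :
    WP A w cur scan s fun s' t =>
      ((∃ r : Fin n, s'.var 16 = r + 1 ∧ ReachesAll E r) ∨
        (s'.var 16 = 0 ∧ (∀ v, ¬ ReachesAll E v) ∧ ∀ v, RowOK E v s')) ∧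
      (∀ i, n * n ≤ i → s'.arr 4 i = s.arr 4 i) ∧
      t + ∑ v, rowPot F v s' ≤ ∑ v, rowPot F v s + 150 * n + 150 ∧
      (ReachesAll E ⟨0, hn⟩ → RowZero ⟨0, hn⟩ s → s'.var 16 = 1 ∧
        t ≤ 200 + ∑ u, 40 * (F u + 1)) := by
  unfold scan
  apply WP.seq
  refine WP.assign (by simp) ?_
  apply WP.seq
  refine WP.assign (by simp) ?_
  apply WP.seq
  refine WP.assign (by simp) ?_
  -- Variable `15` is the upper limit of the loop; it is set to `0` when a root has been found. The
  -- clause on `var 14 = 0` records that no time has passed before the first row.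
  refine WP.loop (fun s' t => s'.var 6 = s'.var 14 * n ∧
      (∀ v : Fin n, s'.var 14 ≤ v → (∀ u : Fin n, s'.arr 4 (v * n + u) = s.arr 4 (v * n + u)) ∧
        s'.arr 6 v = s.arr 6 v) ∧
      (∀ i, n * n ≤ i → s'.arr 4 i = s.arr 4 i) ∧ s'.var 14 ≤ n ∧
      t + ∑ v, rowPot F v s' ≤ ∑ v, rowPot F v s + 150 * s'.var 14 ∧
      ((s'.var 15 = 0 ∧ (∃ r : Fin n, s'.var 16 = r + 1 ∧ ReachesAll E r) ∧
        (ReachesAll E ⟨0, hn⟩ → RowZero ⟨0, hn⟩ s → s'.var 16 = 1 ∧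
          t ≤ 150 + ∑ u, 40 * (F u + 1))) ∨
       (s'.var 15 = n ∧ s'.var 16 = 0 ∧
        (∀ v : Fin n, v < s'.var 14 → RowOK E v s' ∧ ¬ ReachesAll E v) ∧
        (s'.var 14 = 0 → t = 0))))
      (fun s' => s'.var 15 - s'.var 14) ?_ ?_ ?_ ?_
  · refine ⟨by simp, by simp, by simp, by simp, ?_, Or.inr ⟨by simp [h0], by simp [h16], by simp,
      by simp⟩⟩
    simp [rowPot]
  · simp
  · rintro s' t hb' hFr ⟨e6, hkeep, hbeyond, hle, hpot, hcase⟩ hlt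
    have hw0 := hb'.pos
    have e0 : s'.var 0 = n := (hFr.var 0 rfl).trans (by simpa using h0)
    have e3 : s'.var 3 = s.var 3 := (hFr.var 3 rfl).trans (by simp)
    have e4 : s'.var 4 = s.var 4 := (hFr.var 4 rfl).trans (by simp)
    have hadj' : Adj E s' := hadj.congr ((hFr.arr 1 rfl).trans rfl) ((hFr.arr 2 rfl).trans rfl)
      ((hFr.arr 3 rfl).trans rfl)
    simp at hlt
    rcases hcase with ⟨h15, -⟩ | ⟨h15, h16', hdone, hfirst⟩
    · omega
    rw [h15] at hlt
    obtain ⟨v, hv⟩ : ∃ v : Fin n, s'.var 14 = v := ⟨⟨s'.var 14, hlt⟩, rfl⟩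
    have hpre : RowPre E v s' := by
      obtain ⟨k1, k2⟩ := hkeep v hv.le
      rcases hrow v with h | ⟨E', a, b, h1, h2, h3, h4⟩
      · exact Or.inl (h.congr k1 k2)
      · exact Or.inr ⟨E', a, b, h1, e3.trans h2, e4.trans h3, h4.congr k1 k2⟩
    have hvn : (v : ℕ) * n + n ≤ n * n := by
      have := Nat.mul_le_mul_right n v.2
      rwa [Nat.succ_mul] at this
    apply WP.seq
    refine (visit_spec hF hadj' (hv ▸ e6) hv hpre hw).conseq ?_
    rintro s₁ t₁ hb₁ hF₁ ⟨hok, h4o, h6o, ht₁⟩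
    have f14 := (hF₁.var 14 rfl).trans hv
    have f6 := (hF₁.var 6 rfl).trans e6
    rw [hv] at f6
    have f0 := (hF₁.var 0 rfl).trans e0
    have f15 := (hF₁.var 15 rfl).trans h15
    have f16 := (hF₁.var 16 rfl).trans h16'
    have hother : ∀ v' : Fin n, v' ≠ v →
        (∀ u : Fin n, s₁.arr 4 (v' * n + u) = s'.arr 4 (v' * n + u)) ∧
          s₁.arr 6 v' = s'.arr 6 v' := fun v' hne =>
      ⟨fun u => h4o _ fun u' h => hne (Fin.ext (row_inj u.2 u'.2 h).1),
        h6o v' fun h => hne (Fin.ext h)⟩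
    have hpot₁ : ∑ v', rowPot F v' s₁ + rowPot F v s' = ∑ v', rowPot F v' s' + rowPot F v s₁ := by
      rw [← Finset.add_sum_erase _ (fun v' => rowPot F v' s₁) (Finset.mem_univ v),
        ← Finset.add_sum_erase _ (fun v' => rowPot F v' s') (Finset.mem_univ v)]
      have : ∑ v' ∈ Finset.univ.erase v, rowPot F v' s₁ =
          ∑ v' ∈ Finset.univ.erase v, rowPot F v' s' :=
        Finset.sum_congr rfl fun v' hv' => by
          simp only [rowPot, (hother v' (Finset.ne_of_mem_erase hv')).1]
      rw [this]; ring
    have hbeyond₁ : ∀ i, n * n ≤ i → s₁.arr 4 i = s.arr 4 i := fun i hi => by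
      rw [h4o i fun u h => by have := row_le (v := v) (u := u); omega, hbeyond i hi]
    have hkeep₁ : ∀ v' : Fin n, (v : ℕ) + 1 ≤ v' →
        (∀ u : Fin n, s₁.arr 4 (v' * n + u) = s.arr 4 (v' * n + u)) ∧
        s₁.arr 6 v' = s.arr 6 v' := fun v' hv' => by
      have hne : v' ≠ v := by rintro rfl; omega
      obtain ⟨k1, k2⟩ := hkeep v' (by omega)
      obtain ⟨k3, k4⟩ := hother v' hne
      exact ⟨fun u => (k3 u).trans (k1 u), k4.trans k2⟩
    have hall := hok.reachesAll_iff
    apply WP.seq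
    refine WP.ite (by simp) (fun hc => ?_) fun hc => ?_
    · simp only [Expr.val_eq, Expr.val_cell, Expr.val_var, f14, f0, ne_eq, truth_eq_zero,
        not_not] at hc
      apply WP.seq
      refine WP.assign (by simp [f14]; omega) ?_
      refine WP.assign (by simp) ?_
      apply WP.seq
      refine WP.assign (by simp [f14]; omega) ?_
      refine WP.assign (by simp [f6, f0]; omega) ?_
      simp only [Config.put_var, Config.put_arr, Expr.val_var, Expr.val_add, Expr.val_const, f14,
        f6, f0, rowPot] at *
      simp
      refine ⟨⟨by ring, hkeep₁, hbeyond₁, by omega, ⟨v, rfl, hall.mp hc⟩, ?_⟩, by omega⟩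
      intro hr hz
      -- If the first vertex reaches everything, then the loop cannot have passed it without
      -- stopping.
      have hv0 : (v : ℕ) = 0 := by
        by_contra hne
        exact (hdone ⟨0, hn⟩ (by simp; omega)).2 hr
      have ht0 := hfirst (hv.trans hv0)
      have hrz : ∑ u : Fin n, (if s'.arr 4 (v * n + u) = 0 then 40 * (F u + 1) else 0) ≤
          ∑ u : Fin n, 40 * (F u + 1) :=
        Finset.sum_le_sum fun u _ => by split <;> omega
      exact ⟨hv0, by omega⟩
    · simp only [Expr.val_eq, Expr.val_cell, Expr.val_var, f14, f0, truth_eq_zero] at hc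
      refine WP.skip ?_
      apply WP.seq
      refine WP.assign (by simp [f14]; omega) ?_
      refine WP.assign (by simp [f6, f0]; omega) ?_
      simp only [Config.put_var, Config.put_arr, Expr.val_var, Expr.val_add, Expr.val_const, f14,
        f6, f0, f15, f16, rowPot] at *
      simp
      refine ⟨⟨by ring, hkeep₁, hbeyond₁, by omega, ?_⟩, by omega⟩
      intro v' hv'
      by_cases hne : v' = v
      · subst hne
        exact ⟨⟨hok.mem, hok.card⟩, fun h => hc (hall.mpr h)⟩
      · obtain ⟨k3, k4⟩ := hother v' hne
        have hlt' : (v' : ℕ) < v := by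
          have : (v' : ℕ) ≠ v := fun h => hne (Fin.ext h)
          omega
        obtain ⟨h1, h2⟩ := hdone v' (by omega)
        exact ⟨h1.congr k3 k4, h2⟩
  · rintro s' t hb' hFr ⟨e6, hkeep, hbeyond, hle, hpot, hcase⟩ hlt
    simp at hlt
    refine ⟨?_, hbeyond, by simp; omega, ?_⟩
    · rcases hcase with ⟨-, h, -⟩ | ⟨h15, h16', hdone, -⟩
      · exact Or.inl h
      · exact Or.inr ⟨h16', fun v => (hdone v (by have := v.2; omega)).2,
          fun v => (hdone v (by have := v.2; omega)).1⟩
    · intro hr hz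
      rcases hcase with ⟨-, -, h⟩ | ⟨h15, h16', hdone, -⟩
      · obtain ⟨h1, h2⟩ := h hr hz
        exact ⟨h1, by simp; omega⟩
      · exact absurd hr (hdone ⟨0, hn⟩ (by simp; omega)).2

end IncRadius


namespace IncRadius

variable {n : ℕ} {E E' : List (Fin n × Fin n)} {A : BlackBox} {w : ℕ} {cur : List (Fin n × Fin n)}

/-! ### Choosing a residue class of the levels -/

theorem truth_le_one (p : Prop) : truth p ≤ 1 := by unfold truth; split <;> omega

/-- The number of the vertices below `j` with a property. -/
noncomputable def countBelow (p : Fin n → Prop) (j : ℕ) : ℕ :=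
  open Classical in (Finset.univ.filter fun u : Fin n => u < j ∧ p u).card

theorem countBelow_zero (p : Fin n → Prop) : countBelow p 0 = 0 := by simp [countBelow]

theorem countBelow_succ (p : Fin n → Prop) (v : Fin n) :
    countBelow p (v + 1) = countBelow p v + truth (p v) := by
  classical
  unfold countBelow truth
  split
  · rename_i hv
    rw [← Finset.card_insert_of_notMem (a := v) (by simp)]
    refine congrArg Finset.card (Finset.ext fun u => ?_)
    simp only [Finset.mem_filter, Finset.mem_univ, true_and, Finset.mem_insert, Fin.ext_iff]
    constructor
    · rintro ⟨h1, h2⟩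
      rcases Nat.lt_succ_iff_lt_or_eq.mp h1 with h | h
      · exact Or.inr ⟨h, h2⟩
      · exact Or.inl h
    · rintro (h | ⟨h1, h2⟩)
      · obtain rfl : u = v := Fin.ext h
        exact ⟨by omega, hv⟩
      · exact ⟨by omega, h2⟩
  · rename_i hv
    refine (congrArg Finset.card (Finset.ext fun u => ?_)).trans (Nat.add_zero _).symm
    simp only [Finset.mem_filter, Finset.mem_univ, true_and]
    refine ⟨fun ⟨h1, h2⟩ => ⟨?_, h2⟩, fun ⟨h1, h2⟩ => ⟨by omega, h2⟩⟩
    rcases Nat.lt_succ_iff_lt_or_eq.mp h1 with h | h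
    · exact h
    · obtain rfl : u = v := Fin.ext h
      exact absurd h2 hv

theorem countBelow_self (p : Fin n → Prop) [DecidablePred p] :
    countBelow p n = (Finset.univ.filter p).card := by
  unfold countBelow
  congr 1
  ext u
  simp

theorem countBelow_le (p : Fin n → Prop) (j : ℕ) : countBelow p j ≤ n := by
  classical
  exact (Finset.card_filter_le _ _).trans (by simp)

@[simp] theorem truth_true : truth True = 1 := by simp [truth]
@[simp] theorem truth_false : truth False = 0 := by simp

/-- The levels of the breadth-first tree are stored after the rows of all vertices. -/
def TreeMem (dep : Fin n → ℕ) (s : Config n) : Prop :=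
  ∀ u : Fin n, s.arr 4 (n * n + u) = dep u + 1

/-- The level of the vertex in the variable `x`, modulo the number in variable `18`. -/
def residue (x : ℕ) : Expr :=
  (.cell 4 (.var 0 *ₑ .var 0 +ₑ .var x) -ₑ .const 1) %ₑ .var 18

/-- Find a residue class modulo the number in variable `18` that contains few levels, counted with
the number of their vertices; it is left in variable `19`. -/
def select : Cmd :=
  20 ≔ .const 0 ;;
  .loop (.var 20 <ₑ .var 18) (.store 7 (.var 20) (.const 0) ;; 20 ≔ .var 20 +ₑ .const 1) ;;
  20 ≔ .const 0 ;;
  .loop (.var 20 <ₑ .var 0) (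
    21 ≔ residue 20 ;;
    .store 7 (.var 21) (.cell 7 (.var 21) +ₑ .const 1) ;;
    20 ≔ .var 20 +ₑ .const 1) ;;
  19 ≔ .const 0 ;;
  20 ≔ .const 1 ;;
  .loop (.var 20 <ₑ .var 18) (
    .ite (.cell 7 (.var 20) <ₑ .cell 7 (.var 19)) (19 ≔ .var 20) .skip ;;
    20 ≔ .var 20 +ₑ .const 1)

/-- The `k` residue classes partition the vertices, so a smallest class has at most the average
size. -/
theorem mul_card_class_le {f : Fin n → ℕ} {k i : ℕ} (hk : 0 < k)
    (hmin : ∀ i' < k, (Finset.univ.filter fun u => f u % k = i).card ≤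
      (Finset.univ.filter fun u => f u % k = i').card) :
    k * (Finset.univ.filter fun u => f u % k = i).card ≤ n := by
  have h := Finset.card_eq_sum_card_fiberwise (s := (Finset.univ : Finset (Fin n)))
    (t := Finset.range k) (f := fun u => f u % k)
    (fun u _ => by simpa using Nat.mod_lt _ hk)
  rw [Finset.card_univ, Fintype.card_fin] at h
  calc k * (Finset.univ.filter fun u => f u % k = i).card
      = ∑ _i' ∈ Finset.range k, (Finset.univ.filter fun u => f u % k = i).card := by simp
    _ ≤ ∑ i' ∈ Finset.range k, (Finset.univ.filter fun u => f u % k = i').card :=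
        Finset.sum_le_sum fun i' hi' => hmin i' (Finset.mem_range.mp hi')
    _ = n := h.symm

theorem clear_residues_spec {s : Config n} {k : ℕ} (h18 : s.var 18 = k) (h20 : s.var 20 = 0)
    (hk : k ≤ n) (hw : n + 20 ≤ 2 ^ w) :
    WP A w cur (.loop (.var 20 <ₑ .var 18)
      (.store 7 (.var 20) (.const 0) ;; 20 ≔ .var 20 +ₑ .const 1)) s fun s' t =>
      (∀ i < k, s'.arr 7 i = 0) ∧ t ≤ 20 * k + 10 := by
  refine WP.loop (fun s' t => (∀ i < s'.var 20, s'.arr 7 i = 0) ∧ s'.var 20 ≤ k ∧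
    t ≤ 20 * s'.var 20) (fun s' => k - s'.var 20) ?_ ?_ ?_ ?_
  · simp [h20]
  · simp
  · rintro s' t hb hF ⟨hz, hle, ht⟩ hlt
    have hw0 := hb.pos
    have e18 := (hF.var 18 rfl).trans h18
    simp [e18] at hlt
    apply WP.seq
    refine WP.store (by simp) (by simp) ?_
    refine WP.assign (by simp; omega) ?_
    simp
    refine ⟨⟨fun i hi => ?_, by omega, by omega⟩, by omega⟩
    rw [Function.update_apply]
    split
    · rfl
    · exact hz i (by omega)
  · rintro s' t hb hF ⟨hz, hle, ht⟩ hlt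
    have e18 := (hF.var 18 rfl).trans h18
    simp [e18] at hlt
    exact ⟨fun i hi => hz i (by omega), by simp; omega⟩

theorem residue_fits {s : Config n} {x : ℕ} (hb : Bdd w s) (h0 : s.var 0 = n) (hx : s.var x < n)
    (hw : n * n + 3 * n + 20 ≤ 2 ^ w) : (residue x).Fits w s := by
  have := hb.pos
  simp [residue, h0]; omega

theorem residue_val {dep : Fin n → ℕ} {s : Config n} {x : ℕ} {u : Fin n} (h0 : s.var 0 = n)
    (hx : s.var x = u) (ht : TreeMem dep s) : (residue x).val s = dep u % s.var 18 := by
  have := ht u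
  simp [residue, h0, hx, this]

theorem count_residues_spec {dep : Fin n → ℕ} {s : Config n} {k : ℕ} (h0 : s.var 0 = n)
    (h18 : s.var 18 = k) (h20 : s.var 20 = 0) (hk : 0 < k) (htree : TreeMem dep s)
    (hz : ∀ i < k, s.arr 7 i = 0) (hw : n * n + 3 * n + 20 ≤ 2 ^ w) :
    WP A w cur (.loop (.var 20 <ₑ .var 0) (
      21 ≔ residue 20 ;;
      .store 7 (.var 21) (.cell 7 (.var 21) +ₑ .const 1) ;;
      20 ≔ .var 20 +ₑ .const 1)) s fun s' t =>
      (∀ i < k, s'.arr 7 i = (Finset.univ.filter fun u => dep u % k = i).card) ∧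
      t ≤ 40 * n + 10 := by
  refine WP.loop (fun s' t => (∀ i < k, s'.arr 7 i =
      countBelow (fun u => dep u % k = i) (s'.var 20)) ∧ s'.var 20 ≤ n ∧
    t ≤ 40 * s'.var 20) (fun s' => n - s'.var 20) ?_ ?_ ?_ ?_
  · simpa [h20, countBelow_zero] using hz
  · simp
  · rintro s' t hb hF ⟨hc, hle, ht⟩ hlt
    have hw0 := hb.pos
    have e18 := (hF.var 18 rfl).trans h18
    have e0 := (hF.var 0 rfl).trans h0
    have htree' : TreeMem dep s' := fun u => by rw [hF.arr 4 rfl]; exact htree u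
    simp [e0] at hlt
    obtain ⟨v, hv⟩ : ∃ v : Fin n, s'.var 20 = v := ⟨⟨_, hlt⟩, rfl⟩
    have hmod : dep v % k < k := Nat.mod_lt _ hk
    have hcv := hc _ hmod
    have hcard := countBelow_le (fun u => dep u % k = dep v % k) (s'.var 20)
    apply WP.seq
    refine WP.assign (residue_fits hb e0 hlt hw) ?_
    rw [residue_val e0 hv htree', e18]
    apply WP.seq
    refine WP.store (by simp) (by simp; omega) ?_
    refine WP.assign (by simp; omega) ?_
    simp [residue]
    refine ⟨⟨fun i hi => ?_, by omega, by omega⟩, by omega⟩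
    rw [hv, countBelow_succ, ← hv, ← hc i hi, Function.update_apply]
    split
    · rename_i h; subst h; simp
    · rename_i h; simp [Ne.symm h]
  · rintro s' t hb hF ⟨hc, hle, ht⟩ hlt
    have e0 := (hF.var 0 rfl).trans h0
    simp [e0] at hlt
    refine ⟨fun i hi => ?_, by simp; omega⟩
    rw [hc i hi, show s'.var 20 = n by omega, countBelow_self]

theorem select_spec {dep : Fin n → ℕ} {s : Config n} {k : ℕ} (h0 : s.var 0 = n)
    (h18 : s.var 18 = k) (hk : 0 < k) (hkn : k ≤ n) (htree : TreeMem dep s)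
    (hw : n * n + 3 * n + 20 ≤ 2 ^ w) :
    WP A w cur select s fun s' t => ∃ i < k, s'.var 19 = i ∧
      k * (Finset.univ.filter fun u => dep u % k = i).card ≤ n ∧ t ≤ 150 * n + 100 := by
  refine WP.bdd fun hb => ?_
  have hw0 := hb.pos
  unfold select
  apply WP.seq
  refine WP.assign (by simp) ?_
  apply WP.seq
  refine WP.conseq (clear_residues_spec (k := k) (by simpa using h18) (by simp) hkn (by omega)) ?_
  rintro s₁ t₁ hb₁ hF₁ ⟨hz₁, ht₁⟩
  have f0 := (hF₁.var 0 rfl).trans (by simpa using h0)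
  have f18 := (hF₁.var 18 rfl).trans (by simpa using h18)
  apply WP.seq
  refine WP.assign (by simp) ?_
  apply WP.seq
  refine WP.conseq (count_residues_spec (k := k) (dep := dep) (by simpa using f0)
    (by simpa using f18) (by simp) hk (fun u => by
      have := congrFun (hF₁.arr 4 rfl) (n * n + u)
      simp at this ⊢; rw [this]; exact htree u) (by simpa using hz₁) hw) ?_
  rintro s₂ t₂ hb₂ hF₂ ⟨hc, ht₂⟩
  have g18 := (hF₂.var 18 rfl).trans (by simpa using f18)
  apply WP.seq
  refine WP.assign (by simp) ?_
  apply WP.seq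
  refine WP.assign (by simp; omega) ?_
  refine WP.loop (fun s' t => s'.var 19 < k ∧ (∀ i < s'.var 20, i < k →
    s'.arr 7 (s'.var 19) ≤ s'.arr 7 i) ∧ 1 ≤ s'.var 20 ∧ s'.var 20 ≤ k ∧ t + 40 ≤ 40 * s'.var 20)
    (fun s' => k - s'.var 20) ?_ ?_ ?_ ?_
  · simp; exact ⟨hk, hk⟩
  · simp
  · rintro s' t hb' hF ⟨h19, hmin, h1, hle, ht⟩ hlt
    have e18 := (hF.var 18 rfl).trans (by simpa using g18)
    simp [e18] at hlt
    apply WP.seq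
    refine WP.ite (by simp) (fun hv => ?_) fun hv => ?_
    · simp at hv
      refine WP.assign (by simp) (WP.assign (by simp; omega) ?_)
      simp
      refine ⟨⟨hlt, fun i hi hik => ?_, by omega, by omega⟩, by omega⟩
      rcases hi.lt_or_eq with h | rfl
      · exact hv.le.trans (hmin i h hik)
      · exact le_rfl
    · simp at hv
      refine WP.skip (WP.assign (by simp; omega) ?_)
      simp
      refine ⟨⟨h19, fun i hi hik => ?_, by omega, by omega⟩, by omega⟩
      rcases hi.lt_or_eq with h | rfl
      · exact hmin i h hik
      · exact hv
  · rintro s' t hb' hF ⟨h19, hmin, h1, hle, ht⟩ hlt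
    have e18 := (hF.var 18 rfl).trans (by simpa using g18)
    have a7 : s'.arr 7 = s₂.arr 7 := hF.arr 7 rfl
    simp [e18] at hlt
    refine ⟨_, h19, rfl, mul_card_class_le hk fun i' hi' => ?_, by simp; omega⟩
    rw [← hc _ h19, ← hc _ hi', ← a7]
    exact hmin i' (by omega) hi'

/-! ### A first estimate of the radius -/

namespace BFS

variable {x : Fin n} {d : Fin n → ℕ} {P : List (Fin n)}

theorem length_eq_iff (h : BFS E x (fun _ => 0) d P []) : P.length = n ↔ ReachesAll E x := by
  have hc := h.card_marked
  simp only [ne_eq, not_true_eq_false, Finset.filter_false, Finset.card_empty, zero_add] at hc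
  rw [← hc]
  conv_lhs => rhs; rw [← Fintype.card_fin n]
  rw [Finset.card_eq_iff_eq_univ]
  simp only [Finset.ext_iff, Finset.mem_filter, Finset.mem_univ, true_and, iff_true]
  exact forall_congr' fun v => h.reach_iff

/-- The last vertex that is found determines the eccentricity. -/
theorem last (h : BFS E x (fun _ => 0) d P []) (hr : ReachesAll E x) :
    ∃ z : Fin n, P[P.length - 1]? = some z ∧ d z ≤ n ∧ EccLE E x (d z - 1) ∧
      ∀ l, EccLE E x l → d z - 1 ≤ l := by
  have hP : ∀ v, v ∈ P := fun v => by simpa using (h.mem v).mpr ⟨rfl, h.reach_iff.mpr (hr v)⟩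
  have hne : P ≠ [] := List.ne_nil_of_mem (hP x)
  obtain ⟨P', z, rfl⟩ := List.eq_nil_or_concat'  P |>.resolve_left hne
  have hmax : ∀ v, d v ≤ d z := fun v => by
    have hs := h.sorted
    simp only [List.append_nil, List.pairwise_append] at hs
    rcases List.mem_append.mp (hP v) with hv | hv
    · exact hs.2.2 v hv z (by simp)
    · obtain rfl : v = z := by simpa using hv
      exact le_rfl
  obtain ⟨l, hl, hd⟩ := h.shortest (h.reach_iff.mpr (hr z))
  refine ⟨z, by simp, by have := hl.lt; omega, fun u => ?_, fun l' hl' => ?_⟩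
  · obtain ⟨l', hl', hd'⟩ := h.shortest (h.reach_iff.mpr (hr u))
    exact ⟨l', by have := hmax u; omega, hl'.1⟩
  · obtain ⟨l'', hle, hw⟩ := hl' z
    have := hl.2 _ hw
    omega

end BFS

/-- Empty the row at the position in variable `6`, and search from the vertex in variable `23`. If
all vertices are found, then variable `22` is lowered to the eccentricity of this vertex. -/
def lowerByEcc : Cmd :=
  20 ≔ .const 0 ;;
  .loop (.var 20 <ₑ .var 0) (
    .store 4 (.var 6 +ₑ .var 20) (.const 0) ;; 20 ≔ .var 20 +ₑ .const 1) ;;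
  7 ≔ .var 23 ;;
  search ;;
  .ite (.var 9 =ₑ .var 0) (
    21 ≔ .cell 4 (.var 6 +ₑ .cell 5 (.var 9 -ₑ .const 1)) -ₑ .const 1 ;;
    .ite (.var 21 <ₑ .var 22) (22 ≔ .var 21) .skip) .skip

/-- The vertex in variable `23` belongs to the residue class in variable `19`, or it is the root. -/
def inClass : Expr := (residue 23 =ₑ .var 19) +ₑ (.var 23 +ₑ .const 1 =ₑ .var 16)

/-- Compute a breadth-first tree from the root, and an estimate of the radius in variable `22`. -/
def estimateRadius : Cmd :=
  6 ≔ .var 0 *ₑ .var 0 ;;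
  7 ≔ .var 16 -ₑ .const 1 ;;
  search ;;
  22 ≔ .cell 4 (.var 6 +ₑ .cell 5 (.var 9 -ₑ .const 1)) -ₑ .const 1 ;;
  18 ≔ .var 0 ;;
  6 ≔ .var 6 +ₑ .var 0 ;;
  .loop ((.const 1 <ₑ .var 18) *ₑ (.var 22 <ₑ .const 2 *ₑ .var 18)) (
    18 ≔ .var 18 /ₑ .const 2 ;;
    select ;;
    23 ≔ .const 0 ;;
    .loop (.var 23 <ₑ .var 0) (
      .ite inClass lowerByEcc .skip ;;
      23 ≔ .var 23 +ₑ .const 1))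

theorem sum_degTo_of_nodup {P : List (Fin n)} (hP : P.Nodup) :
    (P.map fun v => 40 * (degTo E v E.length + 1)).sum ≤ 40 * (E.length + n) := by
  rw [← List.sum_toFinset _ hP]
  calc ∑ v ∈ P.toFinset, 40 * (degTo E v E.length + 1)
      ≤ ∑ v, 40 * (degTo E v E.length + 1) :=
        Finset.sum_le_sum_of_subset (Finset.subset_univ _)
    _ = 40 * (E.length + n) := by
        rw [← Finset.mul_sum, Finset.sum_add_distrib, sum_degTo le_rfl]; simp

theorem clear_row_spec {s : Config n} (h0 : s.var 0 = n) (h6 : s.var 6 = n * n + n)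
    (h20 : s.var 20 = 0) (hw : n * n + 3 * n + 20 ≤ 2 ^ w) :
    WP A w cur (.loop (.var 20 <ₑ .var 0) (
      .store 4 (.var 6 +ₑ .var 20) (.const 0) ;; 20 ≔ .var 20 +ₑ .const 1)) s fun s' t =>
      (∀ u : Fin n, s'.arr 4 (n * n + n + u) = 0) ∧ (∀ i < n * n + n, s'.arr 4 i = s.arr 4 i) ∧
      t ≤ 20 * n + 10 := by
  refine WP.loop (fun s' t => (∀ u : Fin n, u < s'.var 20 → s'.arr 4 (n * n + n + u) = 0) ∧
    (∀ i < n * n + n, s'.arr 4 i = s.arr 4 i) ∧ s'.var 20 ≤ n ∧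
    t ≤ 20 * s'.var 20) (fun s' => n - s'.var 20) ?_ ?_ ?_ ?_
  · simp [h20]
  · simp
  · rintro s' t hb hF ⟨hz, hk, hle, ht⟩ hlt
    have hw0 := hb.pos
    have e0 := (hF.var 0 rfl).trans h0
    have e6 := (hF.var 6 rfl).trans h6
    simp [e0] at hlt
    apply WP.seq
    refine WP.store (by simp [e6]; omega) (by simp) ?_
    refine WP.assign (by simp; omega) ?_
    simp [e6]
    refine ⟨⟨fun u hu => ?_, fun i hi => ?_, by omega, by omega⟩, by omega⟩
    · rw [Function.update_apply]
      split
      · rfl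
      · exact hz u (by omega)
    · rw [Function.update_of_ne (by omega)]
      exact hk i hi
  · rintro s' t hb hF ⟨hz, hk, hle, ht⟩ hlt
    have e0 := (hF.var 0 rfl).trans h0
    simp [e0] at hlt
    exact ⟨fun u => hz u (by have := u.2; omega), hk, by simp; omega⟩

theorem lowerByEcc_spec {s : Config n} {u : Fin n} (hadj : Adj E s) (h0 : s.var 0 = n)
    (h6 : s.var 6 = n * n + n) (h23 : s.var 23 = u) (hw : n * n + 3 * n + 20 ≤ 2 ^ w) :
    WP A w cur lowerByEcc s fun s' t =>
      (∀ i < n * n + n, s'.arr 4 i = s.arr 4 i) ∧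
      (s'.var 22 = s.var 22 ∨ EccLE E u (s'.var 22)) ∧ s'.var 22 ≤ s.var 22 ∧
      (∀ l, EccLE E u l → s'.var 22 ≤ l) ∧ t ≤ 200 + 60 * (E.length + n) := by
  refine WP.bdd fun hb => ?_
  have hw0 := hb.pos
  have hu := u.2
  unfold lowerByEcc
  apply WP.seq
  refine WP.assign (by simp) ?_
  apply WP.seq
  refine WP.conseq (clear_row_spec (by simpa using h0) (by simpa using h6) (by simp) hw) ?_
  rintro s₁ t₁ hb₁ hF₁ ⟨hz₁, hk₁, ht₁⟩
  have f0 : s₁.var 0 = n := (hF₁.var 0 rfl).trans (by simpa using h0)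
  have f6 : s₁.var 6 = n * n + n := (hF₁.var 6 rfl).trans (by simpa using h6)
  have f23 : s₁.var 23 = u := (hF₁.var 23 rfl).trans (by simpa using h23)
  have f22 : s₁.var 22 = s.var 22 := (hF₁.var 22 rfl).trans (by simp)
  have hadj₁ : Adj E s₁ := hadj.congr ((hF₁.arr 1 rfl).trans rfl) ((hF₁.arr 2 rfl).trans rfl)
    ((hF₁.arr 3 rfl).trans rfl)
  apply WP.seq
  refine WP.assign (by simp) ?_
  apply WP.seq
  refine WP.conseq (search_spec (row := n * n + n) (x := u) (hadj₁.congr rfl rfl rfl)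
    (by simpa using f6) (by simpa using f23) (by simpa using hz₁ u) (by omega)) ?_
  rintro s₂ t₂ hb₂ hF₂ ⟨P, hm, ht₂⟩
  have g0 : s₂.var 0 = n := (hF₂.var 0 rfl).trans (by simpa using f0)
  have g6 : s₂.var 6 = n * n + n := (hF₂.var 6 rfl).trans (by simpa using f6)
  have g22 : s₂.var 22 = s.var 22 := (hF₂.var 22 rfl).trans (by simpa using f22)
  have h9 : s₂.var 9 = P.length := by simpa using hm.len
  have hbfs := hm.bfs
  simp only [Config.put_arr, hz₁] at hbfs
  have hsum := sum_degTo_of_nodup (E := E) (P := P) (by simpa using hbfs.nodup)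
  have hk₂ : ∀ i < n * n + n, s₂.arr 4 i = s.arr 4 i := fun i hi => by
    rw [hm.other i (fun v => by omega)]
    exact hk₁ i hi
  refine WP.ite (by simp) (fun hv => ?_) fun hv => ?_
  · simp [h9, g0] at hv
    obtain ⟨z, hz, hdn, hecc, hmin⟩ := hbfs.last (hbfs.length_eq_iff.mp hv)
    have hzn := z.2
    have hq : s₂.arr 5 (P.length - 1) = z := hm.queue _ _ (by simpa using hz)
    apply WP.seq
    refine WP.assign (by simp [h9, g6, hq]; omega) ?_
    refine WP.ite (by simp) (fun hl => ?_) fun hl => ?_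
    · simp [h9, g6, hq, g22] at hl
      refine WP.assign (by simp) ?_
      simp [h9, g6, hq]
      exact ⟨hk₂, Or.inr hecc, by omega, fun l hl => by have := hmin l hl; omega, by omega⟩
    · simp [h9, g6, hq, g22] at hl
      refine WP.skip ?_
      simp [g22]
      exact ⟨hk₂, fun l hl' => by have := hmin l hl'; omega, by omega⟩
  · simp [h9, g0] at hv
    refine WP.skip ⟨hk₂, Or.inl g22, g22.le, fun l hl => absurd (hbfs.length_eq_iff.mpr ?_) hv, ?_⟩
    · exact fun v => by
        obtain ⟨l', -, h⟩ := hl v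
        exact ⟨l', h⟩
    · simp; omega

/-- The members of the cover that belongs to a residue class. -/
def Center (dep : Fin n → ℕ) (r : Fin n) (k i : ℕ) (u : Fin n) : Prop := dep u % k = i ∨ u = r

instance (dep : Fin n → ℕ) (r : Fin n) (k i : ℕ) : DecidablePred (Center dep r k i) := fun u =>
  inferInstanceAs (Decidable (dep u % k = i ∨ u = r))

theorem card_centers_le (dep : Fin n → ℕ) (r : Fin n) (k i : ℕ) :
    (Finset.univ.filter (Center dep r k i)).card ≤
      (Finset.univ.filter fun u => dep u % k = i).card + 1 := by
  have : Finset.univ.filter (Center dep r k i) ⊆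
      insert r (Finset.univ.filter fun u => dep u % k = i) := fun u hu => by
    simp only [Finset.mem_filter, Finset.mem_univ, true_and, Center, Finset.mem_insert] at hu ⊢
    tauto
  exact (Finset.card_le_card this).trans (Finset.card_insert_le _ _)

theorem inClass_fits {s : Config n} (hb : Bdd w s) (h0 : s.var 0 = n) (hx : s.var 23 < n)
    (hw : n * n + 3 * n + 20 ≤ 2 ^ w) : inClass.Fits w s := by
  have hw0 := hb.pos
  have h1 := truth_le_one ((residue 23).val s = s.var 19)
  have h2 := truth_le_one (s.var 23 + 1 = s.var 16)
  have := residue_fits hb h0 hx hw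
  simp [inClass, this]; omega

theorem inClass_val {dep : Fin n → ℕ} {r u : Fin n} {s : Config n} {k i : ℕ} (h0 : s.var 0 = n)
    (h23 : s.var 23 = u) (ht : TreeMem dep s) (h16 : s.var 16 = r + 1) (h18 : s.var 18 = k)
    (h19 : s.var 19 = i) : inClass.val s ≠ 0 ↔ Center dep r k i u := by
  simp [inClass, residue_val h0 h23 ht, h18, h19, h16, h23, Center, Fin.ext_iff]
  tauto

/-- The value in variable `22` always bounds the eccentricity of some vertex, so it never falls
below the radius; at the end it is also at most the eccentricity of every member of the cover. -/
theorem lower_all_spec {dep : Fin n → ℕ} {r : Fin n} {s : Config n} {k i : ℕ} (hadj : Adj E s)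
    (h0 : s.var 0 = n) (h6 : s.var 6 = n * n + n) (h16 : s.var 16 = r + 1) (h18 : s.var 18 = k)
    (h19 : s.var 19 = i) (h23 : s.var 23 = 0) (htree : TreeMem dep s)
    (hecc : ∃ c, EccLE E c (s.var 22)) (hw : n * n + 3 * n + 20 ≤ 2 ^ w) :
    WP A w cur (.loop (.var 23 <ₑ .var 0) (
      .ite inClass lowerByEcc .skip ;; 23 ≔ .var 23 +ₑ .const 1)) s fun s' t =>
      TreeMem dep s' ∧ (∃ c, EccLE E c (s'.var 22)) ∧ s'.var 22 ≤ s.var 22 ∧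
      (∀ u l, Center dep r k i u → EccLE E u l → s'.var 22 ≤ l) ∧
      t ≤ 50 * n + 10 +
        (Finset.univ.filter (Center dep r k i)).card * (250 + 60 * (E.length + n)) := by
  refine WP.loop (fun s' t => TreeMem dep s' ∧ (∃ c, EccLE E c (s'.var 22)) ∧
    s'.var 22 ≤ s.var 22 ∧ s'.var 23 ≤ n ∧
    (∀ (u : Fin n) l, u < s'.var 23 → Center dep r k i u → EccLE E u l → s'.var 22 ≤ l) ∧
    t ≤ 50 * s'.var 23 + countBelow (Center dep r k i) (s'.var 23) * (250 + 60 * (E.length + n)))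
    (fun s' => n - s'.var 23) ?_ ?_ ?_ ?_
  · exact ⟨htree, hecc, le_rfl, by omega, by simp [h23], by simp⟩
  · simp
  · rintro s' t hb hF ⟨htree', hecc', hle, hn', hmin, ht⟩ hlt
    have hw0 := hb.pos
    have e0 := (hF.var 0 rfl).trans h0
    have e6 := (hF.var 6 rfl).trans h6
    have e16 := (hF.var 16 rfl).trans h16
    have e18 := (hF.var 18 rfl).trans h18
    have e19 := (hF.var 19 rfl).trans h19
    have hadj' := hadj.congr (hF.arr 1 rfl) (hF.arr 2 rfl) (hF.arr 3 rfl)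
    simp [e0] at hlt
    obtain ⟨v, hv⟩ : ∃ v : Fin n, s'.var 23 = v := ⟨⟨_, hlt⟩, rfl⟩
    have hcv := inClass_val e0 hv htree' e16 e18 e19
    have hcard := countBelow_succ (Center dep r k i) v
    rw [hv] at ht hmin
    apply WP.seq
    refine WP.ite (inClass_fits hb e0 hlt hw) (fun hc => ?_) fun hc => ?_
    · rw [hcv] at hc
      simp only [hc, truth_true] at hcard
      refine (lowerByEcc_spec hadj' e0 e6 hv hw).conseq ?_
      rintro s₁ t₁ hb₁ hF₁ ⟨hk₁, hor, hle₁, hmin₁, ht₁⟩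
      have f23 := (hF₁.var 23 rfl).trans hv
      refine WP.assign (by simp; omega) ?_
      simp only [Config.put_var, Expr.val_add, Expr.val_var, Expr.val_const, f23]
      simp only [Nat.reduceEqDiff, ↓reduceIte, hcard]
      refine ⟨⟨fun u => ?_, ?_, by omega, by omega, fun u l hu hcu hl => ?_, ?_⟩, by omega⟩
      · rw [← htree' u]
        exact hk₁ _ (by have := u.2; omega)
      · rcases hor with h | h
        · rw [h]; exact hecc'
        · exact ⟨v, h⟩
      · rcases Nat.lt_succ_iff_lt_or_eq.mp hu with h | h
        · exact hle₁.trans (hmin u l h hcu hl)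
        · obtain rfl : u = v := Fin.ext h
          exact hmin₁ l hl
      · rw [Nat.add_mul]
        simp [inClass, residue]
        omega
    · rw [hcv.not_right] at hc
      simp only [hc, truth_false, Nat.add_zero] at hcard
      refine WP.skip (WP.assign (by simp; omega) ?_)
      simp only [Config.put_var, Expr.val_add, Expr.val_var, Expr.val_const, hv]
      simp only [Nat.reduceEqDiff, ↓reduceIte, hcard]
      refine ⟨⟨htree', hecc', hle, by omega, fun u l hu hcu hl => ?_, ?_⟩, by omega⟩
      · rcases Nat.lt_succ_iff_lt_or_eq.mp hu with h | h
        · exact hmin u l h hcu hl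
        · obtain rfl : u = v := Fin.ext h
          exact absurd hcu hc
      · simp [inClass, residue]
        omega
  · rintro s' t hb hF ⟨htree', hecc', hle, hn', hmin, ht⟩ hlt
    have e0 := (hF.var 0 rfl).trans h0
    simp [e0] at hlt
    have h23' : s'.var 23 = n := by omega
    rw [h23', countBelow_self] at ht
    rw [h23'] at hmin
    refine ⟨htree', hecc', hle, fun u l => hmin u l u.2, ?_⟩
    simp
    omega

end IncRadius


namespace IncRadius

variable {n : ℕ} {E E' : List (Fin n × Fin n)} {A : BlackBox} {w : ℕ} {cur : List (Fin n × Fin n)}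

/-! ### A static approximation of the radius within the factor two. -/

/-- The time bound for one round of the first estimate of the radius. -/
def roundCost (n m R : ℕ) : ℕ := (7 * n / R + 1) * (600 + 400 * (m + n))

/-- The error of the estimate is less than the modulus `k`, which is halved until `2k` is at most
the estimate. Stopping at this point keeps `k` of the order of `R`, so a round needs only `O(n/R)`
searches. -/
theorem estimateRadius_spec {s : Config n} {r : Fin n} {R : ℕ} (hadj : Adj E s) (hn : 2 ≤ n)
    (h0 : s.var 0 = n) (h16 : s.var 16 = r + 1) (hr : ReachesAll E r) (hR : radius E = R)
    (hz : ∀ i, n * n ≤ i → s.arr 4 i = 0) (hw : n * n + 3 * n + 20 ≤ 2 ^ w) :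
    WP A w cur estimateRadius s fun s' t =>
      (∃ dep : Fin n → ℕ, (∀ u, Shortest E (dep u) r u) ∧ TreeMem dep s') ∧
      R ≤ s'.var 22 ∧ s'.var 22 ≤ 2 * R ∧ s'.var 22 + 1 ≤ n ∧
      t ≤ (Nat.log 2 n + 1) * roundCost n E.length R := by
  have hR1 : 1 ≤ R := by
    have := one_le_radius (E := E) hn
    rw [hR] at this
    exact_mod_cast this
  have hRn : R ≤ n - 1 := by
    obtain ⟨R', h1, h2⟩ := hr.exists_radius
    rw [hR] at h1
    have : R = R' := by exact_mod_cast h1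
    omega
  refine WP.bdd fun hb => ?_
  have hw0 := hb.pos
  have hrn := r.2
  unfold estimateRadius
  apply WP.seq
  refine WP.assign (by simp [h0]; omega) ?_
  apply WP.seq
  refine WP.assign (by simp; omega) ?_
  apply WP.seq
  refine WP.conseq (search_spec (E := E) (row := n * n) (x := r) (hadj.congr rfl rfl rfl)
    (by simp [h0]) (by simp [h16]) (by simpa using hz _ (by omega)) (by omega)) ?_
  rintro s₁ t₁ hb₁ hF₁ ⟨P, hm, ht₁⟩
  have f0 : s₁.var 0 = n := (hF₁.var 0 rfl).trans (by simpa using h0)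
  have f6 : s₁.var 6 = n * n := (hF₁.var 6 rfl).trans (by simp [h0])
  have f16 : s₁.var 16 = r + 1 := (hF₁.var 16 rfl).trans (by simpa using h16)
  have h9 : s₁.var 9 = P.length := by simpa using hm.len
  have hadj₁ : Adj E s₁ := hadj.congr ((hF₁.arr 1 rfl).trans rfl) ((hF₁.arr 2 rfl).trans rfl)
    ((hF₁.arr 3 rfl).trans rfl)
  have hbfs := hm.bfs
  have hz' : ∀ v : Fin n, s.arr 4 (n * n + v) = 0 := fun v => hz _ (by omega)
  simp only [Config.put_arr, hz'] at hbfs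
  have hsum := sum_degTo_of_nodup (E := E) (P := P) (by simpa using hbfs.nodup)
  obtain ⟨z, hzP, hdn, hecc, -⟩ := hbfs.last hr
  have hzn := z.2
  have hq : s₁.arr 5 (P.length - 1) = z := hm.queue _ _ (by simpa using hzP)
  have hdep : ∀ u, ∃ l, Shortest E l r u ∧ s₁.arr 4 (n * n + u) = l + 1 := fun u =>
    hbfs.shortest (hbfs.reach_iff.mpr (hr u))
  choose dep hshort htree using hdep
  apply WP.seq
  refine WP.assign (by simp [h9, f6, hq]; omega) ?_
  apply WP.seq
  refine WP.assign (by simp) ?_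
  apply WP.seq
  refine WP.assign (by simp [f0, f6]; omega) ?_
  set X := roundCost n E.length R with hX
  have hXle : 600 + 400 * (E.length + n) ≤ X := Nat.le_mul_of_pos_left _ (Nat.succ_pos _)
  -- The additive bound `var 22 + 1 ≤ R + var 18` is trivial at the beginning, where the modulus is
  -- `n`. Each round pays `X` from the logarithm of the modulus.
  refine WP.loop (fun s' t => TreeMem dep s' ∧ 1 ≤ s'.var 18 ∧ s'.var 18 ≤ n ∧
      (∃ c, EccLE E c (s'.var 22)) ∧ s'.var 22 + 1 ≤ n ∧ s'.var 22 + 1 ≤ R + s'.var 18 ∧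
      t + Nat.log 2 (s'.var 18) * X ≤ Nat.log 2 n * X)
    (fun s' => s'.var 18) ?_ ?_ ?_ ?_
  · refine ⟨htree, ?_, ?_, ⟨r, ?_⟩, ?_, ?_, ?_⟩ <;> simp [h9, f6, f0, hq]
    · omega
    · exact hecc
    · omega
    · omega
  · intro s' t hb' hF hI
    obtain ⟨-, -, hk, -⟩ := hI
    have h1 := truth_le_one (1 < s'.var 18)
    have h2 := truth_le_one (s'.var 22 < 2 * s'.var 18)
    have h3 : truth (1 < s'.var 18) * truth (s'.var 22 < 2 * s'.var 18) ≤ 1 := Nat.mul_le_mul h1 h2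
    simp
    omega
  · rintro s' t hb' hF ⟨htr, hk1, hkn, hec, hQn, hQ, ht⟩ hlt
    have e0 : s'.var 0 = n := (hF.var 0 rfl).trans (by simpa using f0)
    have e6 : s'.var 6 = n * n + n := by
      have : s'.var 6 = _ := hF.var 6 rfl
      simpa [f6, f0] using this
    have e16 : s'.var 16 = r + 1 := (hF.var 16 rfl).trans (by simpa using f16)
    have hadj' : Adj E s' := hadj₁.congr ((hF.arr 1 rfl).trans rfl) ((hF.arr 2 rfl).trans rfl)
      ((hF.arr 3 rfl).trans rfl)
    simp at hlt
    obtain ⟨hk2, hlt⟩ := hlt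
    set k := s'.var 18 with hk
    have hk0 : 0 < k / 2 := Nat.div_pos hk2 (by omega)
    apply WP.seq
    refine WP.assign (by simp; omega) ?_
    apply WP.seq
    refine WP.conseq (select_spec (dep := dep) (k := k / 2) (by simpa using e0) (by simp [hk]) hk0
      (by omega) htr hw) ?_
    rintro s₂ t₂ hb₂ hF₂ ⟨i, hik, h19, hcard, ht₂⟩
    have g0 : s₂.var 0 = n := (hF₂.var 0 rfl).trans (by simpa using e0)
    have g6 : s₂.var 6 = n * n + n := (hF₂.var 6 rfl).trans (by simpa using e6)
    have g16 : s₂.var 16 = r + 1 := (hF₂.var 16 rfl).trans (by simpa using e16)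
    have g18 : s₂.var 18 = k / 2 := (hF₂.var 18 rfl).trans (by simp [hk])
    have g22 : s₂.var 22 = s'.var 22 := (hF₂.var 22 rfl).trans (by simp)
    have hadj₂ : Adj E s₂ := hadj'.congr ((hF₂.arr 1 rfl).trans rfl) ((hF₂.arr 2 rfl).trans rfl)
      ((hF₂.arr 3 rfl).trans rfl)
    have htr₂ : TreeMem dep s₂ := fun u => by
      have : s₂.arr 4 = _ := hF₂.arr 4 rfl
      rw [this]; exact htr u
    apply WP.seq
    refine WP.assign (by simp) ?_
    refine WP.conseq (lower_all_spec (E := E) (dep := dep) (r := r) (k := k / 2) (i := i)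
      (hadj₂.congr rfl rfl rfl) (by simpa using g0) (by simpa using g6) (by simpa using g16)
      (by simpa using g18) (by simpa using h19) (by simp) htr₂ (by simpa [g22] using hec) hw) ?_
    rintro s₃ t₃ hb₃ hF₃ ⟨htr₃, hec₃, hle₃, hmin₃, ht₃⟩
    have k18 : s₃.var 18 = k / 2 := (hF₃.var 18 rfl).trans (by simpa using g18)
    have hle₃' : s₃.var 22 ≤ s'.var 22 := by simpa [g22] using hle₃
    -- The loop condition gives `R ≤ var 22 < 2k`, and `k ≤ 3 (k/2)` for `k ≥ 2` in spite of
    -- rounding.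
    have hRk : R < 6 * (k / 2) := by
      obtain ⟨c, hc⟩ := hec
      have := hc.radius_le
      rw [hR] at this
      have : R ≤ s'.var 22 := by exact_mod_cast this
      omega
    -- The class contributes at most `6n/R` members, and the root one more; since `R ≤ n`, together
    -- this is at most `7n/R`.
    have hcen : (Finset.univ.filter (Center dep r (k / 2) i)).card ≤ 7 * n / R := by
      rw [Nat.le_div_iff_mul_le (by omega)]
      have h1 := card_centers_le dep r (k / 2) i
      set y := (Finset.univ.filter fun u => dep u % (k / 2) = i).card
      calc (Finset.univ.filter (Center dep r (k / 2) i)).card * R ≤ (y + 1) * R :=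
            Nat.mul_le_mul_right _ h1
        _ = y * R + R := by ring
        _ ≤ y * (6 * (k / 2)) + n := by
            have := Nat.mul_le_mul_left y hRk.le
            omega
        _ = 6 * ((k / 2) * y) + n := by ring
        _ ≤ 7 * n := by omega
    -- No member of the cover has eccentricity below the new value, so the covering lemma applies
    -- with `τ` one below it.
    have hlow : s₃.var 22 + 1 ≤ R + k / 2 := by
      by_contra hcon
      have hcov := (covers_of_levels hshort hik).le_radius (τ := s₃.var 22 - 1) (R := R) (by omega)
        (fun u hu hE => by have := hmin₃ u _ hu hE; omega) hR.le
      omega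
    have hlog : Nat.log 2 k = Nat.log 2 (k / 2) + 1 := by
      rw [Nat.log_div_base]
      have : 1 ≤ Nat.log 2 k := Nat.log_pos (by omega) (by omega)
      omega
    have hcost : 200 * n + 150 + (7 * n / R) * (250 + 60 * (E.length + n)) + 40 ≤ X := by
      rw [hX, roundCost, Nat.add_mul]
      have : (7 * n / R) * (250 + 60 * (E.length + n)) ≤
        7 * n / R * (600 + 400 * (E.length + n)) := Nat.mul_le_mul_left _ (by omega)
      omega
    have hcen' := Nat.mul_le_mul_right (250 + 60 * (E.length + n)) hcen
    refine ⟨⟨htr₃, by omega, by omega, hec₃, by omega, by rw [k18]; exact hlow, ?_⟩, by omega⟩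
    rw [k18]
    rw [hlog, Nat.add_mul] at ht
    generalize Nat.log 2 (k / 2) = lg at ht ⊢
    simp
    omega
  · rintro s' t hb' hF ⟨htr, hk1, hkn, ⟨c, hc⟩, hQn, hQ, ht⟩ hlt
    simp at hlt
    have hRQ : R ≤ s'.var 22 := by
      have := hc.radius_le
      rw [hR] at this
      exact_mod_cast this
    -- Either the modulus is `1` and the estimate is at most `R`, or `2k` is at most the estimate;
    -- in this case the error, which is less than `k`, is less than half of the estimate.
    refine ⟨⟨dep, hshort, htr⟩, hRQ, by omega, hQn, ?_⟩
    have ht' : t ≤ Nat.log 2 n * X := (Nat.le_add_right _ _).trans ht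
    have ht₁' : t₁ ≤ 40 + 40 * (E.length + n) := by omega
    rw [Nat.add_mul, Nat.one_mul]
    simp
    omega

end IncRadius


namespace IncRadius

variable {n : ℕ} {E E' : List (Fin n × Fin n)} {A : BlackBox} {w : ℕ} {cur : List (Fin n × Fin n)}

/-! ### Reading the reports of the black box -/

/-- Whether the estimate for the vertex `v` in the instance `j` is at most `τ` after the reports have
been read, if `p` says this at the beginning. -/
def pend (τ j v : ℕ) : List (ℕ × ℕ × ℕ) → Prop → Prop
  | [], p => p
  | m :: l, p => pend τ j v l (if m.1 = j ∧ m.2.1 = v then m.2.2 ≤ τ else p)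

theorem pend_append (τ j v : ℕ) (l l' : List (ℕ × ℕ × ℕ)) (p : Prop) :
    pend τ j v (l ++ l') p = pend τ j v l' (pend τ j v l p) := by
  induction l generalizing p with
  | nil => rfl
  | cons m l ih => exact ih _

theorem pend_of_ne {τ j v : ℕ} {l : List (ℕ × ℕ × ℕ)} (h : ∀ m ∈ l, m.1 ≠ j) (p : Prop) :
    pend τ j v l p = p := by
  induction l with
  | nil => rfl
  | cons m l ih =>
    simp only [pend, h m (by simp), false_and, if_false]
    exact ih fun m' hm' => h m' (by simp [hm'])

/-- The number of flags that are set for an instance. -/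
def flagCount (n : ℕ) (f : ℕ → ℕ) (j : ℕ) : ℕ :=
  (Finset.univ.filter fun v : Fin n => f (j * n + v) ≠ 0).card

/-- The number of instances for which all flags are set. -/
def fullCount (n : ℕ) (f : ℕ → ℕ) (base len : ℕ) : ℕ :=
  ((Finset.Ico base len).filter fun j => flagCount n f j = n).card

theorem flagCount_update (f : ℕ → ℕ) (j : ℕ) (v : Fin n) {c : ℕ} (hc : c ≠ 0)
    (h0 : f (j * n + v) = 0) :
    flagCount n (Function.update f (j * n + v) c) j = flagCount n f j + 1 := by
  unfold flagCount
  rw [← Finset.card_insert_of_notMem (a := v) (by simp [h0])]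
  refine congrArg Finset.card (Finset.ext fun u => ?_)
  by_cases hu : u = v
  · subst hu; simp [hc]
  · have : j * n + (u : ℕ) ≠ j * n + v := fun h => hu (Fin.ext (by omega))
    simp [Function.update_of_ne this, hu]

theorem flagCount_update_of_ne (f : ℕ → ℕ) {j j' : ℕ} (hj : j' ≠ j) (v : Fin n) (c : ℕ) :
    flagCount n (Function.update f (j * n + v) c) j' = flagCount n f j' := by
  unfold flagCount
  refine congrArg Finset.card (Finset.ext fun u => ?_)
  have : j' * n + (u : ℕ) ≠ j * n + v := fun h => hj (row_inj u.2 v.2 h).1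
  simp [Function.update_of_ne this]

theorem flagCount_le (f : ℕ → ℕ) (j : ℕ) : flagCount n f j ≤ n :=
  (Finset.card_filter_le _ _).trans (by simp)

theorem flagCount_eq_iff (f : ℕ → ℕ) (j : ℕ) :
    flagCount n f j = n ↔ ∀ v : Fin n, f (j * n + v) ≠ 0 := by
  unfold flagCount
  conv_lhs => rhs; rw [← Fintype.card_fin n]
  rw [Finset.card_eq_iff_eq_univ]
  simp [Finset.ext_iff]

/-- Before the update the instance `j` is not full, because the flag of `v` is missing. Thus it is
counted afterwards exactly if this was its last missing flag. -/
theorem fullCount_update {f : ℕ → ℕ} {j base len : ℕ} (hj : base ≤ j) (hj' : j < len) (v : Fin n)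
    {c : ℕ} (hc : c ≠ 0) (h0 : f (j * n + v) = 0) :
    fullCount n (Function.update f (j * n + v) c) base len =
      fullCount n f base len + truth (flagCount n f j + 1 = n) := by
  have hlt : flagCount n f j ≠ n := fun h => (flagCount_eq_iff f j).mp h v h0
  unfold fullCount truth
  split
  · rename_i h
    rw [← Finset.card_insert_of_notMem (a := j) (by simp [hlt])]
    refine congrArg Finset.card (Finset.ext fun i => ?_)
    by_cases hi : i = j
    · subst hi; simp [flagCount_update f i v hc h0, h, hj, hj']
    · simp [flagCount_update_of_ne f hi v c, hi]
  · rename_i h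
    refine (congrArg Finset.card (Finset.ext fun i => ?_)).trans (Nat.add_zero _).symm
    by_cases hi : i = j
    · subst hi; simp [flagCount_update f i v hc h0, h, hlt]
    · simp [flagCount_update_of_ne f hi v c]

/-- The counters for the flags of the instances from `base` to `len` are right, and everything is
empty for later instances. -/
structure Counted (base len : ℕ) (s : Config n) : Prop where
  count : ∀ j, base ≤ j → j < len → s.arr 9 j = flagCount n (s.arr 8) j
  full : s.var 27 = fullCount n (s.arr 8) base len
  count_zero : ∀ j, len ≤ j → s.arr 9 j = 0
  flag_zero : ∀ j (v : Fin n), len ≤ j → s.arr 8 (j * n + v) = 0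

/-- Process the report in the variables `28`, `29`, `30`. -/
def process : Cmd :=
  .ite (.var 28 <ₑ .var 25) .skip (
    31 ≔ .var 28 *ₑ .var 0 +ₑ .var 29 ;;
    .ite (.var 24 <ₑ .var 30)
      (.ite (.cell 8 (.var 31))
        (.store 8 (.var 31) (.const 0) ;;
          .ite (.cell 9 (.var 28) =ₑ .var 0) (27 ≔ .var 27 -ₑ .const 1) .skip ;;
          .store 9 (.var 28) (.cell 9 (.var 28) -ₑ .const 1))
        .skip)
      (.ite (.cell 8 (.var 31)) .skip
        (.store 8 (.var 31) (.const 1) ;;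
          .store 9 (.var 28) (.cell 9 (.var 28) +ₑ .const 1) ;;
          .ite (.cell 9 (.var 28) =ₑ .var 0) (27 ≔ .var 27 +ₑ .const 1) .skip)))

/-- Read and process all reports. -/
def drain : Cmd :=
  .receive 28 29 30 ;;
  .loop (.var 28) (
    28 ≔ .var 28 -ₑ .const 1 ;;
    process ;;
    .receive 28 29 30)

theorem process_spec {s : Config n} {base len j y τ : ℕ} {v : Fin n} (h0 : s.var 0 = n)
    (h25 : s.var 25 = base) (h24 : s.var 24 = τ) (h28 : s.var 28 = j) (h29 : s.var 29 = v)
    (h30 : s.var 30 = y) (hj : j < len) (hc : Counted base len s) (hw : len * n + n + 20 ≤ 2 ^ w)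
    (hlen : len ≤ n * n) (hw' : n * n + 20 ≤ 2 ^ w) :
    WP A w cur process s fun s' t => Counted base len s' ∧
      (∀ j', base ≤ j' → ∀ v' : Fin n, (s'.arr 8 (j' * n + v') ≠ 0 ↔
        if j = j' ∧ (v : ℕ) = v' then y ≤ τ else s.arr 8 (j' * n + v') ≠ 0)) ∧ t ≤ 60 := by
  refine WP.bdd fun hb => ?_
  have hw0 := hb.pos
  have hv := v.2
  have hjn : j * n + n ≤ len * n := by
    have := Nat.mul_le_mul_right n hj
    rwa [Nat.succ_mul] at this
  unfold process
  refine WP.ite (by simp) (fun hlt => ?_) fun hlt => ?_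
  · simp [h28, h25] at hlt
    -- Instances of earlier phases keep running and reporting; their reports are only discarded.
    refine WP.skip ⟨hc, fun j' hj' v' => ?_, by simp⟩
    rw [if_neg (by omega)]
  simp [h28, h25] at hlt
  have hcj := hc.count j hlt hj
  have hcn := flagCount_le (n := n) (s.arr 8) j
  have hfull : s.var 27 ≤ n * n := by
    rw [hc.full]
    refine (Finset.card_filter_le _ _).trans ?_
    simp; omega
  have hother : ∀ (c : ℕ) (j' : ℕ) (v' : Fin n), ¬ (j = j' ∧ (v : ℕ) = v') →
      Function.update (s.arr 8) (j * n + v) c (j' * n + v') = s.arr 8 (j' * n + v') :=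
    fun c j' v' h => Function.update_of_ne (fun h' => h
      ⟨((row_inj v'.2 v.2 h').1).symm, ((row_inj v'.2 v.2 h').2).symm⟩) _ _
  have hzero : ∀ (c : ℕ) (j' : ℕ) (v' : Fin n), len ≤ j' →
      Function.update (s.arr 8) (j * n + v) c (j' * n + v') = 0 := fun c j' v' hj' => by
    rw [hother c j' v' (by omega)]
    exact hc.flag_zero j' v' hj'
  apply WP.seq
  refine WP.assign (by simp [h28, h0, h29]; omega) ?_
  refine WP.ite (by simp) (fun hy => ?_) fun hy => ?_
  · simp [h24, h30] at hy
    refine WP.ite (by simp) (fun hf => ?_) fun hf => ?_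
    · simp [h28, h0, h29] at hf
      -- Clearing a flag is read backwards: setting it again in the cleared array restores the
      -- original one, so the lemmas for setting a flag suffice.
      have hcount := flagCount_update (Function.update (s.arr 8) (j * n + v) 0) j v hf (by simp)
      have hfc := fullCount_update (f := Function.update (s.arr 8) (j * n + v) 0) hlt hj v hf
        (by simp)
      simp only [Function.update_idem, Function.update_eq_self] at hcount hfc
      rw [← hcount] at hfc
      have hres : ∀ j', base ≤ j' → ∀ v' : Fin n,
          (Function.update (s.arr 8) (j * n + v) 0 (j' * n + v') ≠ 0 ↔
            if j = j' ∧ (v : ℕ) = v' then y ≤ τ else s.arr 8 (j' * n + v') ≠ 0) := by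
        intro j' _ v'
        by_cases h : j = j' ∧ (v : ℕ) = v'
        · rw [if_pos h, ← h.1, ← h.2]; simp; omega
        · rw [if_neg h, hother 0 j' v' h]
      have hcnt : ∀ j', base ≤ j' → j' < len →
          Function.update (s.arr 9) j (s.arr 9 j - 1) j' =
            flagCount n (Function.update (s.arr 8) (j * n + v) 0) j' := by
        intro j' h1 h2
        by_cases h : j' = j
        · subst h; simp; omega
        · rw [Function.update_of_ne h, flagCount_update_of_ne _ h, hc.count j' h1 h2]
      have hcz : ∀ j', len ≤ j' → Function.update (s.arr 9) j (s.arr 9 j - 1) j' = 0 := by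
        intro j' h1
        rw [Function.update_of_ne (by omega), hc.count_zero j' h1]
      apply WP.seq
      refine WP.store (by simp) (by simp) ?_
      apply WP.seq
      refine WP.ite (by simp) (fun he => ?_) fun he => ?_
      · simp [h28, h0] at he
        rw [hcj] at he
        simp only [he, truth_true] at hfc
        refine WP.assign (by simp; omega) (WP.store (by simp) (by simp; omega) ?_)
        simp [h28, h0, h29]
        exact ⟨⟨by simpa using hcnt, by simp [hc.full, hfc], by simpa using hcz,
          by simpa using hzero 0⟩, by simpa using hres⟩
      · simp [h28, h0] at he
        rw [hcj] at he
        simp only [he, truth_false, Nat.add_zero] at hfc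
        refine WP.skip (WP.store (by simp) (by simp; omega) ?_)
        simp [h28, h0, h29]
        exact ⟨⟨by simpa using hcnt, by simp [hc.full, hfc], by simpa using hcz,
          by simpa using hzero 0⟩, by simpa using hres⟩
    · simp [h28, h0, h29] at hf
      refine WP.skip ⟨⟨hc.count, hc.full, hc.count_zero, hc.flag_zero⟩, fun j' hj' v' => ?_,
        by simp⟩
      by_cases h : j = j' ∧ (v : ℕ) = v'
      · rw [if_pos h, ← h.1, ← h.2]; simp [hf, hy]
      · rw [if_neg h]; rfl
  · simp [h24, h30] at hy
    refine WP.ite (by simp) (fun hf => ?_) fun hf => ?_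
    · simp [h28, h0, h29] at hf
      refine WP.skip ⟨⟨hc.count, hc.full, hc.count_zero, hc.flag_zero⟩, fun j' hj' v' => ?_,
        by simp⟩
      by_cases h : j = j' ∧ (v : ℕ) = v'
      · rw [if_pos h, ← h.1, ← h.2]; simp [hf, hy]
      · rw [if_neg h]; rfl
    · simp [h28, h0, h29] at hf
      have hcount := flagCount_update (s.arr 8) j v (c := 1) (by simp) hf
      have hcn' := flagCount_le (n := n) (Function.update (s.arr 8) (j * n + v) 1) j
      have hfc := fullCount_update (f := s.arr 8) hlt hj v (c := 1) (by simp) hf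
      have hres : ∀ j', base ≤ j' → ∀ v' : Fin n,
          (Function.update (s.arr 8) (j * n + v) 1 (j' * n + v') ≠ 0 ↔
            if j = j' ∧ (v : ℕ) = v' then y ≤ τ else s.arr 8 (j' * n + v') ≠ 0) := by
        intro j' _ v'
        by_cases h : j = j' ∧ (v : ℕ) = v'
        · rw [if_pos h, ← h.1, ← h.2]; simp; omega
        · rw [if_neg h, hother 1 j' v' h]
      have hcnt : ∀ j', base ≤ j' → j' < len →
          Function.update (s.arr 9) j (s.arr 9 j + 1) j' =
            flagCount n (Function.update (s.arr 8) (j * n + v) 1) j' := by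
        intro j' h1 h2
        by_cases h : j' = j
        · subst h; simp; omega
        · rw [Function.update_of_ne h, flagCount_update_of_ne _ h, hc.count j' h1 h2]
      have hcz : ∀ j', len ≤ j' → Function.update (s.arr 9) j (s.arr 9 j + 1) j' = 0 := by
        intro j' h1
        rw [Function.update_of_ne (by omega), hc.count_zero j' h1]
      apply WP.seq
      refine WP.store (by simp) (by simp; omega) ?_
      apply WP.seq
      refine WP.store (by simp) (by simp [h28]; omega) ?_
      refine WP.ite (by simp) (fun he => ?_) fun he => ?_
      · simp [h28, h0] at he
        rw [hcj] at he
        simp only [he, truth_true] at hfc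
        refine WP.assign (by simp; omega) ?_
        simp [h28, h0, h29]
        exact ⟨⟨by simpa using hcnt, by simp [hc.full, hfc], by simpa using hcz,
          by simpa using hzero 1⟩, by simpa using hres⟩
      · simp [h28, h0] at he
        rw [hcj] at he
        simp only [he, truth_false, Nat.add_zero] at hfc
        refine WP.skip ?_
        simp [h28, h0, h29]
        exact ⟨⟨by simpa using hcnt, by simp [hc.full, hfc], by simpa using hcz,
          by simpa using hzero 1⟩, by simpa using hres⟩

/-- The reports that have not been processed, if the oldest of them is in the variables. -/
def Unread (s : Config n) (l : List (ℕ × ℕ × ℕ)) : Prop :=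
  (l = [] ∧ s.var 28 = 0 ∧ s.queue = []) ∨
    ∃ m, l = m :: s.queue ∧ s.var 28 = m.1 + 1 ∧ s.var 29 = m.2.1 ∧ s.var 30 = m.2.2

theorem receive_spec {s : Config n}
    (hq : ∀ m ∈ s.queue, m.1 + 1 < 2 ^ w ∧ m.2.1 < 2 ^ w ∧ m.2.2 < 2 ^ w) :
    WP A w cur (.receive 28 29 30) s fun s' t => Unread s' s.queue ∧ s'.var 27 = s.var 27 ∧
      s'.arr = s.arr ∧ t = 1 := by
  rcases h : s.queue with _ | ⟨⟨j, u, y⟩, rest⟩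
  · refine WP.receive_nil h ⟨Or.inl ⟨rfl, by simp, by simpa using h⟩, by simp, by simp, rfl⟩
  · rw [h] at hq
    obtain ⟨h1, h2, h3⟩ := hq (j, u, y) (by simp)
    refine WP.receive_cons h h1 h2 h3 ⟨Or.inr ⟨(j, u, y), by simp, by simp, by simp, by simp⟩,
      by simp, by simp, rfl⟩

/-- The reports in the queue belong to the first `len` instances, and they are small. -/
def QueueOK (len : ℕ) (s : Config n) : Prop :=
  ∀ m ∈ s.queue, m.1 < len ∧ m.2.1 < n ∧ m.2.2 ≤ n

/-- The quantity preserved by the loop is the final value of each flag, that is, the effect of the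
unread reports on the current flags. -/
theorem drain_spec {s : Config n} {base len τ : ℕ} (h0 : s.var 0 = n) (h25 : s.var 25 = base)
    (h24 : s.var 24 = τ) (hc : Counted base len s) (hq : QueueOK len s)
    (hw : len * n + n + 20 ≤ 2 ^ w) (hlen : len ≤ n * n) (hw' : n * n + n + 20 ≤ 2 ^ w) :
    WP A w cur drain s fun s' t => Counted base len s' ∧ s'.queue = [] ∧
      (∀ j, base ≤ j → ∀ v : Fin n, (s'.arr 8 (j * n + v) ≠ 0 ↔
        pend τ j v s.queue (s.arr 8 (j * n + v) ≠ 0))) ∧ t ≤ 80 * s.queue.length + 10 := by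
  have hqw : ∀ (s' : Config n), QueueOK len s' →
      ∀ m ∈ s'.queue, m.1 + 1 < 2 ^ w ∧ m.2.1 < 2 ^ w ∧ m.2.2 < 2 ^ w := by
    intro s' hs' m hm
    obtain ⟨h1, h2, h3⟩ := hs' m hm
    omega
  unfold drain
  apply WP.seq
  refine WP.conseq (receive_spec (hqw s hq)) ?_
  rintro s₁ t₁ hb₁ hF₁ ⟨hU, e27, earr, rfl⟩
  have f0 := (hF₁.var 0 rfl).trans h0
  have f25 := (hF₁.var 25 rfl).trans h25
  have f24 := (hF₁.var 24 rfl).trans h24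
  -- One report is always read ahead into the variables, so the measure counts it in addition to the
  -- queue.
  refine WP.loop (fun s' t => ∃ l, Unread s' l ∧ (∀ m ∈ l, m.1 < len ∧ m.2.1 < n ∧ m.2.2 ≤ n) ∧
      Counted base len s' ∧ (∀ j, base ≤ j → ∀ v : Fin n,
        (pend τ j v l (s'.arr 8 (j * n + v) ≠ 0) ↔
          pend τ j v s.queue (s.arr 8 (j * n + v) ≠ 0))) ∧
      t + 80 * l.length ≤ 80 * s.queue.length)
    (fun s' => s'.queue.length + truth (s'.var 28 ≠ 0)) ?_ ?_ ?_ ?_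
  · refine ⟨s.queue, hU, hq, ⟨?_, ?_, ?_, ?_⟩, ?_, by omega⟩
    · rw [earr]; exact hc.count
    · rw [earr, e27]; exact hc.full
    · rw [earr]; exact hc.count_zero
    · rw [earr]; exact hc.flag_zero
    · rw [earr]; intros; rfl
  · simp
  · rintro s' t hb hF ⟨l, hU', hl, hc', hp, ht⟩ hne
    simp at hne
    have g0 := (hF.var 0 rfl).trans f0
    have g25 := (hF.var 25 rfl).trans f25
    have g24 := (hF.var 24 rfl).trans f24
    have hw0 := hb.pos
    rcases hU' with ⟨-, h, -⟩ | ⟨⟨j, u, y⟩, rfl, h28, h29, h30⟩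
    · omega
    obtain ⟨hj, hu, hy⟩ := hl (j, u, y) (by simp)
    apply WP.seq
    refine WP.assign (by simp; omega) ?_
    apply WP.seq
    refine WP.conseq (process_spec (base := base) (len := len) (j := j) (v := ⟨u, hu⟩) (y := y)
      (τ := τ) (by simpa using g0) (by simpa using g25) (by simpa using g24) (by simp [h28])
      (by simpa using h29) (by simpa using h30) hj
      ⟨hc'.count, by simpa using hc'.full, hc'.count_zero, hc'.flag_zero⟩ hw hlen (by omega)) ?_
    rintro s₂ t₂ hb₂ hF₂ ⟨hc₂, hfl₂, ht₂⟩
    have q₂ : s₂.queue = s'.queue := (hF₂.queue rfl rfl).trans (by simp)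
    have hq₂ : QueueOK len s₂ := fun m hm => hl m (by rw [q₂] at hm; simp [hm])
    refine WP.conseq (receive_spec (hqw s₂ hq₂)) ?_
    rintro s₃ t₃ hb₃ hF₃ ⟨hU₃, e27', earr', rfl⟩
    refine ⟨⟨s'.queue, by rwa [← q₂], fun m hm => hl m (by simp [hm]), ⟨?_, ?_, ?_, ?_⟩, ?_, ?_⟩,
      ?_⟩
    · rw [earr']; exact hc₂.count
    · rw [earr', e27']; exact hc₂.full
    · rw [earr']; exact hc₂.count_zero
    · rw [earr']; exact hc₂.flag_zero
    · intro i hi v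
      rw [← hp i hi v, earr']
      have := hfl₂ i hi v
      simp only [Config.put_arr] at this
      rw [pend, propext this]
    · simp at ht ⊢; omega
    · have h1 : truth (s'.var 28 ≠ 0) = 1 := by simp [hne]
      rw [h1]
      rcases hU₃ with ⟨_, h3, h4⟩ | ⟨m, h3, h4, -, -⟩
      · simp [h3, h4]
      · have h5 : truth (s₃.var 28 ≠ 0) = 1 := by simp [h4]
        rw [h5, ← q₂, h3]
        simp
  · rintro s' t hb hF ⟨l, hU', hl, hc', hp, ht⟩ h0'
    simp at h0'
    rcases hU' with ⟨rfl, h, hq'⟩ | ⟨⟨j, u, y⟩, rfl, h28, h29, h30⟩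
    · refine ⟨hc', hq', fun j hj v => hp j hj v, ?_⟩
      simp
      simp at ht
      omega
    · omega

end IncRadius


namespace IncRadius

variable {n : ℕ} {E E' : List (Fin n × Fin n)} {A : BlackBox} {w : ℕ} {cur : List (Fin n × Fin n)}

/-! ### The history of an instance of the black box -/

namespace Instance

theorem before_extend (I : Instance n) (e : Fin n × Fin n) {i : ℕ} (hi : i ≤ I.inserted.length) :
    (I.extend e).before i = I.before i := by
  simp [extend, before, List.take_append_of_le_length hi]

theorem before_length (I : Instance n) : I.before I.inserted.length = I := by
  simp [before]

theorem edges_extend (I : Instance n) (e : Fin n × Fin n) : (I.extend e).edges = I.edges ++ [e] := by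
  simp [extend, edges]

end Instance

namespace BlackBox

theorem reports_extend (A : BlackBox) (I : Instance n) (e : Fin n × Fin n) :
    A.reports (I.extend e) = A.reports I ++ A.output (I.extend e) := by
  have h : (I.extend e).inserted.length = I.inserted.length + 1 := by simp [Instance.extend]
  have hb := (I.extend e).before_length
  unfold reports
  rw [h] at hb ⊢
  rw [List.range_succ, List.flatMap_append]
  simp only [List.flatMap_singleton, hb]
  congr 1
  refine List.flatMap_congr fun i hi => ?_
  rw [I.before_extend e (by simpa [Nat.lt_succ_iff] using hi)]

theorem totalCost_extend (A : BlackBox) (I : Instance n) (e : Fin n × Fin n) :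
    A.totalCost (I.extend e) = A.totalCost I + A.cost (I.extend e) := by
  have h : (I.extend e).inserted.length = I.inserted.length + 1 := by simp [Instance.extend]
  have hb := (I.extend e).before_length
  unfold totalCost
  rw [h] at hb ⊢
  rw [Finset.sum_range_succ, hb]
  congr 1
  refine Finset.sum_congr rfl fun i hi => ?_
  rw [I.before_extend e (by simpa [Nat.lt_succ_iff] using hi)]

theorem reports_fresh (A : BlackBox) {I : Instance n} (h : I.inserted = []) :
    A.reports I = A.output I := by
  have hb := I.before_length
  rw [h] at hb
  simp only [List.length_nil] at hb
  simp [reports, h, List.range_succ, hb]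

theorem totalCost_fresh (A : BlackBox) {I : Instance n} (h : I.inserted = []) :
    A.totalCost I = A.cost I := by
  have hb := I.before_length
  rw [h] at hb
  simp only [List.length_nil] at hb
  simp [totalCost, h, hb]

end BlackBox

/-! ### Reports and thresholds. -/

/-- The last value that is reported for a vertex. -/
noncomputable def lastValue (L : List (Fin n × ℝ≥0∞)) (v : Fin n) : ℝ≥0∞ :=
  ((L.reverse.find? fun p => p.1 = v).map Prod.snd).getD ⊤

theorem lastValue_concat (L : List (Fin n × ℝ≥0∞)) (p : Fin n × ℝ≥0∞) (v : Fin n) :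
    lastValue (L ++ [p]) v = if p.1 = v then p.2 else lastValue L v := by
  unfold lastValue
  rw [List.reverse_append, List.reverse_singleton, List.singleton_append, List.find?_cons]
  split <;> simp_all

/-- Rounding up does not affect comparison with an integer, and truncation at `k + 1` does not
affect comparison with a number below `k + 1`. So the words read by the program decide the threshold
exactly. -/
theorem readEstimate_le_iff {τ k : ℕ} (h : τ ≤ k) (x : ℝ≥0∞) : readEstimate k x ≤ τ ↔ x ≤ τ := by
  unfold readEstimate
  have hne : min x (k + 1 : ℝ≥0∞) ≠ ⊤ := ne_top_of_le_ne_top (by finiteness) (min_le_right _ _)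
  rw [Nat.ceil_le, ← ENNReal.coe_le_coe, ENNReal.coe_toNNReal hne, ENNReal.coe_natCast, min_le_iff,
    or_iff_left]
  have : ((τ : ℕ) : ℝ≥0∞) < (k : ℝ≥0∞) + 1 := by exact_mod_cast Nat.lt_succ_of_le h
  exact this.not_ge

theorem readEstimate_le (k : ℕ) (x : ℝ≥0∞) : readEstimate k x ≤ k + 1 := by
  unfold readEstimate
  rw [Nat.ceil_le]
  have : min x (k + 1 : ℝ≥0∞) ≤ ((k + 1 : ℕ) : ℝ≥0∞) := (min_le_right _ _).trans (by simp)
  have h := ENNReal.toNNReal_mono (by finiteness) this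
  rwa [ENNReal.toNNReal_natCast] at h

/-- Reading the reports of an instance. -/
theorem pend_reports {τ k : ℕ} (h : τ ≤ k) (j : ℕ) (v : Fin n) (L₀ L : List (Fin n × ℝ≥0∞)) :
    pend τ j v (L.map fun p => (j, (p.1 : ℕ), readEstimate k p.2)) (lastValue L₀ v ≤ τ) ↔
      lastValue (L₀ ++ L) v ≤ τ := by
  induction L using List.reverseRecOn with
  | nil => simp [pend]
  | append_singleton L p ih =>
    rw [List.map_append, pend_append, ← List.append_assoc, lastValue_concat]
    simp only [List.map_cons, List.map_nil, pend, true_and, Fin.val_inj]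
    split
    · exact readEstimate_le_iff h _
    · exact ih

open Config in
theorem pend_messages_fresh {τ : ℕ} {I : Instance n} (h : τ ≤ I.depth) (hI : I.inserted = [])
    (j : ℕ) (v : Fin n) : pend τ j v (messages A j I) False ↔ A.estimate I v ≤ τ := by
  have h1 := pend_reports h j v [] (A.output I)
  have h2 : (lastValue ([] : List (Fin n × ℝ≥0∞)) v ≤ τ) ↔ False := by simp [lastValue]
  rw [List.nil_append] at h1
  rw [← propext h2]
  unfold BlackBox.estimate
  rw [A.reports_fresh hI]
  exact h1

open Config in
theorem pend_messages_extend {τ : ℕ} {I : Instance n} (h : τ ≤ I.depth) (e : Fin n × Fin n)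
    (j : ℕ) (v : Fin n) : pend τ j v (messages A j (I.extend e)) (A.estimate I v ≤ τ) ↔
      A.estimate (I.extend e) v ≤ τ := by
  have h1 := pend_reports h j v (A.reports I) (A.output (I.extend e))
  rw [← A.reports_extend] at h1
  exact h1

/-- The reports of all instances after an event. -/
noncomputable def allMessages (A : BlackBox) (l : List (Instance n)) : List (ℕ × ℕ × ℕ) :=
  (l.mapIdx fun i I => Config.messages A i I).flatten

theorem mem_allMessages {l : List (Instance n)} {m : ℕ × ℕ × ℕ} (h : m ∈ allMessages A l) :
    ∃ I ∈ l, m.1 < l.length ∧ m.2.1 < n ∧ m.2.2 ≤ I.depth + 1 := by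
  simp only [allMessages, List.mem_flatten, List.mem_mapIdx] at h
  obtain ⟨_, ⟨i, hi, rfl⟩, hm⟩ := h
  simp only [Config.messages, List.mem_map] at hm
  obtain ⟨p, -, rfl⟩ := hm
  exact ⟨l[i], by simp, hi, p.1.2, readEstimate_le _ _⟩

/-- The messages of the other instances carry other numbers and have no effect on the flags of the
instance `j`. -/
theorem pend_allMessages {l : List (Instance n)} {j : ℕ} {I : Instance n} (h : l[j]? = some I)
    (τ v : ℕ) (p : Prop) :
    pend τ j v (allMessages A l) p = pend τ j v (Config.messages A j I) p := by
  obtain ⟨hj, rfl⟩ := List.getElem?_eq_some_iff.mp h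
  have hl : l = l.take j ++ l[j] :: l.drop (j + 1) := by simp
  have hlen : (l.take j).length = j := by simp; omega
  have hmem : ∀ (f : ℕ → ℕ) (l' : List (Instance n)), (∀ i < l'.length, f i ≠ j) →
      ∀ m ∈ (l'.mapIdx fun i I => Config.messages A (f i) I).flatten, m.1 ≠ j := by
    intro f l' hf m hm
    simp only [List.mem_flatten, List.mem_mapIdx] at hm
    obtain ⟨_, ⟨i, hi, rfl⟩, hm⟩ := hm
    simp only [Config.messages, List.mem_map] at hm
    obtain ⟨q, -, rfl⟩ := hm
    exact hf i hi
  conv_lhs => rw [hl]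
  unfold allMessages
  rw [List.mapIdx_append, List.mapIdx_cons, List.flatten_append, List.flatten_cons, pend_append,
    pend_append, hlen, Nat.zero_add]
  have h1 := hmem (fun i => i) (l.take j) fun i hi => by simp at hi; omega
  have h2 := hmem (fun i => i + 1 + j) (l.drop (j + 1)) fun i _ => by omega
  rw [pend_of_ne h1, pend_of_ne h2]

/-- The time that the running instances have used. -/
def spent (A : BlackBox) (s : Config n) : ℕ := (s.insts.map A.totalCost).sum

theorem length_allMessages_le {l : List (Instance n)}
    (h : ∀ I ∈ l, (A.output I).length ≤ A.cost I) :
    (allMessages A l).length ≤ (l.map fun I => A.cost I).sum := by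
  -- The numbering of the instances is generalized because it shifts in the induction step.
  suffices H : ∀ f : ℕ → ℕ, (l.mapIdx fun i I => Config.messages A (f i) I).flatten.length ≤
      (l.map fun I => A.cost I).sum from H id
  induction l with
  | nil => simp
  | cons I l ih =>
    intro f
    have h1 := ih (fun I hI => h I (by simp [hI])) (fun i => f (i + 1))
    have h2 := h I (by simp)
    simp only [List.mapIdx_cons, List.flatten_cons, List.length_append, List.map_cons,
      List.sum_cons]
    simp only [Config.messages, List.length_map] at h1 ⊢
    omega

/-! ### Estimates and eccentricities -/

/-- The accuracy `1/(b+1)` makes the factor `1 - δ` equal to `b/(b+1)`; clearing the denominator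
leaves an inequality of natural numbers. -/
theorem mul_le_of_accuracy {b : ℕ} {x y : ℕ}
    (h : (1 - ((b + 1 : ℕ) : ℝ≥0∞)⁻¹) * (x : ℝ≥0∞) ≤ y) : b * x ≤ (b + 1) * y := by
  have hb : ((b + 1 : ℕ) : ℝ≥0∞) ≠ 0 := by simp
  have hb' : ((b + 1 : ℕ) : ℝ≥0∞) ≠ ⊤ := by finiteness
  have h1 : ((b + 1 : ℕ) : ℝ≥0∞) * (1 - ((b + 1 : ℕ) : ℝ≥0∞)⁻¹) = b := by
    rw [ENNReal.mul_sub (by intros; exact hb'), mul_one, ENNReal.mul_inv_cancel hb hb']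
    push_cast
    exact ENNReal.add_sub_cancel_right (by simp)
  have h2 := mul_le_mul_right h ((b + 1 : ℕ) : ℝ≥0∞)
  rw [← mul_assoc, h1] at h2
  exact_mod_cast h2

/-- If all estimates are small, then so is the eccentricity. -/
theorem eccLE_of_estimate_le {I : Instance n} {q : ℕ} (hA : A.Correct) (hI : I.Admissible)
    (hq : 1 ≤ q) (hacc : I.acc = 8 * q + 1)
    (h : ∀ v, A.estimate I v ≤ (I.depth - 1 - 2 * (I.depth / (8 * q)) : ℕ)) :
    EccLE I.edges I.src (I.depth - 1 - I.depth / (8 * q)) := by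
  intro v
  have hQ := hI.1
  obtain ⟨h1, h2⟩ := hA n I hI v
  rw [hacc] at h1 h2
  set Q := I.depth
  have hg := Nat.div_mul_le_self Q (8 * q)
  have hg' := Nat.lt_mul_div_succ Q (show 0 < 8 * q by omega)
  set g := Q / (8 * q)
  have hg8 : 8 * g ≤ Q := by nlinarith
  obtain ⟨τ, hτ⟩ : ∃ τ, Q = τ + 1 + 2 * g := ⟨Q - 1 - 2 * g, by omega⟩
  have hτ' : Q - 1 - 2 * g = τ := by omega
  have hv := h v
  rw [hτ'] at hv
  rcases le_or_gt (distance I.edges I.src v) Q with hd | hd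
  · obtain ⟨d, hs⟩ := exists_shortest_of_distance_ne_top (ne_top_of_le_ne_top (by simp) hd)
    have h3 := (h1 hd).1.trans hv
    rw [hs.distance_eq] at h3
    have h4 := mul_le_of_accuracy (b := 8 * q) (x := d) (y := τ) (by simpa using h3)
    refine ⟨d, ?_, hs.1⟩
    -- A distance of at least `τ + g + 1` would give `8q (g + 1) ≤ τ`, but `8q (g + 1) > Q > τ`. The
    -- gap of `g` between the threshold and the conclusion absorbs the error of the estimates.
    by_contra hlt
    have : τ + g + 1 ≤ d := by omega
    nlinarith
  -- A vertex beyond the truncation depth cannot have an estimate below the threshold: this would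
  -- give `8q (1 + 2g) ≤ τ`, again against `8q (g + 1) > Q`.
  · have h4 := mul_le_of_accuracy (b := 8 * q) (x := Q) (y := τ) (by simpa using (h2 hd).trans hv)
    exfalso
    nlinarith

/-- Small eccentricities are recognized. -/
theorem estimate_le_of_eccLE {I : Instance n} {τ : ℕ} (hA : A.Correct) (hI : I.Admissible)
    (hτ : τ ≤ I.depth) (h : EccLE I.edges I.src τ) (v : Fin n) : A.estimate I v ≤ τ := by
  have hd : distance I.edges I.src v ≤ τ := distance_le_iff.mpr (h v)
  refine ((hA n I hI v).1 (hd.trans (by exact_mod_cast hτ))).2.trans ?_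
  exact_mod_cast hd

/-- The threshold loses `2g` and the cover another `g`, so `Q ≤ R + 3g`. As `8qg ≤ Q`, this loss is
at most `3Q/(8q)`, and `3Q/8 ≤ R` follows from the same inequality with `g ≤ Q/8`. -/
theorem mul_le_of_covers {S : Fin n → Prop} {q Q R : ℕ} (hn : 0 < n) (hq : 1 ≤ q)
    (hc : Covers E S (Q / (8 * q) + 1)) (hS : ∀ s, S s → ¬ EccLE E s (Q - 1 - 2 * (Q / (8 * q))))
    (hR : radius E ≤ R) : q * Q ≤ (q + 1) * R := by
  have h := hc.le_radius hn hS hR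
  have hg := Nat.div_mul_le_self Q (8 * q)
  set g := Q / (8 * q)
  have hg8 : 8 * g ≤ Q := by nlinarith
  have h1 : Q ≤ R + 3 * g := by omega
  nlinarith

end IncRadius


namespace IncRadius

variable {n : ℕ} {E E' : List (Fin n × Fin n)} {A : BlackBox} {w : ℕ} {cur : List (Fin n × Fin n)}

/-! ### Watching the instances of a phase -/

/-- The instances that have been started, and empty counters for the later ones. -/
structure Fleet (cur : List (Fin n × Fin n)) (q : ℕ) (s : Config n) : Prop where
  ninst : s.var 26 = s.insts.length
  inst : ∀ I ∈ s.insts, I.edges = cur ∧ 1 ≤ I.depth ∧ I.depth + 1 ≤ n ∧ I.acc = 8 * q + 1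
  count_zero : ∀ j, s.insts.length ≤ j → s.arr 9 j = 0
  flag_zero : ∀ j (v : Fin n), s.insts.length ≤ j → s.arr 8 (j * n + v) = 0

/-- The instances from the number `base` on have depth `Q`. The flags show which of their estimates
are at most `τ`, up to the reports that have not been read. -/
structure Watch (A : BlackBox) (cur : List (Fin n × Fin n)) (q base τ Q : ℕ) (s : Config n) :
    Prop where
  fleet : Fleet cur q s
  base_eq : s.var 25 = base
  thresh_eq : s.var 24 = τ
  base_le : base ≤ s.insts.length
  counted : Counted base s.insts.length s
  queue : QueueOK s.insts.length s
  live : ∀ j I, base ≤ j → s.insts[j]? = some I → I.depth = Q ∧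
    ∀ v : Fin n, pend τ j v s.queue (s.arr 8 (j * n + v) ≠ 0) ↔ A.estimate I v ≤ τ

theorem Fleet.congr {q : ℕ} {s s' : Config n} (h : Fleet cur q s) (h26 : s'.var 26 = s.var 26)
    (hi : s'.insts = s.insts) (h8 : s'.arr 8 = s.arr 8) (h9 : s'.arr 9 = s.arr 9) :
    Fleet cur q s' := by
  obtain ⟨a, b, c, d⟩ := h
  constructor <;> rw [hi] <;> first | rwa [h26] | rwa [h9] | rwa [h8] | assumption

theorem Watch.congr {q base τ Q : ℕ} {s s' : Config n} (h : Watch A cur q base τ Q s)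
    (h24 : s'.var 24 = s.var 24) (h25 : s'.var 25 = s.var 25) (h26 : s'.var 26 = s.var 26)
    (h27 : s'.var 27 = s.var 27) (hi : s'.insts = s.insts) (hq : s'.queue = s.queue)
    (h8 : s'.arr 8 = s.arr 8) (h9 : s'.arr 9 = s.arr 9) : Watch A cur q base τ Q s' where
  fleet := h.fleet.congr h26 hi h8 h9
  base_eq := h25.trans h.base_eq
  thresh_eq := h24.trans h.thresh_eq
  base_le := hi ▸ h.base_le
  counted := by
    obtain ⟨a, b, c, d⟩ := h.counted
    constructor <;> rw [hi] <;> (try rw [h8]) <;> (try rw [h9]) <;> (try rw [h27]) <;> assumption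
  queue := by
    intro m hm
    rw [hi]
    exact h.queue m (hq ▸ hm)
  live := by rw [hi, hq, h8]; exact h.live

theorem Instance.admissible_of {I : Instance n} {q : ℕ} (hs : IsSimple cur)
    (h : I.edges = cur ∧ 1 ≤ I.depth ∧ I.depth + 1 ≤ n ∧ I.acc = 8 * q + 1) : I.Admissible :=
  ⟨h.2.1, by omega, h.1 ▸ hs⟩

theorem Config.spawn_eq (s : Config n) (u : Fin n) {k a : ℕ} (hk : 1 ≤ k) (ha : 1 ≤ a) :
    s.spawn A cur u k a = ({ s with
      insts := s.insts ++ [⟨u, k, a, cur, []⟩]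
      queue := s.queue ++ messages A s.insts.length ⟨u, k, a, cur, []⟩ },
      A.cost (⟨u, k, a, cur, []⟩ : Instance n)) := by
  unfold Config.spawn
  rw [dif_pos ⟨u.2, hk, ha⟩]

/-- The cells of a new instance are still empty, which agrees with estimates that were never
reported. Its first reports only enter the queue, and `pend` accounts for them. -/
theorem Watch.spawn {q base τ Q : ℕ} {s : Config n} (h : Watch A cur q base τ Q s) (hn : 0 < n)
    (hτ : τ ≤ Q) (hQ : 1 ≤ Q) (hQn : Q + 1 ≤ n) (u : Fin n) :
    Watch A cur q base τ Q
      ((s.spawn A cur u Q (8 * q + 1)).1.put 26 (s.insts.length + 1)) := by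
  rw [s.spawn_eq u hQ (by omega)]
  set I : Instance n := ⟨u, Q, 8 * q + 1, cur, []⟩ with hI
  have hedges : I.edges = cur := by simp [Instance.edges, hI]
  have hzero : flagCount n (s.arr 8) s.insts.length = 0 := by
    simp only [flagCount, Finset.card_eq_zero, Finset.filter_eq_empty_iff]
    intro v _
    simpa using h.fleet.flag_zero s.insts.length v le_rfl
  refine ⟨⟨by simp, ?_, ?_, ?_⟩, by simpa using h.base_eq, by simpa using h.thresh_eq, ?_,
    ⟨?_, ?_, ?_, ?_⟩, ?_, ?_⟩
  · intro J hJ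
    simp only [Config.put_insts, List.mem_append, List.mem_singleton] at hJ
    rcases hJ with hJ | rfl
    · exact h.fleet.inst J hJ
    · exact ⟨hedges, hQ, hQn, rfl⟩
  · intro j hj
    simp at hj
    exact h.fleet.count_zero j (by omega)
  · intro j v hj
    simp at hj
    exact h.fleet.flag_zero j v (by omega)
  · have := h.base_le
    simp
    omega
  · intro j hj hj'
    simp only [Config.put_insts, List.length_append, List.length_singleton, Config.put_arr] at hj' ⊢
    rcases Nat.lt_succ_iff_lt_or_eq.mp hj' with h1 | rfl
    · exact h.counted.count j hj h1
    · rw [hzero, h.fleet.count_zero _ le_rfl]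
  · simp only [Config.put_insts, List.length_append, List.length_singleton, Config.put_arr,
      Config.put_var]
    rw [if_neg (by omega), h.counted.full]
    unfold fullCount
    -- The new instance has no flag yet and `n > 0`, so the number of full instances does not
    -- change.
    rw [← Finset.insert_Ico_right_eq_Ico_add_one h.base_le, Finset.filter_insert, if_neg]
    rw [hzero]
    omega
  · intro j hj
    simp at hj
    exact h.fleet.count_zero j (by omega)
  · intro j v hj
    simp at hj
    exact h.fleet.flag_zero j v (by omega)
  · intro m hm
    simp only [Config.put_queue, List.mem_append, Config.put_insts, List.length_append,
      List.length_singleton] at hm ⊢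
    rcases hm with hm | hm
    · have := h.queue m hm
      omega
    · simp only [Config.messages, List.mem_map] at hm
      obtain ⟨p, -, rfl⟩ := hm
      have := readEstimate_le Q p.2
      exact ⟨by simp, p.1.2, by simp only [hI]; omega⟩
  · intro j J hj hJ
    simp only [Config.put_insts, Config.put_queue, Config.put_arr] at hJ ⊢
    rcases Nat.lt_or_ge j s.insts.length with h1 | h1
    · rw [List.getElem?_append_left h1] at hJ
      obtain ⟨h2, h3⟩ := h.live j J hj hJ
      refine ⟨h2, fun v => ?_⟩
      rw [pend_append, pend_of_ne, h3 v]
      intro m hm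
      simp only [Config.messages, List.mem_map] at hm
      obtain ⟨p, -, rfl⟩ := hm
      simp only
      omega
    · rw [List.getElem?_append_right h1] at hJ
      have h2 := (List.getElem?_eq_some_iff.mp hJ).1
      simp only [List.length_singleton] at h2
      obtain rfl : j = s.insts.length := by omega
      simp only [Nat.sub_self, List.getElem?_cons_zero, Option.some.injEq] at hJ
      subst hJ
      refine ⟨rfl, fun v => ?_⟩
      have hne : ∀ m ∈ s.queue, m.1 ≠ s.insts.length := fun m hm => (h.queue m hm).1.ne
      rw [pend_append, pend_of_ne hne]
      rw [propext (show s.arr 8 (s.insts.length * n + v) ≠ 0 ↔ False by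
        simpa using h.fleet.flag_zero s.insts.length v le_rfl)]
      exact pend_messages_fresh hτ rfl _ v

/-- Start an instance from each member of the cover. -/
def spawnCenters : Cmd :=
  .loop (.var 23 <ₑ .var 0) (
    .ite inClass (
      .spawn (.var 23) (.var 22) (.const 8 *ₑ .var 1 +ₑ .const 1) ;;
      26 ≔ .var 26 +ₑ .const 1) .skip ;;
    23 ≔ .var 23 +ₑ .const 1)

/-- Start the instances for the estimate in variable `22`. -/
def newPhase : Cmd :=
  18 ≔ .var 22 /ₑ (.const 8 *ₑ .var 1) +ₑ .const 1 ;;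
  24 ≔ .var 22 -ₑ .const 1 -ₑ .const 2 *ₑ (.var 18 -ₑ .const 1) ;;
  select ;;
  25 ≔ .var 26 ;;
  27 ≔ .const 0 ;;
  23 ≔ .const 0 ;;
  spawnCenters

/-- Lower the estimate in variable `22` as long as it is found to be too large. -/
def advance : Cmd :=
  .loop (.var 27) (
    22 ≔ .var 22 -ₑ (.var 22 /ₑ (.const 8 *ₑ .var 1) +ₑ .const 1) ;;
    newPhase ;;
    drain)

/-- Process all reports, and compute the answer. -/
def finish : Cmd :=
  drain ;; advance ;; 5 ≔ .var 22 +ₑ .const 1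

/-- The black-box time passes into `spent`, and so does the growth of the queue, since a report
takes at least one time unit. Only `O(n)` is left for the program itself. -/
theorem spawnCenters_spec {dep : Fin n → ℕ} {r : Fin n} {s : Config n} {q base τ Q k i : ℕ}
    (hA : ∀ I : Instance n, I.Admissible → (A.output I).length ≤ A.cost I) (hn : 0 < n)
    (hs : IsSimple cur) (hτ : τ ≤ Q) (hQ : 1 ≤ Q) (hQn : Q + 1 ≤ n) (h0 : s.var 0 = n)
    (h1 : s.var 1 = q) (h16 : s.var 16 = r + 1) (h18 : s.var 18 = k) (h19 : s.var 19 = i)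
    (h22 : s.var 22 = Q) (h23 : s.var 23 = 0) (htree : TreeMem dep s)
    (hwatch : Watch A cur q base τ Q s) (hlen : s.insts.length + n ≤ n * n)
    (hw : n * n + 3 * n + 20 ≤ 2 ^ w) (hw' : 8 * q + 1 < 2 ^ w) :
    WP A w cur spawnCenters s fun s' t =>
      Watch A cur q base τ Q s' ∧ (∃ new, s'.insts = s.insts ++ new ∧ (∀ I ∈ new, I.depth = Q) ∧
        new.length = (Finset.univ.filter (Center dep r k i)).card ∧
        ∀ u, Center dep r k i u → ∃ I ∈ new, I.src = u) ∧
      t + spent A s ≤ 80 * n + 10 + spent A s' ∧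
      s'.queue.length + spent A s ≤ s.queue.length + spent A s' := by
  refine WP.loop (fun s' t => Watch A cur q base τ Q s' ∧ (∃ new, s'.insts = s.insts ++ new ∧
        (∀ I ∈ new, I.depth = Q) ∧ new.length = countBelow (Center dep r k i) (s'.var 23) ∧
        ∀ u : Fin n, u < s'.var 23 → Center dep r k i u → ∃ I ∈ new, I.src = u) ∧
      t + spent A s ≤ 80 * s'.var 23 + spent A s' ∧ s'.var 23 ≤ n ∧
      s'.queue.length + spent A s ≤ s.queue.length + spent A s')
    (fun s' => n - s'.var 23) ?_ ?_ ?_ ?_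
  · exact ⟨hwatch, ⟨[], by simp, by simp, by simp [h23, countBelow_zero], by simp [h23]⟩,
      by simp, by omega, le_rfl⟩
  · simp
  · rintro s' t hb hF ⟨hW, ⟨new, hnew, hdep, hcount, hsrc⟩, ht, hle, hql⟩ hlt
    have hw0 := hb.pos
    have e0 := (hF.var 0 rfl).trans h0
    have e1 := (hF.var 1 rfl).trans h1
    have e16 := (hF.var 16 rfl).trans h16
    have e18 := (hF.var 18 rfl).trans h18
    have e19 := (hF.var 19 rfl).trans h19
    have e22 := (hF.var 22 rfl).trans h22
    have htree' : TreeMem dep s' := fun u => by rw [hF.arr 4 rfl]; exact htree u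
    simp [e0] at hlt
    obtain ⟨v, hv⟩ : ∃ v : Fin n, s'.var 23 = v := ⟨⟨_, hlt⟩, rfl⟩
    have hcv := inClass_val e0 hv htree' e16 e18 e19
    have hcard := countBelow_succ (Center dep r k i) v
    have hcn := countBelow_le (Center dep r k i) v
    rw [hv] at ht hcount hsrc
    have h26 := hW.fleet.ninst
    have hl : s'.insts.length = s.insts.length + new.length := by simp [hnew]
    apply WP.seq
    refine WP.ite (inClass_fits hb e0 hlt hw) (fun hc => ?_) fun hc => ?_
    · rw [hcv] at hc
      simp only [hc, truth_true] at hcard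
      have hW' := hW.spawn hn hτ hQ hQn v
      have hout := hA (⟨v, Q, 8 * q + 1, cur, []⟩ : Instance n)
        ⟨hQ, by simp, by simpa [Instance.edges] using hs⟩
      have htot := A.totalCost_fresh (I := (⟨v, Q, 8 * q + 1, cur, []⟩ : Instance n)) rfl
      apply WP.seq
      refine WP.spawn (by simp) (by simp) (by simp [e1]; omega) ?_
      simp only [Expr.val_add, Expr.val_mul, Expr.val_const, Expr.val_var, hv, e22, e1]
      rw [s'.spawn_eq v hQ (by omega)] at hW' ⊢
      refine WP.assign (by simp [h26]; omega) ?_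
      refine WP.assign (by simp; omega) ⟨⟨?_, ⟨new ++ [⟨v, Q, 8 * q + 1, cur, []⟩], ?_, ?_, ?_, ?_⟩,
        ?_, ?_, ?_⟩, ?_⟩
      · refine hW'.congr ?_ ?_ ?_ ?_ rfl rfl rfl rfl <;> simp [h26]
      · simp [hnew]
      · intro I hI
        rcases List.mem_append.mp hI with hI | hI
        · exact hdep I hI
        · rw [List.mem_singleton.mp hI]
      · simp [hv, hcard, hcount]
      · intro u hu hcu
        simp [hv] at hu
        rcases hu.lt_or_eq with h | h
        · obtain ⟨I, hI, hI'⟩ := hsrc u h hcu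
          exact ⟨I, by simp [hI], hI'⟩
        · exact ⟨⟨v, Q, 8 * q + 1, cur, []⟩, by simp, by simpa using h.symm⟩
      · simp [spent, hv, htot, inClass, residue] at ht ⊢
        omega
      · simp; omega
      · simp [spent, htot, Config.messages] at hql ⊢
        omega
      · simp; omega
    · rw [hcv.not_right] at hc
      simp only [hc, truth_false, Nat.add_zero] at hcard
      refine WP.skip (WP.assign (by simp; omega) ⟨⟨?_, ⟨new, ?_, hdep, ?_, ?_⟩, ?_, ?_, ?_⟩, ?_⟩)
      · refine hW.congr ?_ ?_ ?_ ?_ rfl rfl rfl rfl <;> simp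
      · simp [hnew]
      · simp [hv, hcard, hcount]
      · intro u hu hcu
        simp [hv] at hu
        rcases hu.lt_or_eq with h | h
        · exact hsrc u h hcu
        · obtain rfl : u = v := by simpa using h
          exact absurd hcu hc
      · simp [spent, hv, inClass, residue] at ht ⊢
        omega
      · simp; omega
      · simpa [spent] using hql
      · simp; omega
  · rintro s' t hb hF ⟨hW, ⟨new, hnew, hdep, hcount, hsrc⟩, ht, hle, hql⟩ hlt
    have e0 := (hF.var 0 rfl).trans h0
    simp [e0] at hlt
    have h23' : s'.var 23 = n := by omega
    rw [h23'] at hcount ht hsrc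
    rw [countBelow_self] at hcount
    refine ⟨hW, ⟨new, hnew, hdep, hcount, fun u => hsrc u u.2⟩, ?_, hql⟩
    simp
    omega

/-- The levels may come from a subgraph `E` of the current graph: the cover needs only that the
walks in `E` still exist. -/
theorem newPhase_spec {dep : Fin n → ℕ} {r : Fin n} {s : Config n} {q Q : ℕ}
    (hA : ∀ I : Instance n, I.Admissible → (A.output I).length ≤ A.cost I) (hn : 0 < n)
    (hs : IsSimple cur) (hq : 1 ≤ q) (hQ : 1 ≤ Q) (hQn : Q + 1 ≤ n) (h0 : s.var 0 = n)
    (h1 : s.var 1 = q) (h16 : s.var 16 = r + 1) (h22 : s.var 22 = Q) (htree : TreeMem dep s)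
    (hE : E ⊆ cur) (hdep : ∀ u, Shortest E (dep u) r u) (hfleet : Fleet cur q s)
    (hqueue : s.queue = []) (hlen : s.insts.length + n ≤ n * n)
    (hw : n * n + 3 * n + 20 ≤ 2 ^ w) (hw' : 8 * q + 1 < 2 ^ w) :
    WP A w cur newPhase s fun s' t =>
      Watch A cur q s.insts.length (Q - 1 - 2 * (Q / (8 * q))) Q s' ∧
      (∃ new, s'.insts = s.insts ++ new ∧ (∀ I ∈ new, I.depth = Q) ∧
        new.length ≤ n / (Q / (8 * q) + 1) + 1 ∧ new.length ≤ n ∧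
        Covers cur (fun u => ∃ I ∈ new, I.src = u) (Q / (8 * q) + 1)) ∧
      t + spent A s ≤ 300 * n + 200 + spent A s' ∧
      s'.queue.length + spent A s ≤ spent A s' := by
  refine WP.bdd fun hb => ?_
  have hw0 := hb.pos
  have hdiv : Q / (8 * q) ≤ Q := Nat.div_le_self _ _
  have hk1 : Q / (8 * q) + 1 ≤ n := by omega
  unfold newPhase
  apply WP.seq
  refine WP.assign (by simp [h22, h1]; omega) ?_
  simp only [Expr.val_add, Expr.val_div, Expr.val_mul, Expr.val_const, Expr.val_var, h22, h1]
  set g := Q / (8 * q) with hg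
  apply WP.seq
  refine WP.assign (by simp; omega) ?_
  apply WP.seq
  refine WP.conseq (select_spec (dep := dep) (k := g + 1) (by simpa using h0) (by simp)
    (Nat.succ_pos _) hk1 htree hw) ?_
  rintro s₁ t₁ hb₁ hF₁ ⟨i, hi, h19, hcard, ht₁⟩
  have f0 : s₁.var 0 = n := (hF₁.var 0 rfl).trans (by simpa using h0)
  have f1 : s₁.var 1 = q := (hF₁.var 1 rfl).trans (by simpa using h1)
  have f16 : s₁.var 16 = r + 1 := (hF₁.var 16 rfl).trans (by simpa using h16)
  have f18 : s₁.var 18 = g + 1 := (hF₁.var 18 rfl).trans (by simp)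
  have f22 : s₁.var 22 = Q := (hF₁.var 22 rfl).trans (by simpa using h22)
  have f24 : s₁.var 24 = Q - 1 - 2 * g := (hF₁.var 24 rfl).trans (by simp [h22])
  have f26 : s₁.var 26 = s.var 26 := (hF₁.var 26 rfl).trans (by simp)
  have fi : s₁.insts = s.insts := hF₁.insts rfl
  have fq : s₁.queue = [] := (hF₁.queue rfl rfl).trans hqueue
  have f8 : s₁.arr 8 = s.arr 8 := hF₁.arr 8 rfl
  have f9 : s₁.arr 9 = s.arr 9 := hF₁.arr 9 rfl
  have f4 : TreeMem dep s₁ := fun u => by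
    have : s₁.arr 4 = s.arr 4 := hF₁.arr 4 rfl
    rw [this]; exact htree u
  have hF' := hfleet.congr f26 fi f8 f9
  apply WP.seq
  refine WP.assign (by simp) ?_
  apply WP.seq
  refine WP.assign (by simp) ?_
  apply WP.seq
  refine WP.assign (by simp) ?_
  refine WP.conseq (spawnCenters_spec (dep := dep) (r := r) (q := q) (base := s.insts.length)
    (τ := Q - 1 - 2 * g) (Q := Q) (k := g + 1) (i := i) hA hn hs (by omega) hQ hQn (by simpa using f0)
    (by simpa using f1) (by simpa using f16) (by simpa using f18) (by simpa using h19)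
    (by simpa using f22) (by simp) f4
    ⟨hF'.congr (by simp) rfl rfl rfl, by simp [f26, hfleet.ninst], by simpa using f24, ?_,
      ⟨?_, ?_, hF'.count_zero, hF'.flag_zero⟩, ?_, ?_⟩ (by simpa [fi] using hlen) hw hw') ?_
  · simp [fi]
  · intro j h1 h2
    simp [fi] at h2
    omega
  · simp [fullCount, fi]
  · intro m hm
    simp [fq] at hm
  · intro j I h1 h2
    have h3 := (List.getElem?_eq_some_iff.mp h2).1
    simp [fi] at h3
    omega
  rintro s' t' hb' hF ⟨hW, ⟨new, hnew, hd, hcount, hsrc⟩, ht, hql⟩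
  have hsp : ∀ x y z, spent A (((s₁.put 25 x).put 27 y).put 23 z) = spent A s := fun x y z => by
    simp [spent, fi]
  rw [hsp] at ht hql
  refine ⟨hW, ⟨new, by simpa [fi] using hnew, hd, ?_, ?_, ?_⟩, ?_, by simpa [fq] using hql⟩
  · rw [hcount]
    refine (card_centers_le _ _ _ _).trans (Nat.add_le_add_right ?_ 1)
    rw [Nat.le_div_iff_mul_le (Nat.succ_pos _), Nat.mul_comm]
    exact hcard
  · rw [hcount]
    exact (Finset.card_filter_le _ _).trans (by simp)
  · intro u
    obtain ⟨x, hx, hx'⟩ := (covers_of_levels hdep hi).mono hE u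
    exact ⟨x, hsrc x hx, hx'⟩
  · simp
    omega

end IncRadius


namespace IncRadius

variable {n : ℕ} {E E' : List (Fin n × Fin n)} {A : BlackBox} {w : ℕ} {cur : List (Fin n × Fin n)}

/-! ### Preservation of the watched state while reports arrive. -/

/-- The words are large enough for the numbers that occur in the program. -/
structure LargeWords (w n q : ℕ) : Prop where
  sq : n * n + 3 * n + 20 ≤ 2 ^ w
  cube : n * n * n + n + 20 ≤ 2 ^ w
  acc : 8 * q + 1 < 2 ^ w

theorem Watch.drain {q base τ Q : ℕ} {s : Config n} (h : Watch A cur q base τ Q s)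
    (h0 : s.var 0 = n) (hlen : s.insts.length ≤ n * n) (hw : LargeWords w n q) :
    WP A w cur drain s fun s' t => Watch A cur q base τ Q s' ∧ s'.queue = [] ∧
      t ≤ 80 * s.queue.length + 10 := by
  have hsq := hw.sq
  have hmul := Nat.mul_le_mul_right n hlen
  have hcube := hw.cube
  refine WP.conseq (drain_spec h0 h.base_eq h.thresh_eq h.counted h.queue (by omega) hlen
    (by omega)) ?_
  rintro s' t hb hF ⟨hc, hq, hfl, ht⟩
  have hi : s'.insts = s.insts := hF.insts rfl
  refine ⟨⟨⟨?_, ?_, ?_, ?_⟩, (hF.var 25 rfl).trans h.base_eq, (hF.var 24 rfl).trans h.thresh_eq,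
    by rw [hi]; exact h.base_le, by rw [hi]; exact hc, ?_, ?_⟩, hq, ht⟩
  · rw [hi, hF.var 26 rfl, h.fleet.ninst]
  · rw [hi]; exact h.fleet.inst
  · rw [hi]; exact hc.count_zero
  · rw [hi]; exact hc.flag_zero
  · intro m hm
    simp [hq] at hm
  · intro j I hj hI
    rw [hi] at hI
    refine ⟨(h.live j I hj hI).1, fun v => ?_⟩
    rw [hq, ← (h.live j I hj hI).2 v]
    exact hfl j hj v

/-! ### Insertions -/

theorem Config.insertEdge_eq {s : Config n} (hw : n ≤ 2 ^ w) (e : Fin n × Fin n) :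
    s.insertEdge A w e = ((({ s with
      insts := s.insts.map fun I => I.extend e
      queue := s.queue ++ allMessages A (s.insts.map fun I => I.extend e) } : Config n).put 3
        e.1).put 4 e.2, (s.insts.map fun I => A.cost (I.extend e)).sum) := by
  have h1 := e.1.2
  have h2 := e.2.2
  unfold Config.insertEdge
  simp only [allMessages, List.map_map, Prod.mk.injEq]
  rw [Config.setVar_eq_put _ _ (by omega), Config.setVar_eq_put _ _ (by omega)]
  exact ⟨rfl, rfl⟩

theorem Bdd.insertEdge {s : Config n} (h : Bdd w s) (e : Fin n × Fin n) :
    Bdd w (s.insertEdge A w e).1 := by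
  unfold Config.insertEdge
  refine Bdd.setVar (Bdd.setVar ?_ _ _) _ _
  exact h.of_eq rfl rfl

theorem spent_insertEdge (s : Config n) (e : Fin n × Fin n) :
    spent A (s.insertEdge A w e).1 = spent A s + (s.insertEdge A w e).2 := by
  simp only [spent, Config.insertEdge, Config.setVar, List.map_map]
  induction s.insts with
  | nil => rfl
  | cons I l ih =>
    simp only [List.map_cons, List.sum_cons, Function.comp_apply, A.totalCost_extend] at ih ⊢
    omega

theorem Instance.extend_inst {q : ℕ} {l : List (Instance n)} (e : Fin n × Fin n)
    (h : ∀ I ∈ l, I.edges = cur ∧ 1 ≤ I.depth ∧ I.depth + 1 ≤ n ∧ I.acc = 8 * q + 1) :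
    ∀ I ∈ l.map fun I => I.extend e,
      I.edges = cur ++ [e] ∧ 1 ≤ I.depth ∧ I.depth + 1 ≤ n ∧ I.acc = 8 * q + 1 := by
  intro I hI
  obtain ⟨J, hJ, rfl⟩ := List.mem_map.mp hI
  obtain ⟨h1, h2⟩ := h J hJ
  exact ⟨by rw [J.edges_extend, h1], h2⟩

theorem length_queue_insertEdge_le {q : ℕ} {s : Config n} {e : Fin n × Fin n}
    (hA : ∀ I : Instance n, I.Admissible → (A.output I).length ≤ A.cost I)
    (hs : IsSimple (cur ++ [e])) (h : Fleet cur q s) :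
    (s.insertEdge A w e).1.queue.length ≤ s.queue.length + (s.insertEdge A w e).2 := by
  simp only [Config.insertEdge, Config.setVar, List.length_append]
  refine Nat.add_le_add_left (length_allMessages_le fun I hI => hA I ?_) _
  exact Instance.admissible_of hs (Instance.extend_inst e h.inst I hI)

/-- The insertion changes no flag. The new estimates are those obtained from the old ones by the
reports just appended to the queue, which is the form in which `live` is stated. -/
theorem Watch.insertEdge {q base τ Q : ℕ} {s : Config n} (h : Watch A cur q base τ Q s)
    (hτ : τ ≤ Q) (e : Fin n × Fin n) (hw : n ≤ 2 ^ w) :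
    Watch A (cur ++ [e]) q base τ Q (s.insertEdge A w e).1 := by
  rw [Config.insertEdge_eq hw]
  set l' := s.insts.map fun I => I.extend e with hl'
  have hlen : l'.length = s.insts.length := by simp [hl']
  have hinst := Instance.extend_inst e h.fleet.inst
  refine ⟨⟨?_, hinst, ?_, ?_⟩, by simpa using h.base_eq, by simpa using h.thresh_eq, ?_,
    ⟨?_, ?_, ?_, ?_⟩, ?_, ?_⟩
  · simpa [hlen] using h.fleet.ninst
  · simpa [hlen] using h.fleet.count_zero
  · simpa [hlen] using h.fleet.flag_zero
  · simpa [hlen] using h.base_le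
  · simpa [hlen] using h.counted.count
  · simpa [hlen] using h.counted.full
  · simpa [hlen] using h.fleet.count_zero
  · simpa [hlen] using h.fleet.flag_zero
  · intro m hm
    simp only [Config.put_queue, List.mem_append, Config.put_insts] at hm ⊢
    rcases hm with hm | hm
    · rw [hlen]; exact h.queue m hm
    · obtain ⟨I, hI, h1, h2, h3⟩ := mem_allMessages hm
      have := (hinst I hI).2.2.1
      exact ⟨h1, h2, by omega⟩
  · intro j J hj hJ
    simp only [Config.put_insts, Config.put_queue, Config.put_arr] at hJ ⊢
    have hJ' := hJ
    rw [hl', List.getElem?_map, Option.map_eq_some_iff] at hJ'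
    obtain ⟨I, hI, rfl⟩ := hJ'
    obtain ⟨h1, h2⟩ := h.live j I hj hI
    refine ⟨h1, fun v => ?_⟩
    rw [pend_append, propext (h2 v), pend_allMessages hJ]
    exact pend_messages_extend (by omega) e j v

/-! ### Phases -/

/-- An upper bound for the number of phases that start with an estimate `Q`. -/
def phaseBound (q : ℕ) : ℕ → ℕ
  | 0 => 0
  | Q + 1 => 1 + phaseBound q (Q - (Q + 1) / (8 * q))
  decreasing_by exact Nat.lt_succ_of_le (Nat.sub_le _ _)

theorem phaseBound_eq {q Q : ℕ} (hQ : 1 ≤ Q) :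
    phaseBound q Q = 1 + phaseBound q (Q - (Q / (8 * q) + 1)) := by
  obtain ⟨Q, rfl⟩ : ∃ Q', Q = Q' + 1 := ⟨Q - 1, by omega⟩
  rw [phaseBound, show Q + 1 - ((Q + 1) / (8 * q) + 1) = Q - (Q + 1) / (8 * q) by omega]

/-- As long as `Q ≥ 2 ^ j`, a phase lowers it by at least `2 ^ j / (8q) + 1`, and `8q` such steps
exceed `2 ^ j`. So each halving costs at most `8q` phases. -/
theorem phaseBound_le {q : ℕ} (hq : 1 ≤ q) (j : ℕ) :
    ∀ Q < 2 ^ j, phaseBound q Q ≤ 8 * q * j := by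
  induction j with
  | zero =>
    intro Q hQ
    obtain rfl : Q = 0 := by simpa using hQ
    simp [phaseBound]
  | succ j ih =>
    -- With `i` steps of this size the estimate falls below `2 ^ j`; the case `i = 8q` covers
    -- everything below `2 ^ (j + 1)`.
    have key : ∀ i Q, Q < 2 ^ j + i * (2 ^ j / (8 * q) + 1) → phaseBound q Q ≤ i + 8 * q * j := by
      intro i
      induction i with
      | zero => intro Q hQ; simpa using ih Q (by simpa using hQ)
      | succ i ihi =>
        intro Q hQ
        rcases Nat.lt_or_ge Q (2 ^ j) with h | h
        · exact (ih Q h).trans (by omega)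
        · have h1 : 2 ^ j / (8 * q) ≤ Q / (8 * q) := Nat.div_le_div_right h
          have h2 : 1 ≤ 2 ^ j := Nat.one_le_two_pow
          rw [phaseBound_eq (by omega)]
          rw [Nat.add_mul] at hQ
          have := ihi (Q - (Q / (8 * q) + 1)) (by omega)
          omega
    intro Q hQ
    have h3 := Nat.lt_mul_div_succ (2 ^ j) (show 0 < 8 * q by omega)
    have := key (8 * q) Q (by rw [pow_succ] at hQ; omega)
    rw [Nat.mul_add]
    omega

/-- The state of the program while the radius is finite. The phases that have been started are those
for the estimates in `ph`, and the last of them has the estimate `Q`. -/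
structure Phase (A : BlackBox) (cur : List (Fin n × Fin n)) (q : ℕ) (r : Fin n) (dep : Fin n → ℕ)
    (Q₀ : ℕ) (ph : List ℕ) (base Q : ℕ) (s : Config n) : Prop where
  n_eq : s.var 0 = n
  q_eq : s.var 1 = q
  root_eq : s.var 16 = r + 1
  est_eq : s.var 22 = Q
  tree : TreeMem dep s
  -- The levels are shortest in the graph in which the root was found; they are never recomputed.
  tree_short : ∃ E ⊆ cur, ∀ u, Shortest E (dep u) r u
  radius_le : radius cur ≤ Q
  est_lt : Q + 1 ≤ n
  watch : Watch A cur q base (Q - 1 - 2 * (Q / (8 * q))) Q s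
  cover : Covers cur (fun u => ∃ j I, base ≤ j ∧ s.insts[j]? = some I ∧ I.src = u)
    (Q / (8 * q) + 1)
  phases_mem : ∀ Q' ∈ ph, Q ≤ Q' ∧ Q' ≤ Q₀
  -- A crude bound, as each phase lowers the estimate by at least one; it limits the number of
  -- instances to `n * n` and keeps array indices within a word.
  phases_length : ph.length + Q ≤ n
  phases_bound : ph.length + phaseBound q (Q - (Q / (8 * q) + 1)) ≤ phaseBound q Q₀
  length_insts : s.insts.length ≤ n * ph.length
  -- An arbitrary weight of the depth, so that the black-box time for the final number of edges can
  -- be inserted at the end.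
  sum_insts : ∀ F : ℕ → ℝ≥0, (s.insts.map fun I => F I.depth).sum ≤
    (ph.map fun Q' => ((n / (Q' / (8 * q) + 1) + 1 : ℕ) : ℝ≥0) * F Q').sum

section

variable {q : ℕ} {r : Fin n} {dep : Fin n → ℕ} {Q₀ : ℕ} {ph : List ℕ} {base Q : ℕ} {s s' : Config n}

theorem Phase.one_le (h : Phase A cur q r dep Q₀ ph base Q s) (hn : 2 ≤ n) : 1 ≤ Q := by
  have := (one_le_radius (E := cur) hn).trans h.radius_le
  exact_mod_cast this

theorem Phase.length_insts_le (h : Phase A cur q r dep Q₀ ph base Q s) :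
    s.insts.length ≤ n * n :=
  h.length_insts.trans (Nat.mul_le_mul_left n (by have := h.phases_length; omega))

theorem Phase.congr (h : Phase A cur q r dep Q₀ ph base Q s) (h0 : s'.var 0 = s.var 0)
    (h1 : s'.var 1 = s.var 1) (h16 : s'.var 16 = s.var 16) (h22 : s'.var 22 = s.var 22)
    (h4 : s'.arr 4 = s.arr 4) (hi : s'.insts = s.insts)
    (hw : Watch A cur q base (Q - 1 - 2 * (Q / (8 * q))) Q s') :
    Phase A cur q r dep Q₀ ph base Q s' where
  n_eq := h0.trans h.n_eq
  q_eq := h1.trans h.q_eq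
  root_eq := h16.trans h.root_eq
  est_eq := h22.trans h.est_eq
  tree u := by rw [h4]; exact h.tree u
  tree_short := h.tree_short
  radius_le := h.radius_le
  est_lt := h.est_lt
  watch := hw
  cover := by rw [hi]; exact h.cover
  phases_mem := h.phases_mem
  phases_length := h.phases_length
  phases_bound := h.phases_bound
  length_insts := by rw [hi]; exact h.length_insts
  sum_insts := by rw [hi]; exact h.sum_insts

theorem Phase.insertEdge (h : Phase A cur q r dep Q₀ ph base Q s) (e : Fin n × Fin n)
    (hw : n ≤ 2 ^ w) :
    Phase A (cur ++ [e]) q r dep Q₀ ph base Q (s.insertEdge A w e).1 := by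
  have hwatch := h.watch.insertEdge (by omega) e hw
  have hsub : cur ⊆ cur ++ [e] := by simp
  rw [Config.insertEdge_eq hw] at hwatch ⊢
  obtain ⟨E, hE, hdep⟩ := h.tree_short
  refine ⟨by simpa using h.n_eq, by simpa using h.q_eq, by simpa using h.root_eq,
    by simpa using h.est_eq, h.tree, ⟨E, List.Subset.trans hE hsub, hdep⟩,
    (radius_antitone hsub).trans h.radius_le, h.est_lt, hwatch, ?_, h.phases_mem, h.phases_length,
    h.phases_bound, by simpa using h.length_insts, ?_⟩
  · intro u
    obtain ⟨x, ⟨j, I, hj, hI, hx⟩, hu⟩ := h.cover.mono hsub u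
    exact ⟨x, ⟨j, I.extend e, hj, by simp [hI], hx⟩, hu⟩
  · intro F
    have := h.sum_insts F
    simpa [Function.comp_def, Instance.extend] using this

theorem Phase.drain (h : Phase A cur q r dep Q₀ ph base Q s) (hw : LargeWords w n q) :
    WP A w cur drain s fun s' t => Phase A cur q r dep Q₀ ph base Q s' ∧ s'.queue = [] ∧
      t ≤ 80 * s.queue.length + 10 := by
  refine WP.conseq (h.watch.drain h.n_eq h.length_insts_le hw) ?_
  rintro s' t hb hF ⟨hW, hq, ht⟩
  exact ⟨h.congr (hF.var 0 rfl) (hF.var 1 rfl) (hF.var 16 rfl) (hF.var 22 rfl) (hF.arr 4 rfl)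
    (hF.insts rfl) hW, hq, ht⟩

/-- If some instance has small estimates only, then the estimate of the radius is too large. -/
theorem Phase.radius_le_of_full (h : Phase A cur q r dep Q₀ ph base Q s) (hA : A.Correct)
    (hs : IsSimple cur) (hq : 1 ≤ q) (hqueue : s.queue = []) (hfull : s.var 27 ≠ 0) :
    radius cur ≤ (Q - (Q / (8 * q) + 1) : ℕ) := by
  rw [h.watch.counted.full, fullCount, Finset.card_ne_zero] at hfull
  obtain ⟨j, hj⟩ := hfull
  simp only [Finset.mem_filter, Finset.mem_Ico, flagCount_eq_iff] at hj
  obtain ⟨⟨hj1, hj2⟩, hfl⟩ := hj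
  obtain ⟨hd, hlive⟩ := h.watch.live j _ hj1 (List.getElem?_eq_getElem hj2)
  have hi := h.watch.fleet.inst _ (List.getElem_mem hj2)
  have hadm := Instance.admissible_of hs hi
  have hecc := eccLE_of_estimate_le hA hadm hq hi.2.2.2 fun v => by
    rw [hd]
    have := (hlive v).mp
    rw [hqueue] at this
    exact this (hfl v)
  rw [hi.1, hd] at hecc
  refine hecc.radius_le.trans ?_
  rw [show Q - 1 - Q / (8 * q) = Q - (Q / (8 * q) + 1) by omega]

/-- If every instance has a large estimate, then the estimate of the radius is good. -/
theorem Phase.mul_le (h : Phase A cur q r dep Q₀ ph base Q s) (hA : A.Correct) (hn : 2 ≤ n)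
    (hs : IsSimple cur) (hq : 1 ≤ q) (hqueue : s.queue = []) (hfull : s.var 27 = 0) {R : ℕ}
    (hR : radius cur ≤ R) : q * Q ≤ (q + 1) * R := by
  refine mul_le_of_covers (by omega) hq h.cover ?_ hR
  rintro _ ⟨j, I, hj, hI, rfl⟩ hecc
  have hj2 := (List.getElem?_eq_some_iff.mp hI).1
  obtain ⟨hd, hlive⟩ := h.watch.live j I hj hI
  have hi := h.watch.fleet.inst I (List.mem_of_getElem? hI)
  have hadm := Instance.admissible_of hs hi
  have hest := estimate_le_of_eccLE hA hadm (τ := Q - 1 - 2 * (Q / (8 * q))) (by rw [hd]; omega)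
    (by rw [hi.1]; exact hecc)
  rw [h.watch.counted.full, fullCount, Finset.card_eq_zero, Finset.filter_eq_empty_iff] at hfull
  refine hfull (Finset.mem_Ico.mpr ⟨hj, hj2⟩) ((flagCount_eq_iff _ _).mpr fun v => ?_)
  have := (hlive v).mpr (hest v)
  rwa [hqueue] at this

/-- Used both for the first phase, with `ph` empty, and after each lowering of the estimate; the
invariant `Phase` itself is therefore not assumed. -/
theorem start_phase (hA : ∀ I : Instance n, I.Admissible → (A.output I).length ≤ A.cost I)
    (hn : 2 ≤ n) (hs : IsSimple cur) (hq : 1 ≤ q) (h0 : s.var 0 = n) (h1 : s.var 1 = q)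
    (h16 : s.var 16 = r + 1) (h22 : s.var 22 = Q) (htree : TreeMem dep s)
    (hshort : ∃ E ⊆ cur, ∀ u, Shortest E (dep u) r u) (hR : radius cur ≤ Q) (hQn : Q + 1 ≤ n)
    (hfleet : Fleet cur q s) (hqueue : s.queue = [])
    (hmem : ∀ Q' ∈ ph, Q ≤ Q' ∧ Q' ≤ Q₀) (hQ₀ : Q ≤ Q₀) (hlen : ph.length + 1 + Q ≤ n)
    (hbound : ph.length + phaseBound q Q ≤ phaseBound q Q₀)
    (hinsts : s.insts.length ≤ n * ph.length)
    (hsum : ∀ F : ℕ → ℝ≥0, (s.insts.map fun I => F I.depth).sum ≤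
      (ph.map fun Q' => ((n / (Q' / (8 * q) + 1) + 1 : ℕ) : ℝ≥0) * F Q').sum)
    (hw : LargeWords w n q) :
    WP A w cur newPhase s fun s' t => (∃ base, Phase A cur q r dep Q₀ (Q :: ph) base Q s') ∧
      t + spent A s ≤ 300 * n + 200 + spent A s' ∧ s'.queue.length + spent A s ≤ spent A s' := by
  have hQ : 1 ≤ Q := by
    have := (one_le_radius (E := cur) hn).trans hR
    exact_mod_cast this
  obtain ⟨E, hE, hdep⟩ := hshort
  have hnn : n * (ph.length + 1) ≤ n * n := Nat.mul_le_mul_left n (by omega)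
  rw [Nat.mul_add, Nat.mul_one] at hnn
  refine WP.conseq (newPhase_spec hA (by omega) hs hq hQ hQn h0 h1 h16 h22 htree hE hdep hfleet
    hqueue (by omega) hw.sq hw.acc) ?_
  rintro s' t hb hF ⟨hW, ⟨new, hnew, hd, hc, hcn, hcov⟩, ht, hql⟩
  refine ⟨⟨_, (hF.var 0 rfl).trans h0, (hF.var 1 rfl).trans h1, (hF.var 16 rfl).trans h16,
    (hF.var 22 rfl).trans h22, fun u => ?_, ⟨E, hE, hdep⟩, hR, hQn, hW, ?_, ?_, ?_, ?_, ?_, ?_⟩,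
    ht, hql⟩
  · have : s'.arr 4 = s.arr 4 := hF.arr 4 rfl
    rw [this]; exact htree u
  · intro u
    obtain ⟨x, ⟨I, hI, hx⟩, hu⟩ := hcov u
    obtain ⟨i, hi⟩ := List.mem_iff_getElem?.mp hI
    refine ⟨x, ⟨s.insts.length + i, I, by omega, ?_, hx⟩, hu⟩
    rw [hnew, List.getElem?_append_right (by omega), Nat.add_sub_cancel_left, hi]
  · intro Q' hQ'
    rcases List.mem_cons.mp hQ' with rfl | h
    · exact ⟨le_rfl, hQ₀⟩
    · exact hmem Q' h
  · simpa using hlen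
  · rw [phaseBound_eq hQ] at hbound
    simp only [List.length_cons]
    omega
  · rw [hnew]
    simp only [List.length_append, List.length_cons, Nat.mul_add, Nat.mul_one]
    omega
  · intro F
    rw [hnew, List.map_append, List.sum_append, List.map_cons, List.sum_cons, add_comm]
    refine add_le_add ?_ (hsum F)
    rw [List.map_congr_left (g := fun _ => F Q) fun I hI => by rw [hd I hI]]
    simp only [List.map_const', List.sum_replicate, nsmul_eq_mul]
    gcongr

/-- Each unit of black-box time is charged `81` times: once for itself and `80` times for a report
that it may have produced. The charge `600 n` per phase covers the choice and the start of the
instances and the overhead of the loop. -/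
theorem advance_spec (hA : A.Correct)
    (hA' : ∀ I : Instance n, I.Admissible → (A.output I).length ≤ A.cost I) (hn : 2 ≤ n)
    (hs : IsSimple cur) (hq : 1 ≤ q) (hw : LargeWords w n q)
    (h : Phase A cur q r dep Q₀ ph base Q s) (hqueue : s.queue = []) :
    WP A w cur advance s fun s' t => (∃ ph' base' Q', Phase A cur q r dep Q₀ ph' base' Q' s' ∧
      t + 81 * spent A s + 600 * n * ph.length ≤ 81 * spent A s' + 600 * n * ph'.length + 2) ∧
      s'.queue = [] ∧ s'.var 27 = 0 := by
  refine WP.loop (fun s' t => (∃ ph' base' Q', Phase A cur q r dep Q₀ ph' base' Q' s' ∧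
      t + 81 * spent A s + 600 * n * ph.length ≤ 81 * spent A s' + 600 * n * ph'.length) ∧
      s'.queue = []) (fun s' => s'.var 22) ?_ ?_ ?_ ?_
  · exact ⟨⟨ph, base, Q, h, by omega⟩, hqueue⟩
  · simp
  · rintro s' t hb hF ⟨⟨ph', base', Q', h', ht⟩, hqueue'⟩ hv
    simp at hv
    have hw0 := hb.pos
    have hR := h'.radius_le_of_full hA hs hq hqueue' hv
    have hacc := hw.acc
    have hQ' := h'.one_le hn
    have hlen := h'.phases_length
    have hbound := h'.phases_bound
    have hQn := h'.est_lt
    have hwt := h'.watch.fleet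
    have hdec : Q' - (Q' / (8 * q) + 1) + 1 ≤ Q' := by
      generalize Q' / (8 * q) = g
      omega
    apply WP.seq
    refine WP.assign (by
      have h1 : Q' / (8 * q) ≤ Q' := Nat.div_le_self _ _
      have h2 := h'.est_eq ▸ hb.var 22
      have h3 := hw.sq
      simp [h'.est_eq, h'.q_eq]; omega) ?_
    simp only [Expr.val_sub, Expr.val_add, Expr.val_div, Expr.val_mul, Expr.val_const,
      Expr.val_var, h'.est_eq, h'.q_eq]
    generalize Q' - (Q' / (8 * q) + 1) = Q'' at *
    apply WP.seq
    refine WP.conseq (start_phase (q := q) (r := r) (dep := dep) (Q₀ := Q₀) (ph := ph') (Q := Q'')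
      hA' hn hs hq (by simpa using h'.n_eq) (by simpa using h'.q_eq) (by simpa using h'.root_eq)
      (by simp) h'.tree h'.tree_short hR (by omega) (hwt.congr (by simp) rfl rfl rfl) hqueue'
      (fun x hx => by have := h'.phases_mem x hx; omega)
      (by
        -- Without a recorded phase there would be no instance, but the cover provides one for `r`.
        -- Any recorded phase shows that the new estimate is at most `Q₀`.
        obtain ⟨x, hx⟩ : ∃ x, x ∈ ph' := by
          rcases ph' with _ | ⟨x, l⟩
          · have h1 := h'.length_insts
            simp at h1
            obtain ⟨x, ⟨j, I, -, hI, -⟩, -⟩ := h'.cover r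
            simp [h1] at hI
          · exact ⟨x, by simp⟩
        have := h'.phases_mem x hx
        omega)
      (by omega) hbound h'.length_insts h'.sum_insts hw) ?_
    rintro s₁ t₁ hb₁ hF₁ ⟨⟨base₁, h₁⟩, ht₁, hql₁⟩
    refine WP.conseq (h₁.drain hw) ?_
    rintro s₂ t₂ hb₂ hF₂ ⟨h₂, hq₂, ht₂⟩
    have hsp : spent A (s'.put 22 Q'') = spent A s' := by simp [spent]
    have hsp₂ : spent A s₂ = spent A s₁ := by
      have := hF₂.insts rfl
      simp [spent, this]
    rw [hsp] at ht₁ hql₁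
    refine ⟨⟨⟨_, _, _, h₂, ?_⟩, hq₂⟩, ?_⟩
    · rw [hsp₂, List.length_cons, Nat.mul_add, Nat.mul_one]
      simp
      omega
    · rw [h₂.est_eq]
      omega
  · rintro s' t hb hF ⟨⟨ph', base', Q', h', ht⟩, hqueue'⟩ hv
    exact ⟨⟨ph', base', Q', h', by simp; omega⟩, hqueue', by simpa using hv⟩

theorem finish_spec (hA : A.Correct)
    (hA' : ∀ I : Instance n, I.Admissible → (A.output I).length ≤ A.cost I) (hn : 2 ≤ n)
    (hs : IsSimple cur) (hq : 1 ≤ q) (hw : LargeWords w n q)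
    (h : Phase A cur q r dep Q₀ ph base Q s) :
    WP A w cur finish s fun s' t => (∃ ph' base' Q', Phase A cur q r dep Q₀ ph' base' Q' s' ∧
      s'.var 5 = Q' + 1 ∧ (∀ R : ℕ, radius cur ≤ R → q * Q' ≤ (q + 1) * R) ∧
      t + 81 * spent A s + 600 * n * ph.length ≤
        80 * s.queue.length + 81 * spent A s' + 600 * n * ph'.length + 40) ∧
      s'.queue = [] := by
  unfold finish
  apply WP.seq
  refine WP.conseq (h.drain hw) ?_
  rintro s₁ t₁ hb₁ hF₁ ⟨h₁, hq₁, ht₁⟩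
  have hsp₁ : spent A s₁ = spent A s := by
    have := hF₁.insts rfl
    simp [spent, this]
  apply WP.seq
  refine WP.conseq (advance_spec hA hA' hn hs hq hw h₁ hq₁) ?_
  rintro s₂ t₂ hb₂ hF₂ ⟨⟨ph', base', Q', h₂, ht₂⟩, hq₂, hv₂⟩
  have hw0 := hb₂.pos
  have hsq := hw.sq
  have hQ' := h₂.est_lt
  refine WP.assign (by simp [h₂.est_eq]; omega) ⟨⟨ph', base', Q', h₂.congr ?_ ?_ ?_ ?_ rfl rfl
    (h₂.watch.congr ?_ ?_ ?_ ?_ rfl rfl rfl rfl), ?_, ?_, ?_⟩, hq₂⟩ <;> try (simp; done)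
  · simp [h₂.est_eq]
  · exact fun R hR => h₂.mul_le hA hn hs hq hq₂ hv₂ hR
  · rw [hsp₁] at ht₂
    simp [spent] at ht₂ ⊢
    omega

end

end IncRadius


namespace IncRadius

variable {n : ℕ} {E E' : List (Fin n × Fin n)} {A : BlackBox} {w : ℕ} {cur : List (Fin n × Fin n)}

/-! ### The algorithm -/

theorem IsSimple.length_le (h : IsSimple E) : E.length ≤ n * n := by
  simpa using h.1.length_le_card

/-- Every vertex other than `v` is the head of an edge. With fewer than `n - 1` edges the radius is
therefore infinite, and no search is needed. -/
theorem ReachesAll.le_length {v : Fin n} (h : ReachesAll E v) : n ≤ E.length + 1 := by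
  have hsub : (Finset.univ.erase v) ⊆ (E.map Prod.snd).toFinset := by
    intro u hu
    have hne := Finset.ne_of_mem_erase hu
    obtain ⟨l, hl⟩ := h u
    cases hl with
    | nil => exact absurd rfl hne
    | snoc _ he => exact List.mem_toFinset.mpr (List.mem_map.mpr ⟨_, he, rfl⟩)
  have h1 := (Finset.card_le_card hsub).trans (List.toFinset_card_le _)
  rw [Finset.card_erase_of_mem (Finset.mem_univ v), Finset.card_univ, Fintype.card_fin,
    List.length_map] at h1
  omega

/-- Look for a root if there are enough edges. If one is found, then start the first phase. -/
def tryFind : Cmd :=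
  .ite (.var 2 +ₑ .const 1 <ₑ .var 0) .skip (
    scan ;;
    .ite (.var 16) (estimateRadius ;; newPhase ;; finish) .skip)

/-- Initialization. -/
def setup : Cmd :=
  .ite (.var 0 =ₑ .const 1) (5 ≔ .const 1) (build ;; tryFind)

/-- Add the new edge to the adjacency lists. -/
def addEdge : Cmd :=
  .store 0 (.var 2) (.var 3) ;;
  .store 1 (.var 2) (.var 4) ;;
  13 ≔ .var 2 ;;
  link ;;
  2 ≔ .var 2 +ₑ .const 1

/-- The reaction to an insertion. -/
def update : Cmd :=
  .ite (.var 16) finish (addEdge ;; tryFind)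

/-- The state of the program before a root has been found. -/
structure Idle (cur : List (Fin n × Fin n)) (q : ℕ) (s : Config n) : Prop where
  adj : Adj cur s
  n_eq : s.var 0 = n
  q_eq : s.var 1 = q
  m_eq : s.var 2 = cur.length
  ans_eq : s.var 5 = 0
  root_eq : s.var 16 = 0
  ninst_eq : s.var 26 = 0
  insts_eq : s.insts = []
  queue_eq : s.queue = []
  tree_zero : ∀ i, n * n ≤ i → s.arr 4 i = 0
  flag_zero : ∀ i, s.arr 8 i = 0
  count_zero : ∀ i, s.arr 9 i = 0

/-- The state of the program when the radius is finite and the answer is right. At most the time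
`X` has been used for finding the root and for the insertions. -/
def Solved (A : BlackBox) (cur : List (Fin n × Fin n)) (q R₀ X : ℕ) (s : Config n) (t : ℕ) : Prop :=
  ∃ r dep Q₀ ph base Q, Phase A cur q r dep Q₀ ph base Q s ∧ s.queue = [] ∧ s.var 5 = Q + 1 ∧
    (∀ R : ℕ, radius cur ≤ R → q * Q ≤ (q + 1) * R) ∧ Q₀ ≤ 2 * R₀ ∧
    t ≤ X + 81 * spent A s + 600 * n * ph.length

theorem Solved.mono {q R₀ X X' t t' : ℕ} {s : Config n} (h : Solved A cur q R₀ X s t)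
    (ht : t' + X ≤ t + X') : Solved A cur q R₀ X' s t' := by
  obtain ⟨r, dep, Q₀, ph, base, Q, h1, h2, h3, h4, h5, h6⟩ := h
  exact ⟨r, dep, Q₀, ph, base, Q, h1, h2, h3, h4, h5, by omega⟩

section

variable {q : ℕ} {s : Config n}

theorem solve_spec {r : Fin n} {R : ℕ} (hA : A.Correct)
    (hA' : ∀ I : Instance n, I.Admissible → (A.output I).length ≤ A.cost I) (hn : 2 ≤ n)
    (hs : IsSimple cur) (hq : 1 ≤ q) (hw : LargeWords w n q) (hadj : Adj cur s) (h0 : s.var 0 = n)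
    (h1 : s.var 1 = q) (h16 : s.var 16 = r + 1) (h26 : s.var 26 = 0) (hi : s.insts = [])
    (hqueue : s.queue = []) (hr : ReachesAll cur r) (hR : radius cur = R)
    (hz : ∀ i, n * n ≤ i → s.arr 4 i = 0) (h8 : ∀ i, s.arr 8 i = 0) (h9 : ∀ i, s.arr 9 i = 0) :
    WP A w cur (estimateRadius ;; newPhase ;; finish) s fun s' t =>
      Solved A cur q R ((Nat.log 2 n + 1) * roundCost n cur.length R + 500) s' t := by
  apply WP.seq
  refine WP.conseq (estimateRadius_spec hadj hn h0 h16 hr hR hz hw.sq) ?_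
  rintro s₁ t₁ hb₁ hF₁ ⟨⟨dep, hdep, htree⟩, hR₁, hR₁', hQn, ht₁⟩
  have fi : s₁.insts = [] := (hF₁.insts rfl).trans hi
  have fq : s₁.queue = [] := (hF₁.queue rfl rfl).trans hqueue
  have f8 : s₁.arr 8 = s.arr 8 := hF₁.arr 8 rfl
  have f9 : s₁.arr 9 = s.arr 9 := hF₁.arr 9 rfl
  have f26 : s₁.var 26 = 0 := (hF₁.var 26 rfl).trans h26
  set Q := s₁.var 22 with hQ
  apply WP.seq
  refine WP.conseq (start_phase (q := q) (r := r) (dep := dep) (Q₀ := Q) (ph := []) (Q := Q) hA' hn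
    hs hq ((hF₁.var 0 rfl).trans h0) ((hF₁.var 1 rfl).trans h1) ((hF₁.var 16 rfl).trans h16) rfl
    htree ⟨cur, List.Subset.refl _, hdep⟩ (by rw [hR]; exact_mod_cast hR₁) hQn
    ⟨by simp [f26, fi], by simp [fi], fun j _ => by rw [f9]; exact h9 _,
      fun j v _ => by rw [f8]; exact h8 _⟩ fq (by simp) le_rfl (by simp; omega) (by simp)
    (by simp [fi]) (by simp [fi]) hw) ?_
  rintro s₂ t₂ hb₂ hF₂ ⟨⟨base, h₂⟩, ht₂, hql₂⟩
  have hsp : spent A s₁ = 0 := by simp [spent, fi]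
  refine WP.conseq (finish_spec hA hA' hn hs hq hw h₂) ?_
  rintro s₃ t₃ hb₃ hF₃ ⟨⟨ph', base', Q', h₃, h5, hsound, ht₃⟩, hq₃⟩
  refine ⟨r, dep, Q, ph', base', Q', h₃, hq₃, h5, hsound, hR₁', ?_⟩
  simp only [List.length_singleton] at ht₃
  omega

/-- The potential of all rows amounts to `40 n (m + n)`, which is `O(mn)` only if `n ≤ m + 1`. The
test on the number of edges defers the searches until this holds. -/
theorem tryFind_spec {F : Fin n → ℕ} (hA : A.Correct)
    (hA' : ∀ I : Instance n, I.Admissible → (A.output I).length ≤ A.cost I) (hn : 2 ≤ n)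
    (hs : IsSimple cur) (hq : 1 ≤ q) (hw : LargeWords w n q)
    (hF : ∀ u, degTo cur u cur.length ≤ F u) (h : Idle cur q s) (hrow : ∀ v, RowPre cur v s) :
    WP A w cur tryFind s fun s' t =>
      (cur.length + 1 < n ∧ s' = s ∧ t ≤ 20) ∨
      (n ≤ cur.length + 1 ∧ radius cur = ⊤ ∧ Idle cur q s' ∧ (∀ v, RowOK cur v s') ∧
        t + ∑ v, rowPot F v s' ≤ ∑ v, rowPot F v s + 200 * n + 200) ∨
      ∃ R X, radius cur = (R : ℕ) ∧ Solved A cur q R X s' t ∧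
        X ≤ (∑ v, rowPot F v s) + (Nat.log 2 n + 1) * roundCost n cur.length R + 200 * n + 1000 ∧
        (ReachesAll cur ⟨0, by omega⟩ → RowZero ⟨0, by omega⟩ s →
          X ≤ ∑ u, 40 * (F u + 1) + (Nat.log 2 n + 1) * roundCost n cur.length R + 1000) := by
  refine WP.bdd fun hb => ?_
  have hw0 := hb.pos
  have hlen := hs.length_le
  have hsq := hw.sq
  unfold tryFind
  refine WP.ite (by simp [h.m_eq]; omega) (fun hlt => ?_) fun hlt => ?_
  · simp [h.m_eq, h.n_eq] at hlt
    exact WP.skip (Or.inl ⟨hlt, rfl, by simp⟩)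
  simp [h.m_eq, h.n_eq] at hlt
  apply WP.seq
  refine WP.conseq (scan_spec (F := F) (by omega) hF h.adj h.n_eq h.root_eq hrow hsq) ?_
  rintro s₁ t₁ hb₁ hF₁ ⟨hor, hkeep, ht₁, hfast⟩
  have hadj₁ : Adj cur s₁ := h.adj.congr (hF₁.arr 1 rfl) (hF₁.arr 2 rfl) (hF₁.arr 3 rfl)
  have e0 := (hF₁.var 0 rfl).trans h.n_eq
  have e1 := (hF₁.var 1 rfl).trans h.q_eq
  have e26 := (hF₁.var 26 rfl).trans h.ninst_eq
  have ei : s₁.insts = [] := (hF₁.insts rfl).trans h.insts_eq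
  have eq' : s₁.queue = [] := (hF₁.queue rfl rfl).trans h.queue_eq
  have e4 : ∀ i, n * n ≤ i → s₁.arr 4 i = 0 := fun i hi => by rw [hkeep i hi, h.tree_zero i hi]
  have e8 : ∀ i, s₁.arr 8 i = 0 := fun i => by rw [hF₁.arr 8 rfl, h.flag_zero]
  have e9 : ∀ i, s₁.arr 9 i = 0 := fun i => by rw [hF₁.arr 9 rfl, h.count_zero]
  refine WP.ite (by simp) (fun hv => ?_) fun hv => ?_
  · simp at hv
    obtain ⟨r, h16, hr⟩ := hor.resolve_right fun h' => hv h'.1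
    obtain ⟨R, hR, -⟩ := hr.exists_radius
    refine WP.conseq (solve_spec hA hA' hn hs hq hw hadj₁ e0 e1 h16 e26 ei eq' hr hR e4 e8 e9) ?_
    rintro s' t hb' hF' hsol
    refine Or.inr (Or.inr ⟨R, t₁ + (Nat.log 2 n + 1) * roundCost n cur.length R + 600, hR,
      hsol.mono (by simp; omega), by omega, fun h1 h2 => ?_⟩)
    have := (hfast h1 h2).2
    omega
  · simp at hv
    obtain ⟨h16, hno, hok⟩ := hor.resolve_left fun ⟨r, h', _⟩ => by omega
    refine WP.skip (Or.inr (Or.inl ⟨by omega, radius_eq_top hno, ⟨hadj₁, e0, e1,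
      (hF₁.var 2 rfl).trans h.m_eq, (hF₁.var 5 rfl).trans h.ans_eq, h16, e26, ei, eq', e4, e8, e9⟩,
      hok, ?_⟩))
    simp
    omega

theorem addEdge_spec {e : Fin n × Fin n} (h : Idle cur q s) (h3 : s.var 3 = e.1)
    (h4 : s.var 4 = e.2) (hlen : cur.length + 1 < 2 ^ w) (cur' : List (Fin n × Fin n)) :
    WP A w cur' addEdge s fun s' t => Idle (cur ++ [e]) q s' ∧ t ≤ 50 := by
  refine WP.bdd fun hb => ?_
  have hw0 := hb.pos
  have hne : ∀ i e', cur[i]? = some e' → i ≠ cur.length := fun i e' he =>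
    (List.getElem?_eq_some_iff.mp he).1.ne
  unfold addEdge
  apply WP.seq
  refine WP.store (by simp) (by simp) ?_
  apply WP.seq
  refine WP.store (by simp) (by simp) ?_
  apply WP.seq
  refine WP.assign (by simp) ?_
  apply WP.seq
  refine WP.conseq (link_spec (E := cur ++ [e]) (j := cur.length) (e := e) (by simp [h.m_eq])
    (by simp) (by simp [h.m_eq, h3]) ⟨?_, ?_⟩ hlen) ?_
  · intro u
    simpa using (h.adj.adjTo_append e).first u
  · intro i e' hi he'
    simpa using (h.adj.adjTo_append e).next i e' hi he'
  rintro s₁ t₁ hb₁ hF₁ ⟨hA₁, ht₁⟩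
  have f1 : s₁.arr 1 = _ := hF₁.arr 1 rfl
  have f2 : s₁.var 2 = cur.length := (hF₁.var 2 rfl).trans (by simpa using h.m_eq)
  have hadj : Adj (cur ++ [e]) s₁ := by
    refine AdjTo.adj (by simpa using hA₁) fun i e' he' => ?_
    rw [f1]
    rcases Nat.lt_or_ge i cur.length with hi | hi
    · rw [List.getElem?_append_left hi] at he'
      simp [h.m_eq, Function.update_of_ne hi.ne, h.adj.heads i e' he']
    · have hi' := (List.getElem?_eq_some_iff.mp he').1
      simp at hi'
      obtain rfl : i = cur.length := by omega
      simp at he'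
      simp [h.m_eq, h4, he']
  have f4 : s₁.arr 4 = s.arr 4 := hF₁.arr 4 rfl
  have f8 : s₁.arr 8 = s.arr 8 := hF₁.arr 8 rfl
  have f9 : s₁.arr 9 = s.arr 9 := hF₁.arr 9 rfl
  refine WP.assign (by simp [f2]; omega) ⟨⟨hadj.congr rfl rfl rfl, ?_, ?_, ?_, ?_, ?_, ?_, ?_, ?_,
    ?_, ?_, ?_⟩, ?_⟩
  · exact (hF₁.var 0 rfl).trans (by simpa using h.n_eq)
  · exact (hF₁.var 1 rfl).trans (by simpa using h.q_eq)
  · simp [f2]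
  · exact (hF₁.var 5 rfl).trans (by simpa using h.ans_eq)
  · exact (hF₁.var 16 rfl).trans (by simpa using h.root_eq)
  · exact (hF₁.var 26 rfl).trans (by simpa using h.ninst_eq)
  · exact (hF₁.insts rfl).trans h.insts_eq
  · exact (hF₁.queue rfl rfl).trans h.queue_eq
  · simpa [f4] using h.tree_zero
  · simpa [f8] using h.flag_zero
  · simpa [f9] using h.count_zero
  · simp
    omega

end

end IncRadius


namespace IncRadius

variable {n : ℕ} {E E' : List (Fin n × Fin n)} {A : BlackBox} {w : ℕ} {cur : List (Fin n × Fin n)}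

/-! ### Word size and the invariant of a whole run. -/

/-- The incremental algorithm for the radius. -/
def algorithm : Algorithm := ⟨setup, update, 8⟩

theorem lt_two_pow_wordSize (n q : ℕ) : (n + q + 1) ^ 8 ≤ 2 ^ algorithm.wordSize n q := by
  have h : n + q < 2 ^ (Nat.log 2 (n + q) + 1) := Nat.lt_pow_succ_log_self (by norm_num) _
  calc (n + q + 1) ^ 8 ≤ (2 ^ (Nat.log 2 (n + q) + 1)) ^ 8 := Nat.pow_le_pow_left h 8
    _ = 2 ^ algorithm.wordSize n q := by
      rw [← pow_mul, Nat.mul_comm]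
      rfl

/-- The largest numbers are flag indices, of order `n ^ 3` as there are at most `n * n` instances,
and the accuracy `8q + 1`. The word constant leaves five spare powers of `n + q + 1`, which absorb
the numerical constants. -/
theorem largeWords {q : ℕ} (hn : 2 ≤ n) (hq : 1 ≤ q) :
    LargeWords (algorithm.wordSize n q) n q := by
  have h := lt_two_pow_wordSize n q
  set x := n + q + 1 with hx
  have hx4 : 4 ≤ x := by omega
  have h5 : 4 ^ 5 ≤ x ^ 5 := Nat.pow_le_pow_left hx4 5
  have h8 : 1024 * x ^ 3 ≤ x ^ 8 := by
    calc 1024 * x ^ 3 ≤ x ^ 5 * x ^ 3 := Nat.mul_le_mul_right _ h5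
      _ = x ^ 8 := by ring
  have h1 : x * x * 1 ≤ x * x * x := Nat.mul_le_mul_left _ (by omega)
  have h2 : x * 4 ≤ x * x := Nat.mul_le_mul_left _ hx4
  have h3 : x ^ 3 = x * x * x := by ring
  have hnx : n ≤ x := by omega
  have h4 : n * n ≤ x * x := Nat.mul_le_mul hnx hnx
  have h6 : n * n * n ≤ x * x * x := Nat.mul_le_mul h4 hnx
  exact ⟨by omega, by omega, by omega⟩

theorem Bdd.initial {q : ℕ} (hw : 1 < 2 ^ w) (start : List (Fin n × Fin n)) :
    Bdd w (Config.initial w q start) :=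
  ⟨hw, fun _ => Nat.mod_lt _ (by positivity), fun _ _ => Nat.mod_lt _ (by positivity)⟩

theorem rowPot_of_zero (F : Fin n → ℕ) {v : Fin n} {s : Config n} (h : RowZero v s) :
    rowPot F v s = ∑ u, 40 * (F u + 1) := by
  simp [rowPot, h.mem]

theorem sum_rowPot_of_zero (F : Fin n → ℕ) {s : Config n} (h : ∀ v, RowZero v s) :
    ∑ v, rowPot F v s = n * ∑ u, 40 * (F u + 1) := by
  simp [rowPot_of_zero F (h _)]

theorem roundCost_mono {m m' R : ℕ} (h : m ≤ m') : roundCost n m R ≤ roundCost n m' R :=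
  Nat.mul_le_mul_left _ (by omega)

/-- The state of the program after `i` insertions, and the time that it has used. -/
def Running (A : BlackBox) (start ins : List (Fin n × Fin n)) (q : ℕ) (F : Fin n → ℕ) (i : ℕ)
    (s : Config n) (t : ℕ) : Prop :=
  let cur := start ++ ins.take i
  let W := ∑ u, 40 * (F u + 1)
  (Idle cur q s ∧ radius cur = ⊤ ∧
    ((cur.length + 1 < n ∧ (∀ v, RowZero v s) ∧ t ≤ 300 * (cur.length + 1)) ∨
      (n ≤ cur.length + 1 ∧ (∀ v, RowOK cur v s) ∧
        t + ∑ v, rowPot F v s ≤ n * W + 1000 * n * (cur.length + 1)))) ∨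
  ∃ R X j, j ≤ i ∧ radius (start ++ ins.take j) = (R : ℕ) ∧ Solved A cur q R X s t ∧
    X ≤ n * W + (Nat.log 2 n + 1) * roundCost n (start ++ ins).length R +
      1000 * n * (cur.length + 1) + 1000 ∧
    (StronglyConnected start → X ≤ W + (Nat.log 2 n + 1) * roundCost n (start ++ ins).length R +
      1000 * (cur.length + 1) + 1000)

section

variable {q : ℕ} {start ins : List (Fin n × Fin n)}

theorem length_take_le {i : ℕ} : (start ++ ins.take i).length ≤ (start ++ ins).length := by
  simp

/-- Degrees only grow, so the final degrees may be used in the potential at all times. -/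
theorem degTo_take_le (u : Fin n) (i : ℕ) :
    degTo (start ++ ins.take i) u (start ++ ins.take i).length ≤
      degTo (start ++ ins) u (start ++ ins).length := by
  have h : start ++ ins = (start ++ ins.take i) ++ ins.drop i := by simp
  have h1 := degTo_append (E := start ++ ins.take i) u (ins.drop i) le_rfl
  rw [← h] at h1
  rw [← h1]
  exact degTo_mono u length_take_le

theorem IsSimple.take (hs : IsSimple (start ++ ins)) (i : ℕ) :
    IsSimple (start ++ ins.take i) := by
  have hsub : (start ++ ins.take i).Sublist (start ++ ins) :=
    (List.Sublist.refl start).append (List.take_sublist i ins)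
  exact ⟨hs.1.sublist hsub, fun e he => hs.2 e (hsub.subset he)⟩

theorem setup_spec (hA : A.Correct)
    (hA' : ∀ I : Instance n, I.Admissible → (A.output I).length ≤ A.cost I) (hn : 2 ≤ n)
    (hq : 1 ≤ q) (hw : LargeWords w n q) (hs : IsSimple (start ++ ins)) :
    WP A w start setup (Config.initial w q start) fun s' t =>
      Running A start ins q (fun u => degTo (start ++ ins) u (start ++ ins).length) 0 s' t := by
  set F : Fin n → ℕ := fun u => degTo (start ++ ins) u (start ++ ins).length with hF
  refine WP.bdd fun hb => ?_
  have hw0 := hb.pos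
  have hsq := hw.sq
  have hacc := hw.acc
  have hs₀ : IsSimple start := by simpa using hs.take 0
  have hlen := hs₀.length_le
  have hn1 : (Config.initial w q start).var 0 = n := Nat.mod_eq_of_lt (by simp; omega)
  have hq1 : (Config.initial w q start).var 1 = q := Nat.mod_eq_of_lt (by simp; omega)
  have hm1 : (Config.initial w q start).var 2 = start.length := Nat.mod_eq_of_lt (by simp; omega)
  have hz : ∀ x, 3 ≤ x → (Config.initial w q start).var x = 0 := by
    intro x hx
    simp only [Config.initial]
    rw [if_neg (by omega), if_neg (by omega), if_neg (by omega), Nat.zero_mod]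
  have ha : ∀ a i, 2 ≤ a → (Config.initial w q start).arr a i = 0 := by
    intro a i hx
    simp only [Config.initial]
    rw [if_neg (by omega), if_neg (by omega), Nat.zero_mod]
  unfold setup
  refine WP.ite (by simp [hw0]) (fun hv => by simp [hn1] at hv; omega) fun _ => ?_
  apply WP.seq
  refine WP.conseq (build_spec (E := start) hm1 (fun i e he => ?_) (fun i e he => ?_)
    (fun i => ha 2 i le_rfl) (by omega)) ?_
  · have := e.1.2
    simp only [Config.initial, he]
    exact Nat.mod_eq_of_lt (by simp; omega)
  · have := e.2.2
    simp only [Config.initial, he]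
    exact Nat.mod_eq_of_lt (by simp; omega)
  rintro s₁ t₁ hb₁ hF₁ ⟨hadj, ht₁⟩
  have f4 : ∀ i, s₁.arr 4 i = 0 := fun i => by rw [hF₁.arr 4 rfl]; exact ha 4 i (by omega)
  have f6 : ∀ i, s₁.arr 6 i = 0 := fun i => by rw [hF₁.arr 6 rfl]; exact ha 6 i (by omega)
  have hidle : Idle start q s₁ := ⟨hadj, (hF₁.var 0 rfl).trans hn1, (hF₁.var 1 rfl).trans hq1,
    (hF₁.var 2 rfl).trans hm1, (hF₁.var 5 rfl).trans (hz 5 (by omega)),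
    (hF₁.var 16 rfl).trans (hz 16 (by omega)), (hF₁.var 26 rfl).trans (hz 26 (by omega)),
    hF₁.insts rfl, hF₁.queue rfl rfl, fun i _ => f4 i,
    fun i => by rw [hF₁.arr 8 rfl]; exact ha 8 i (by omega),
    fun i => by rw [hF₁.arr 9 rfl]; exact ha 9 i (by omega)⟩
  have hzero : ∀ v : Fin n, RowZero v s₁ := fun v => ⟨fun u => f4 _, f6 _⟩
  have hdeg : ∀ u, degTo start u start.length ≤ F u := fun u => by
    simpa [hF] using degTo_take_le (start := start) (ins := ins) u 0
  refine WP.conseq (tryFind_spec hA hA' hn hs₀ hq hw hdeg hidle fun v => Or.inl (hzero v)) ?_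
  rintro s' t' hb' hF' hor
  rw [sum_rowPot_of_zero F hzero] at hor
  have hnn : 1000 * n * (start.length + 1) = 1000 * (n * start.length) + 1000 * n := by ring
  have hnl : start.length ≤ n * start.length := Nat.le_mul_of_pos_left _ (by omega)
  have hLM : start.length ≤ (start ++ ins).length := by simp
  rcases hor with ⟨h1, rfl, ht⟩ | ⟨h1, h2, h3, h4, ht⟩ | ⟨R, X, hR, hsol, hX, hX'⟩
  · refine Or.inl ⟨by simpa using hidle, ?_, Or.inl ⟨by simpa using h1, hzero, ?_⟩⟩
    · refine radius_eq_top fun v hv => ?_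
      have := hv.le_length
      simp at this
      omega
    · simp
      omega
  · refine Or.inl ⟨by simpa using h3, by simpa using h2, Or.inr ⟨by simpa using h1,
      by simpa using h4, ?_⟩⟩
    simp only [List.take_zero, List.append_nil, Expr.size]
    omega
  · have hmono := Nat.mul_le_mul_left (Nat.log 2 n + 1) (roundCost_mono (n := n) (R := R) hLM)
    refine Or.inr ⟨R, X + (t₁ + 10), 0, le_rfl, by simpa using hR, ?_, ?_, ?_⟩
    · exact Solved.mono (t := t') (X := X) (by simpa using hsol) (by simp only [Expr.size]; omega)
    · simp only [List.take_zero, List.append_nil]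
      omega
    · intro hsc
      have := hX' (fun u => hsc _ u) (hzero _)
      simp only [List.take_zero, List.append_nil]
      omega

theorem update_spec {i : ℕ} {e : Fin n × Fin n} {s : Config n} {t : ℕ} (hA : A.Correct)
    (hA' : ∀ I : Instance n, I.Admissible → (A.output I).length ≤ A.cost I) (hn : 2 ≤ n)
    (hq : 1 ≤ q) (hw : LargeWords w n q) (hs : IsSimple (start ++ ins)) (he : ins[i]? = some e)
    (hrun : Running A start ins q (fun u => degTo (start ++ ins) u (start ++ ins).length) i s t) :
    WP A w (start ++ ins.take (i + 1)) update (s.insertEdge A w e).1 fun s' t' =>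
      Running A start ins q (fun u => degTo (start ++ ins) u (start ++ ins).length) (i + 1) s'
        (t + (s.insertEdge A w e).2 + t') := by
  set F : Fin n → ℕ := fun u => degTo (start ++ ins) u (start ++ ins).length with hF
  have hsq := hw.sq
  have htake : start ++ ins.take (i + 1) = (start ++ ins.take i) ++ [e] := by
    rw [List.take_add_one, he, List.append_assoc]; rfl
  have hs' := hs.take (i + 1)
  have hdeg := fun u => degTo_take_le (start := start) (ins := ins) u (i + 1)
  have hLM := length_take_le (start := start) (ins := ins) (i := i + 1)
  unfold Running at hrun ⊢
  simp only [htake] at hs' hdeg hLM ⊢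
  have hlen := hs'.length_le
  have hsub : start ⊆ start ++ ins.take i := by simp
  simp only at hrun
  generalize start ++ ins.take i = cur at *
  have hcl : (cur ++ [e]).length = cur.length + 1 := by simp
  rw [hcl] at hlen hLM ⊢
  have hnn : 1000 * n * (cur.length + 1 + 1) = 1000 * n * (cur.length + 1) + 1000 * n := by ring
  refine WP.bdd fun hb => ?_
  have hw0 := hb.pos
  unfold update
  rcases hrun with ⟨hidle, htop, hrow⟩ | ⟨R, X, j, hj, hR, hsol, hX, hX'⟩
  · rw [Config.insertEdge_eq (by omega)]
    simp only [hidle.insts_eq, List.map_nil, List.sum_nil, allMessages, List.mapIdx_nil,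
      List.flatten_nil, List.append_nil, Nat.add_zero]
    have hidle' : Idle cur q (((({ s with insts := [], queue := s.queue } : Config n).put 3
        e.1).put 4 e.2)) := by
      obtain ⟨h1, h2, h3, h4, h5, h6, h7, h8, h9, h10, h11, h12⟩ := hidle
      exact ⟨h1.congr rfl rfl rfl, by simpa, by simpa, by simpa, by simpa, by simpa, by simpa,
        rfl, h9, h10, h11, h12⟩
    refine WP.ite (by simp) (fun hv => by simp [hidle.root_eq] at hv) fun _ => ?_
    apply WP.seq
    refine WP.conseq (addEdge_spec hidle' (e := e) (by simp) (by simp) (by omega) _) ?_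
    rintro s₁ t₁ hb₁ hF₁ ⟨hidle₁, ht₁⟩
    have f4 : s₁.arr 4 = s.arr 4 := hF₁.arr 4 rfl
    have f6 : s₁.arr 6 = s.arr 6 := hF₁.arr 6 rfl
    have f3 : s₁.var 3 = e.1 := (hF₁.var 3 rfl).trans (by simp)
    have f3' : s₁.var 4 = e.2 := (hF₁.var 4 rfl).trans (by simp)
    have hpre : ∀ v, RowPre (cur ++ [e]) v s₁ := by
      intro v
      rcases hrow with ⟨-, hz, -⟩ | ⟨-, hok, -⟩
      · exact Or.inl ((hz v).congr (fun u => by rw [f4]) (by rw [f6]))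
      · exact Or.inr ⟨cur, e.1, e.2, rfl, f3, f3', (hok v).congr (fun u => by rw [f4]) (by rw [f6])⟩
    have hpot : ∑ v, rowPot F v s₁ = ∑ v, rowPot F v s := by simp only [rowPot, f4]
    refine WP.conseq (tryFind_spec (F := F) hA hA' hn hs' hq hw hdeg hidle₁ hpre) ?_
    rintro s' t' hb' hF' hor
    rw [hpot] at hor
    have hn1 : 1000 * (cur.length + 1) ≤ 1000 * n * (cur.length + 1) :=
      Nat.mul_le_mul_right _ (by omega)
    -- At the first scan the rows are still empty, and their full potential is added to the small
    -- time used before; later it is part of the invariant.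
    have hbudget : t + ∑ v, rowPot F v s ≤
        n * ∑ u, 40 * (F u + 1) + 1000 * n * (cur.length + 1) := by
      rcases hrow with ⟨-, hz, ht⟩ | ⟨-, -, ht⟩
      · rw [sum_rowPot_of_zero F hz]
        omega
      · exact ht
    rw [hcl] at hor
    rcases hor with ⟨h1, rfl, ht⟩ | ⟨h1, h2, h3, h4, ht⟩ | ⟨R, X, hR, hsol, hX, -⟩
    · refine Or.inl ⟨hidle₁, ?_, Or.inl ⟨h1, ?_, ?_⟩⟩
      · refine radius_eq_top fun v hv => ?_
        have := hv.le_length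
        simp at this
        omega
      · rcases hrow with ⟨-, hz, -⟩ | ⟨h2, -⟩
        · exact fun v => (hz v).congr (fun u => by rw [f4]) (by rw [f6])
        · omega
      · rcases hrow with ⟨-, -, ht⟩ | ⟨h2, -⟩
        · simp
          omega
        · omega
    · refine Or.inl ⟨h3, h2, Or.inr ⟨h1, h4, ?_⟩⟩
      simp only [Expr.size]
      omega
    · have hmono := Nat.mul_le_mul_left (Nat.log 2 n + 1) (roundCost_mono (n := n) (R := R) hLM)
      refine Or.inr ⟨R, X + t + 100, i + 1, le_rfl, by rw [htake]; exact hR,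
        hsol.mono (by simp only [Expr.size]; omega), by omega, fun hsc => absurd htop ?_⟩
      -- A strongly connected initial graph has finite radius throughout, so then the root was
      -- already found during the setup.
      obtain ⟨R', hR', -⟩ := ReachesAll.exists_radius (v := ⟨0, by omega⟩) fun u => hsc _ u
      refine ne_top_of_le_ne_top (ENat.natCast_ne_top R') ?_
      rw [← hR']
      exact radius_antitone hsub
  · obtain ⟨r, dep, Q₀, ph, base, Q, h1, h2, h3, h4, h5, h6⟩ := hsol
    have h7 := h1.insertEdge (w := w) e (by omega)
    refine WP.ite (by simp) (fun _ => ?_) fun hv => by simp [h7.root_eq] at hv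
    refine WP.conseq (finish_spec hA hA' hn hs' hq hw h7) ?_
    rintro s' t' hb' hF' ⟨⟨ph', base', Q', h8, h9, h10, h11⟩, h12⟩
    have hq' := length_queue_insertEdge_le (w := w) hA' hs' h1.watch.fleet
    rw [h2, List.length_nil, Nat.zero_add] at hq'
    rw [spent_insertEdge] at h11
    refine Or.inr ⟨R, X + 50, j, by omega, hR, ⟨r, dep, Q₀, ph', base', Q', h8, h12, h9, h10, h5,
      ?_⟩, by omega, fun hsc => by have := hX' hsc; omega⟩
    simp only [Expr.size]
    omega

end

end IncRadius


namespace IncRadius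

variable {n : ℕ} {E E' : List (Fin n × Fin n)} {A : BlackBox} {w : ℕ} {cur : List (Fin n × Fin n)}

theorem exists_run {q : ℕ} {start ins : List (Fin n × Fin n)} (hA : A.Correct)
    (hA' : ∀ I : Instance n, I.Admissible → (A.output I).length ≤ A.cost I) (hn : 2 ≤ n)
    (hq : 1 ≤ q) (hs : IsSimple (start ++ ins)) : ∀ i ≤ ins.length, ∃ s t,
      algorithm.RunsTo A q start (ins.take i) s t ∧ Bdd (algorithm.wordSize n q) s ∧
      Running A start ins q (fun u => degTo (start ++ ins) u (start ++ ins).length) i s t := by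
  have hw := largeWords hn hq
  intro i
  induction i with
  | zero =>
    intro _
    have hb : Bdd (algorithm.wordSize n q) (Config.initial (algorithm.wordSize n q) q start) :=
      Bdd.initial (by have := hw.acc; omega) start
    obtain ⟨s, t, hex, hrun⟩ := setup_spec hA hA' hn hq hw hs hb
    exact ⟨s, t, .setup hex, hex.bdd hb, hrun⟩
  | succ i ih =>
    intro hi
    obtain ⟨s, t, hto, hb, hrun⟩ := ih (by omega)
    have he : ins[i]? = some ins[i] := List.getElem?_eq_getElem (by omega)
    have htake : ins.take (i + 1) = ins.take i ++ [ins[i]] := by simp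
    have hb' := hb.insertEdge (A := A) ins[i]
    obtain ⟨s', t', hex, hrun'⟩ := update_spec hA hA' hn hq hw hs he hrun hb'
    rw [htake] at hex
    refine ⟨s', _, ?_, hex.bdd hb', hrun'⟩
    rw [htake]
    exact .insert ins[i] hto hex

/-! ### The running time -/

theorem PolynomialGrowth.pow {K : ℝ≥0} {T : ℕ → ℕ → ℕ → ℝ≥0 → ℝ≥0} (hT : PolynomialGrowth K T)
    {m k : ℕ} {δ : ℝ≥0} (hk : 1 ≤ k) (hδ : 0 < δ) (j : ℕ) :
    T n m (2 ^ j * k) (δ / 2 ^ j) ≤ K ^ j * T n m k δ := by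
  induction j with
  | zero => simp
  | succ j ih =>
    have h := (hT n m (2 ^ j * k) (δ / 2 ^ j) (Nat.mul_pos (by positivity) hk) (by positivity)).2
    rw [show 2 ^ (j + 1) * k = 2 * (2 ^ j * k) by ring,
      show δ / 2 ^ (j + 1) = δ / 2 ^ j / 2 by rw [pow_succ, div_div]]
    refine h.trans ?_
    rw [pow_succ', mul_assoc]
    gcongr

/-- Five doublings lead from `(k', δ)` to `(32 k', δ/32)`, which dominates `(k, δ')` by
monotonicity. -/
theorem PolynomialGrowth.le {K : ℝ≥0} {T : ℕ → ℕ → ℕ → ℝ≥0 → ℝ≥0} (hT : PolynomialGrowth K T)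
    {m k k' : ℕ} {δ δ' : ℝ≥0} (hk : 1 ≤ k) (hk' : k ≤ k') (hδ : 0 < δ) (hδ' : 0 < δ')
    (h : δ / 32 ≤ δ') : T n m k δ' ≤ K ^ 5 * T n m k' δ := by
  have h1 := hT.pow (n := n) (m := m) (hk.trans hk') hδ 5
  refine le_trans ?_ h1
  rcases le_total δ' (δ / 32) with h2 | h2
  · rw [show δ' = δ / 2 ^ 5 by rw [le_antisymm h2 h]; norm_num]
    exact (hT n m k _ hk (by positivity)).1 _ _ (by omega) (by positivity) le_rfl
  · refine (hT n m k _ hk hδ').1 _ _ (by omega) (by positivity) ?_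
    rw [show (2 : ℝ≥0) ^ 5 = 32 by norm_num]
    exact h

/-- `ε q < 1 + ε < 3` is where `ε < 2` enters: `q` and `1/ε` may be exchanged up to a constant. -/
theorem accuracy_bounds {ε : ℝ≥0} (hε : 0 < ε) (hε2 : ε < 2) :
    1 ≤ ⌈1 / ε⌉₊ ∧ (1 : ℝ) ≤ ε * ⌈1 / ε⌉₊ ∧ (ε : ℝ) * ⌈1 / ε⌉₊ ≤ 3 := by
  have hpos : (0 : ℝ) < ε := by exact_mod_cast hε
  have h2 : (ε : ℝ) < 2 := by exact_mod_cast hε2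
  have h1 : (1 / ε : ℝ≥0) ≤ ⌈1 / ε⌉₊ := Nat.le_ceil _
  have h3 : ((⌈1 / ε⌉₊ : ℕ) : ℝ≥0) < 1 / ε + 1 := Nat.ceil_lt_add_one (by positivity)
  have h1' : (1 / ε : ℝ) ≤ (⌈1 / ε⌉₊ : ℕ) := by exact_mod_cast h1
  have h3' : ((⌈1 / ε⌉₊ : ℕ) : ℝ) < 1 / ε + 1 := by exact_mod_cast h3
  refine ⟨Nat.one_le_iff_ne_zero.mpr (Nat.ceil_pos.mpr (by positivity)).ne', ?_, ?_⟩
  · rw [div_le_iff₀ hpos] at h1'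
    linarith
  · have := mul_lt_mul_of_pos_left h3' hpos
    rw [mul_add, mul_one_div_cancel hpos.ne'] at this
    linarith

section

variable {K ε : ℝ≥0} {T : ℕ → ℕ → ℕ → ℝ≥0 → ℝ≥0} {start ins : List (Fin n × Fin n)} {q : ℕ}

theorem le_maxTerm {R j r : ℕ} (hε : 0 < ε) (hj : j ≤ ins.length)
    (hR : radius (start ++ ins.take j) = (R : ℕ)) (hn : R < n) (hr : 1 ≤ r) (hrR : r ≤ R)
    (hfr : radius (start ++ ins) ≤ r) :
    ((T n (start ++ ins).length (2 * r) ε : ℝ) + (start ++ ins).length) * n ≤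
      maxTerm T ε start ins * (ε ^ 2 * r) := by
  have hmem : r ∈ radiusRange start ins := by
    simp only [radiusRange, Finset.mem_filter, Finset.mem_range]
    exact ⟨by omega, hfr, j, hj, by rw [hR]; exact ENat.natCast_ne_top R,
      by rw [hR]; exact_mod_cast hrR⟩
  have h := Finset.le_sup (f := fun r => (T n (start ++ ins).length (2 * r) ε +
    (start ++ ins).length) * n / (ε ^ 2 * r)) hmem
  have hr' : (0 : ℝ≥0) < r := by exact_mod_cast hr
  rw [div_le_iff₀ (by positivity)] at h
  exact_mod_cast h

/-- The number of the instances of a phase, times its estimate. -/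
theorem phase_size_mul_le {Q : ℕ} (hq : 1 ≤ q) (hQ : Q ≤ 2 * n) :
    (n / (Q / (8 * q) + 1) + 1) * Q ≤ 10 * (q * n) := by
  have h1 := Nat.lt_mul_div_succ Q (show 0 < 8 * q by omega)
  have h2 := Nat.div_mul_le_self n (Q / (8 * q) + 1)
  set k := Q / (8 * q) + 1
  calc (n / k + 1) * Q = n / k * Q + Q := by ring
    _ ≤ n / k * (8 * q * k) + 2 * n := by gcongr
    _ = 8 * q * (n / k * k) + 2 * n := by ring
    _ ≤ 8 * q * n + 2 * (q * n) := by
      have : n ≤ q * n := Nat.le_mul_of_pos_left _ (by omega)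
      gcongr
    _ = 10 * (q * n) := by ring

/-- The time of a phase. -/
theorem phase_cost_le {R j Q : ℕ} (hT : PolynomialGrowth K T) (hε : 0 < ε) (hε2 : ε < 2)
    (hj : j ≤ ins.length) (hR : radius (start ++ ins.take j) = (R : ℕ)) (hn : R < n)
    (hQ : 1 ≤ Q) (hQR : Q ≤ 2 * R) (hfQ : radius (start ++ ins) ≤ Q) :
    ((n / (Q / (8 * ⌈1 / ε⌉₊) + 1) + 1 : ℕ) : ℝ≥0) *
      T n (start ++ ins).length Q (((8 * ⌈1 / ε⌉₊ + 1 : ℕ) : ℝ≥0)⁻¹) ≤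
        30 * K ^ 5 * ε * maxTerm T ε start ins := by
  obtain ⟨hq, hq1, hq3⟩ := accuracy_bounds hε hε2
  set q := ⌈1 / ε⌉₊
  set M := (start ++ ins).length with hM
  have hR1 : 1 ≤ R := by omega
  have hfR : radius (start ++ ins) ≤ R := by
    rw [← hR]
    refine radius_antitone ?_
    intro x hx
    rcases List.mem_append.mp hx with h | h
    · simp [h]
    · simp [List.mem_of_mem_take h]
  -- Take the minimum of `Q` and `R`. It lies in the range of the maximum, and it differs from `Q`
  -- at most by the factor two because `Q ≤ 2R`.
  obtain ⟨r, hr1, hrR, hrQ, hQr, hfr⟩ : ∃ r, 1 ≤ r ∧ r ≤ R ∧ r ≤ Q ∧ Q ≤ 2 * r ∧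
      radius (start ++ ins) ≤ r := by
    rcases le_total Q R with h | h
    · exact ⟨Q, hQ, h, le_rfl, by omega, hfQ⟩
    · exact ⟨R, hR1, le_rfl, h, hQR, hfR⟩
  have hmax := le_maxTerm (T := T) hε hj hR hn hr1 hrR hfr
  have hsize := phase_size_mul_le (n := n) hq (show Q ≤ 2 * n by omega)
  have hεr : (0 : ℝ) < ε := by exact_mod_cast hε
  have hε2' : (ε : ℝ) < 2 := by exact_mod_cast hε2
  have hgrow := hT.le (n := n) (m := M) (k := Q) (k' := 2 * r) (δ := ε)
    (δ' := ((8 * q + 1 : ℕ) : ℝ≥0)⁻¹) hQ hQr hε (by positivity) (by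
      rw [le_inv_comm₀ (by positivity) (by positivity), inv_div, le_div_iff₀ hε]
      -- In fact at most `8 * 3 + 2 = 26`; `32` is the next power of two.
      have : ((8 * q + 1 : ℕ) : ℝ) * ε ≤ 32 := by push_cast; nlinarith
      exact_mod_cast this)
  set N := n / (Q / (8 * q) + 1) + 1
  have hN : (N : ℝ) * r ≤ 10 * (q * n) := by
    have : N * r ≤ 10 * (q * n) := (Nat.mul_le_mul_left N hrQ).trans hsize
    exact_mod_cast this
  set y := T n M (2 * r) ε
  set G := maxTerm T ε start ins
  have hr0 : (0 : ℝ) < r := by exact_mod_cast hr1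
  have hy0 : (0 : ℝ) ≤ y := y.2
  have hG0 : (0 : ℝ) ≤ G := G.2
  have key : (N : ℝ) * y ≤ 30 * ε * G := by
    refine le_of_mul_le_mul_right ?_ hr0
    have h0 : (y : ℝ) * n ≤ G * (ε ^ 2 * r) := by
      have : (0 : ℝ) ≤ (M : ℝ) * n := by positivity
      nlinarith
    calc (N : ℝ) * y * r = (N * r) * y := by ring
      _ ≤ 10 * (q * n) * y := by gcongr
      _ = 10 * q * (y * n) := by ring
      _ ≤ 10 * q * (G * (ε ^ 2 * r)) := by gcongr
      _ = 10 * (ε * q) * (ε * G * r) := by ring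
      _ ≤ 10 * 3 * (ε * G * r) := by gcongr
      _ = 30 * ε * G * r := by ring
  have key' : (N : ℝ≥0) * y ≤ 30 * ε * G := by exact_mod_cast key
  calc (N : ℝ≥0) * T n M Q (((8 * q + 1 : ℕ) : ℝ≥0)⁻¹) ≤ N * (K ^ 5 * y) := by gcongr
    _ = K ^ 5 * (N * y) := by ring
    _ ≤ K ^ 5 * (30 * ε * G) := by gcongr
    _ = 30 * K ^ 5 * ε * G := by ring

/-- The first estimate is less than `2n`, hence has at most `log n + 2` binary digits, and `8 (log n
+ 2) ≤ 16 (log n + 1)`. -/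
theorem length_phases_le {s : Config n} {r : Fin n} {dep : Fin n → ℕ} {Q₀ R base Q : ℕ}
    {ph : List ℕ} (h : Phase A cur q r dep Q₀ ph base Q s) (hq : 1 ≤ q) (hQ : Q₀ ≤ 2 * R)
    (hR : R < n) : ph.length ≤ 16 * q * (Nat.log 2 n + 1) := by
  have h1 : n < 2 ^ (Nat.log 2 n + 1) := Nat.lt_pow_succ_log_self (by norm_num) n
  have h2 := phaseBound_le hq (Nat.log 2 n + 2) Q₀ (by rw [pow_succ]; omega)
  have h3 := h.phases_bound
  nlinarith

/-- The time of all instances. -/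
theorem spent_le {s : Config n} {r : Fin n} {dep : Fin n → ℕ} {Q₀ R j base Q : ℕ} {ph : List ℕ}
    (hT : PolynomialGrowth K T) (hA : A.HasTotalTime T) (hε : 0 < ε) (hε2 : ε < 2) (hn : 2 ≤ n)
    (hs : IsSimple (start ++ ins))
    (h : Phase A (start ++ ins) ⌈1 / ε⌉₊ r dep Q₀ ph base Q s) (hj : j ≤ ins.length)
    (hR : radius (start ++ ins.take j) = (R : ℕ)) (hRn : R < n) (hQ : Q₀ ≤ 2 * R) :
    (spent A s : ℝ≥0) ≤ 1440 * K ^ 5 * (Nat.log 2 n + 1) * maxTerm T ε start ins := by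
  obtain ⟨hq, hq1, hq3⟩ := accuracy_bounds hε hε2
  have hlen := length_phases_le h hq hQ hRn
  have h1 : (spent A s : ℝ≥0) ≤ (s.insts.map fun I => T n (start ++ ins).length I.depth
      (((8 * ⌈1 / ε⌉₊ + 1 : ℕ) : ℝ≥0)⁻¹)).sum := by
    unfold spent
    have hinst := h.watch.fleet.inst
    generalize s.insts = l at hinst
    induction l with
    | nil => simp
    | cons I l ih =>
      have hI := hinst I (by simp)
      have h2 := (hA n I (Instance.admissible_of hs hI)).2
      rw [hI.1, hI.2.2.2] at h2
      rw [List.map_cons, List.sum_cons, List.map_cons, List.sum_cons, Nat.cast_add]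
      exact add_le_add h2 (ih fun J hJ => hinst J (by simp [hJ]))
  refine h1.trans ((h.sum_insts fun k => T n (start ++ ins).length k _).trans ?_)
  refine (List.sum_le_card_nsmul _ (30 * K ^ 5 * ε * maxTerm T ε start ins) ?_).trans ?_
  · intro x hx
    obtain ⟨Q', hQ', rfl⟩ := List.mem_map.mp hx
    obtain ⟨h2, h3⟩ := h.phases_mem Q' hQ'
    refine phase_cost_le hT hε hε2 hj hR hRn ((h.one_le hn).trans h2) (h3.trans hQ)
      (h.radius_le.trans (by exact_mod_cast h2))
  · rw [List.length_map, nsmul_eq_mul]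
    set q := ⌈1 / ε⌉₊
    -- A phase costs `ε` times the maximum, and there are `O(q log n)` phases; the two factors
    -- cancel.
    have hq3' : ε * q ≤ 3 := by exact_mod_cast hq3
    have hlen' : (ph.length : ℝ≥0) ≤ 16 * q * (Nat.log 2 n + 1) := by exact_mod_cast hlen
    set G := maxTerm T ε start ins
    calc (ph.length : ℝ≥0) * (30 * K ^ 5 * ε * G) ≤
          16 * q * (Nat.log 2 n + 1) * (30 * K ^ 5 * ε * G) := by gcongr
      _ = 480 * K ^ 5 * (Nat.log 2 n + 1) * G * (ε * q) := by ring
      _ ≤ 480 * K ^ 5 * (Nat.log 2 n + 1) * G * 3 := by gcongr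
      _ = 1440 * K ^ 5 * (Nat.log 2 n + 1) * G := by ring

end

end IncRadius


namespace IncRadius

variable {n : ℕ} {E E' : List (Fin n × Fin n)} {A : BlackBox} {w : ℕ} {cur : List (Fin n × Fin n)}

/-! ### Summation of the time, and the approximation guarantee. -/

theorem roundCost_mul_le {M R : ℕ} (hR : 1 ≤ R) (hRn : R < n) (hM : n ≤ M + 1) :
    roundCost n M R * R ≤ 14400 * (n * M) := by
  have h1 := Nat.div_mul_le_self (7 * n) R
  unfold roundCost
  calc (7 * n / R + 1) * (600 + 400 * (M + n)) * R
      = (7 * n / R * R + R) * (600 + 400 * (M + n)) := by ring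
    _ ≤ (7 * n + n) * (1800 * M) := Nat.mul_le_mul (by omega) (by omega)
    _ = 14400 * (n * M) := by ring

/-- The total time in terms of the maximum `G` in the theorem. -/
theorem total_le {M R q L p sp t X : ℕ} {G ε B : ℝ} (hε : 0 < ε) (hε2 : ε < 2) (hn : 2 ≤ n)
    (hR : 1 ≤ R) (hRn : R < n) (hM : n ≤ M + 1) (hG : (M : ℝ) * n ≤ G * (ε ^ 2 * R))
    (hq : ε * q ≤ 3) (hp : p ≤ 16 * q * (L + 1)) (hsp : (sp : ℝ) ≤ B * (L + 1) * G)
    (ht : t ≤ X + 81 * sp + 600 * n * p) :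
    (X ≤ n * (40 * (M + n)) + (L + 1) * roundCost n M R + 1000 * n * (M + 1) + 1000 →
      (t : ℝ) ≤ (200000 + 81 * B) * (L + 1) * (G + M * n)) ∧
    (X ≤ 40 * (M + n) + (L + 1) * roundCost n M R + 1000 * (M + 1) + 1000 →
      (t : ℝ) ≤ (200000 + 81 * B) * (L + 1) * G) := by
  have hR0 : (0 : ℝ) < R := by exact_mod_cast hR
  have hn0 : (0 : ℝ) < n := by exact_mod_cast (show 0 < n by omega)
  have hM0 : (0 : ℝ) < M := by exact_mod_cast (show 0 < M by omega)
  have hRn' : (R : ℝ) ≤ n := by exact_mod_cast hRn.le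
  have hRM : (R : ℝ) ≤ M := by exact_mod_cast (show R ≤ M by omega)
  have hε4 : ε ^ 2 ≤ 4 := by nlinarith
  have hG0 : 0 < G := by
    by_contra hcon
    have : G * (ε ^ 2 * R) ≤ 0 := mul_nonpos_of_nonpos_of_nonneg (by linarith) (by positivity)
    have : 0 < (M : ℝ) * n := by positivity
    linarith
  -- The factor `ε ^ 2` is kept here: it has to compensate the `O(q log n)` phases with overhead
  -- `O(n)` each.
  have hnG : (n : ℝ) ≤ ε ^ 2 * G := by
    refine le_of_mul_le_mul_left ?_ hM0
    calc (M : ℝ) * n ≤ ε ^ 2 * G * R := by linarith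
      _ ≤ ε ^ 2 * G * M := by gcongr
      _ = M * (ε ^ 2 * G) := by ring
  have hMG : (M : ℝ) ≤ 4 * G := by
    refine le_of_mul_le_mul_right ?_ hn0
    calc (M : ℝ) * n ≤ ε ^ 2 * G * R := by linarith
      _ ≤ 4 * G * n := by gcongr
  have hnG' : (n : ℝ) ≤ 4 * G := hnG.trans (by gcongr)
  have hround : (roundCost n M R : ℝ) ≤ 57600 * G := by
    refine le_of_mul_le_mul_right ?_ hR0
    have h1 : (roundCost n M R : ℝ) * R ≤ 14400 * (n * M) := by
      exact_mod_cast roundCost_mul_le hR hRn hM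
    calc (roundCost n M R : ℝ) * R ≤ 14400 * (ε ^ 2 * (G * R)) := by linarith
      _ ≤ 14400 * (4 * (G * R)) := by gcongr
      _ = 57600 * G * R := by ring
  have hL : (1 : ℝ) ≤ L + 1 := by
    have : (0 : ℝ) ≤ L := by positivity
    linarith
  set ℓ : ℝ := (L : ℝ) + 1 with hℓ
  have hp' : (n : ℝ) * p ≤ 96 * ℓ * G := by
    have h1 : (p : ℝ) ≤ 16 * q * ℓ := by rw [hℓ]; exact_mod_cast hp
    calc (n : ℝ) * p ≤ ε ^ 2 * G * (16 * q * ℓ) := by gcongr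
      _ = 16 * ℓ * G * (ε * (ε * q)) := by ring
      _ ≤ 16 * ℓ * G * (2 * 3) := by gcongr
      _ = 96 * ℓ * G := by ring
  have ht' : (t : ℝ) ≤ X + 81 * sp + 600 * (n * p) := by
    rw [← mul_assoc]
    exact_mod_cast ht
  have hℓround : ℓ * roundCost n M R ≤ 57600 * (ℓ * G) := by
    calc ℓ * roundCost n M R ≤ ℓ * (57600 * G) := by gcongr
      _ = 57600 * (ℓ * G) := by ring
  have hGℓ : G ≤ ℓ * G := le_mul_of_one_le_left hG0.le hL
  constructor
  · intro hX
    have h1 : 1 * M ≤ n * M := Nat.mul_le_mul_right M (by omega)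
    have h2 : n * 1 ≤ n * M := Nat.mul_le_mul_left n (by omega)
    have h3 : n * n ≤ n * (M + 1) := Nat.mul_le_mul_left n hM
    have hX1 : X ≤ 4000 * (n * M) + (L + 1) * roundCost n M R := by
      have h4 : n * (40 * (M + n)) = 40 * (n * M) + 40 * (n * n) := by ring
      have h5 : 1000 * n * (M + 1) = 1000 * (n * M) + 1000 * n := by ring
      have h6 : n * (M + 1) = n * M + n := by ring
      omega
    have hX2 : (X : ℝ) ≤ 4000 * (n * M) + ℓ * roundCost n M R := by
      rw [hℓ]; exact_mod_cast hX1
    have hnM : (n : ℝ) * M ≤ ℓ * (M * n) := by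
      rw [mul_comm]
      exact le_mul_of_one_le_left (by positivity) hL
    -- No sign of `B` is assumed; it follows from the bound for the nonnegative `sp`, as `G > 0`.
    have hB : 0 ≤ B * ℓ * (M * n) := by
      have h0 : 0 ≤ B * ℓ * G := le_trans (by positivity) hsp
      have h1 : 0 ≤ B * ℓ := nonneg_of_mul_nonneg_left h0 hG0
      positivity
    have hℓM : 0 ≤ ℓ * (M * n) := by positivity
    nlinarith
  · intro hX
    have hX1 : X ≤ 4000 * M + (L + 1) * roundCost n M R := by omega
    have hX2 : (X : ℝ) ≤ 4000 * M + ℓ * roundCost n M R := by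
      rw [hℓ]; exact_mod_cast hX1
    nlinarith

theorem sum_degTo_cost (E : List (Fin n × Fin n)) :
    ∑ u, 40 * (degTo E u E.length + 1) = 40 * (E.length + n) := by
  rw [← Finset.mul_sum, Finset.sum_add_distrib, sum_degTo le_rfl]
  simp

/-- Terms of order `n ^ 2` occur only when `n ≤ M + 1`, where they are `O(nM)`; with fewer edges the
time is linear in their number. -/
theorem idle_time_le {M L t : ℕ} {C G : ℝ} (hn : 2 ≤ n) (hM : 1 ≤ M) (hC : 5000 ≤ C) (hG : 0 ≤ G)
    (h : t ≤ 300 * (M + 1) ∨ (n ≤ M + 1 ∧ t ≤ n * (40 * (M + n)) + 1000 * n * (M + 1))) :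
    (t : ℝ) ≤ C * ((L : ℝ) + 1) * (G + M * n) := by
  have h1 : 1 * M ≤ n * M := Nat.mul_le_mul_right M (by omega)
  have h2 : n * 1 ≤ n * M := Nat.mul_le_mul_left n (by omega)
  have h3 : t ≤ 5000 * (M * n) := by
    rw [Nat.mul_comm M n]
    rcases h with h | ⟨hnM, h⟩
    · omega
    · have h3 : n * n ≤ n * (M + 1) := Nat.mul_le_mul_left n hnM
      have h4 : n * (40 * (M + n)) = 40 * (n * M) + 40 * (n * n) := by ring
      have h5 : 1000 * n * (M + 1) = 1000 * (n * M) + 1000 * n := by ring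
      have h6 : n * (M + 1) = n * M + n := by ring
      omega
  have h4 : (t : ℝ) ≤ 5000 * (M * n) := by exact_mod_cast h3
  have hL : (1 : ℝ) ≤ L + 1 := by
    have : (0 : ℝ) ≤ L := by positivity
    linarith
  calc (t : ℝ) ≤ 5000 * (M * n) := h4
    _ ≤ C * (M * n) := by gcongr
    _ ≤ C * ((L : ℝ) + 1) * (G + M * n) := by
      have h5 : (M : ℝ) * n ≤ (L + 1) * (G + M * n) := by
        have : (M : ℝ) * n ≤ G + M * n := by linarith
        refine this.trans (le_mul_of_one_le_left (by positivity) hL)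
      rw [mul_assoc]
      gcongr

theorem answer_of_zero {s : Config n} (h : s.var 5 = 0) : s.answer = ⊤ := by
  simp [Config.answer, h]

theorem answer_of_succ {s : Config n} {Q : ℕ} (h : s.var 5 = Q + 1) : s.answer = Q := by
  simp [Config.answer, h]

/-- The approximation guarantee. -/
theorem approx_le {ε : ℝ≥0} {Q R : ℕ} (hε : 0 < ε) (hε2 : ε < 2)
    (h : ⌈1 / ε⌉₊ * Q ≤ (⌈1 / ε⌉₊ + 1) * R) :
    ((Q : ℕ∞) : ℝ≥0∞) ≤ (1 + (ε : ℝ≥0∞)) * ((R : ℕ∞) : ℝ≥0∞) := by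
  obtain ⟨hq, hq1, -⟩ := accuracy_bounds hε hε2
  set q := ⌈1 / ε⌉₊
  have hq0 : (0 : ℝ) < q := by exact_mod_cast hq
  have h1 : (q : ℝ) * Q ≤ (q + 1) * R := by exact_mod_cast h
  have h2 : (Q : ℝ) ≤ (1 + ε) * R := by
    refine le_of_mul_le_mul_left ?_ hq0
    have : (0 : ℝ) ≤ R := by positivity
    nlinarith
  have h3 : (Q : ℝ≥0) ≤ (1 + ε) * R := by exact_mod_cast h2
  have h4 : ((Q : ℝ≥0) : ℝ≥0∞) ≤ (((1 + ε) * R : ℝ≥0) : ℝ≥0∞) := by exact_mod_cast h3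
  simpa using h4

theorem exists_run_one {q : ℕ} (hn : n = 1) : ∃ (s : Config n) (t : ℕ),
    algorithm.RunsTo A q [] [] s t ∧ s.var 5 = 1 := by
  subst hn
  have hw : 1 < 2 ^ algorithm.wordSize 1 q := by
    have h1 := lt_two_pow_wordSize 1 q
    have h2 : 2 ^ 8 ≤ (1 + q + 1) ^ 8 := Nat.pow_le_pow_left (by omega) 8
    omega
  have hw0 : algorithm.wordSize 1 q ≠ 0 := fun h => by simp [h] at hw
  have hb := Bdd.initial (q := q) hw ([] : List (Fin 1 × Fin 1))
  have hn1 : (Config.initial (algorithm.wordSize 1 q) q ([] : List (Fin 1 × Fin 1))).var 0 = 1 :=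
    Nat.mod_eq_of_lt (by simpa using hw)
  have h : WP A (algorithm.wordSize 1 q) [] setup
      (Config.initial (algorithm.wordSize 1 q) q ([] : List (Fin 1 × Fin 1)))
      fun s' _ => s'.var 5 = 1 := by
    unfold setup
    refine WP.ite (by simp [hw0]) (fun _ => WP.assign (by simp [hw0]) (by simp)) fun hv => ?_
    simp [hn1] at hv
  obtain ⟨s, t, hex, h5⟩ := h hb
  exact ⟨s, t, .setup hex, h5⟩

end IncRadius

theorem mainTheorem12 :
    ∃ (P : Algorithm) (c : ℕ), ∀ K : ℝ≥0, ∃ C : ℝ≥0,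
      ∀ (T : ℕ → ℕ → ℕ → ℝ≥0 → ℝ≥0) (A : BlackBox),
        PolynomialGrowth K T → A.Correct → A.HasTotalTime T →
      ∀ (n : ℕ) (ε : ℝ≥0) (start ins : List (Fin n × Fin n)),
        0 < n → 0 < ε → ε < 2 → IsSimple (start ++ ins) →
      ∃ (s : Config n) (t : ℕ), P.RunsTo A ⌈1 / ε⌉₊ start ins s t ∧
        radius (start ++ ins) ≤ s.answer ∧
        (s.answer : ℝ≥0∞) ≤ (1 + (ε : ℝ≥0∞)) * (radius (start ++ ins) : ℝ≥0∞) ∧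
        (start ++ ins ≠ [] →
          (t : ℝ≥0) ≤ C * ((Nat.log 2 n : ℝ≥0) + 1) ^ c *
            (maxTerm T ε start ins + (start ++ ins).length * n)) ∧
        (start ++ ins ≠ [] → StronglyConnected start →
          (t : ℝ≥0) ≤ C * ((Nat.log 2 n : ℝ≥0) + 1) ^ c * maxTerm T ε start ins) := by
  refine ⟨algorithm, 1, fun K => ⟨200000 + 81 * (1440 * K ^ 5), ?_⟩⟩
  intro T A hT hA hTime n ε start ins hn hε hε2 hs
  have hA' : ∀ I : Instance n, I.Admissible → (A.output I).length ≤ A.cost I :=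
    fun I hI => (hTime n I hI).1
  rcases Nat.lt_or_ge n 2 with hn2 | hn2
  -- A single vertex admits no edge, so there is just the setup, the radius is `0`, and the time
  -- bounds are void.
  · obtain rfl : n = 1 := by omega
    have hnil : start ++ ins = [] := by
      refine List.eq_nil_iff_forall_not_mem.mpr fun e he => hs.2 e he (Subsingleton.elim _ _)
    obtain ⟨rfl, rfl⟩ := List.append_eq_nil_iff.mp hnil
    obtain ⟨s, t, hrun, h5⟩ := exists_run_one (A := A) (q := ⌈1 / ε⌉₊) rfl
    have hecc : EccLE ([] : List (Fin 1 × Fin 1)) 0 0 := fun u => by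
      rw [Subsingleton.elim u 0]
      exact ⟨0, le_rfl, .nil _⟩
    have hrad : radius ([] : List (Fin 1 × Fin 1)) = 0 := by simpa using hecc.radius_le
    refine ⟨s, t, hrun, ?_, ?_, fun h => absurd rfl h, fun h => absurd rfl h⟩
    · simp [hrad]
    · rw [answer_of_succ (Q := 0) (by simpa using h5)]
      simp
  obtain ⟨hq, hq1, hq3⟩ := accuracy_bounds hε hε2
  obtain ⟨s, t, hrun, -, hst⟩ := exists_run hA hA' hn2 hq hs ins.length le_rfl
  rw [List.take_length] at hrun
  have hεr : (0 : ℝ) < ε := by exact_mod_cast hε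
  have hε2r : (ε : ℝ) < 2 := by exact_mod_cast hε2
  refine ⟨s, t, hrun, ?_⟩
  unfold Running at hst
  simp only [List.take_length, sum_degTo_cost] at hst
  rcases hst with ⟨hidle, htop, ht⟩ | ⟨R, X, j, hj, hR, hsol, hX, hX'⟩
  · rw [answer_of_zero hidle.ans_eq, htop]
    refine ⟨le_rfl, ?_, fun hne => ?_, fun _ hsc => absurd htop ?_⟩
    · rw [ENat.toENNReal_top, ENNReal.mul_top (by positivity)]
    · have hM : 1 ≤ (start ++ ins).length := List.length_pos_of_ne_nil hne
      have := idle_time_le (L := Nat.log 2 n) (t := t) (n := n) (G := maxTerm T ε start ins)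
        (C := 200000 + 81 * (1440 * K ^ 5)) hn2 hM
        (by have : (0 : ℝ) ≤ (K : ℝ) ^ 5 := by positivity
            linarith) (maxTerm T ε start ins).2 (by
          rcases ht with ⟨-, -, h⟩ | ⟨h1, -, h⟩
          · exact Or.inl h
          · exact Or.inr ⟨h1, by omega⟩)
      rw [pow_one]
      exact_mod_cast this
    -- An infinite final radius contradicts strong connectivity of the initial graph.
    · obtain ⟨R', hR', -⟩ := ReachesAll.exists_radius (E := start) (v := ⟨0, hn⟩) fun u => hsc _ u
      refine ne_top_of_le_ne_top (ENat.natCast_ne_top R') ?_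
      rw [← hR']
      exact radius_antitone (by simp)
  · obtain ⟨r, dep, Q₀, ph, base, Q, hph, hqueue, h5, hsound, hQ₀, ht⟩ := hsol
    obtain ⟨E, hE, hdep⟩ := hph.tree_short
    have hreach : ReachesAll (start ++ ins) r := fun u => ⟨_, (hdep u).1.mono hE⟩
    obtain ⟨Rf, hRf, hRfn⟩ := hreach.exists_radius
    have hfR : radius (start ++ ins) ≤ R := by
      rw [← hR]
      refine radius_antitone fun x hx => ?_
      rcases List.mem_append.mp hx with h | h
      · simp [h]
      · simp [List.mem_of_mem_take h]
    have hRn : R < n := by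
      obtain ⟨v, hv⟩ := exists_eccLE hn hR.le
      obtain ⟨R', hR', hRn'⟩ := ReachesAll.exists_radius (v := v) fun u =>
        (hv u).imp fun l hl => hl.2
      have : R = R' := by
        rw [hR] at hR'
        exact_mod_cast hR'
      omega
    have hR1 : 1 ≤ R := by
      have := (one_le_radius (E := start ++ ins) hn2).trans hfR
      exact_mod_cast this
    have hlen := length_phases_le hph hq hQ₀ hRn
    have hsp := spent_le hT hTime hε hε2 hn2 hs hph hj hR hRn hQ₀
    have hsp' : (spent A s : ℝ) ≤ 1440 * (K : ℝ) ^ 5 * (Nat.log 2 n + 1) *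
        maxTerm T ε start ins := by exact_mod_cast hsp
    have hmax := le_maxTerm (T := T) hε hj hR hRn hR1 le_rfl hfR
    have hG : ((start ++ ins).length : ℝ) * n ≤ maxTerm T ε start ins * (ε ^ 2 * R) := by
      refine le_trans ?_ hmax
      have : (0 : ℝ) ≤ T n (start ++ ins).length (2 * R) ε := NNReal.coe_nonneg _
      gcongr
      linarith
    obtain ⟨h1, h2⟩ := total_le hεr hε2r hn2 hR1 hRn hreach.le_length hG hq3 hlen hsp' ht
    rw [answer_of_succ h5]
    refine ⟨hph.radius_le, ?_, fun _ => ?_, fun _ hsc => ?_⟩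
    · rw [hRf]
      exact approx_le hε hε2 (hsound Rf hRf.le)
    · rw [pow_one]
      exact_mod_cast h1 hX
    · rw [pow_one]
      exact_mod_cast h2 (hX' hsc)
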